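/- **Setting.** Let $d\ge 1$, let $\Omega\subseteq\mathbb{R}^d$ be open, and let $(M_p)_{p\in\mathbb N}$ be a positive sequence with $M_0=1$ satisfying $(M.1)$ $M_p^2\le M_{p-1}M_{p+1}$ for $p\ge1$; $(M.2)$ $M_{p+q}\le AH^{p+q}M_pM_q$ for all $p,q$ and some $A,H\ge 1$; $(M.3)'$ $\sum_{p\ge1}M_{p-1}/M_p<\infty$. Let $M(t)=\sup_p\log(t^p/M_p)$, $t\ge0$. For compact $K\subset\Omega$ and $h>0$ put $\|\varphi\|_{K,h}=\sup_{x\in K,\,\alpha\in\mathbb N^d}|\varphi^{(\alpha)}(x)|/(h^{|\alpha|}M_{|\alpha|})$. Let $*$ be $(M_p)$ (Beurling) or $\{M_p\}$ (Roumieu; conditions in double parentheses). $\mathcal E^*(\Omega)$ is the space of $\varphi\in C^\infty(\Omega)$ such that for every compact $K\subset\Omega$, $\|\varphi\|_{K,h}<\infty$ for every $h>0$ ((for some $h>0$)). $\mathcal D^*(\Omega)$ is the space of compactly supported $\varphi\in C^\infty(\Omega)$ with $\|\varphi\|_{\operatorname{supp}\varphi,h}<\infty$ for every $h$ ((for some $h$)),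 with its usual inductive-limit topology, and ${\mathcal D^*}'(\Omega)$ is its dual, the space of ultradistributions of class $*$. The function $u\in\mathcal E^*(\Omega)$ is identified with the ultradistribution $\psi\mapsto\int_\Omega u\psi$. For nets $(f_\varepsilon)_{\varepsilon\in(0,1]}$ in $\mathcal E^*(\Omega)$, with all $O$'s as $\varepsilon\to0^+$, and for all compact $K\subset\Omega$: - moderate: $\forall h\,\exists k$ ((resp. $\forall k\,\exists h$)) $\ \|f_\varepsilon\|_{K,h}=O(e^{M(k/\varepsilon)})$; - regular: $\exists k\,\forall h$ ((resp. $\exists h\,\forall k$)) $\ \|f_\varepsilon\|_{K,h}=O(e^{M(k/\varepsilon)})$; - negligible: $\forall h\,\forall k$ ((resp. $\exists k\,\exists h$)) $\ \|f_\varepsilon\|_{K,h}=O(e^{-M(k/\varepsilon)})$, where $h,k>0$. $\mathcal G^*(\Omega)$ is the quotient of the moderate nets by the negligible nets, and $\mathcal G^{*,\infty}(\Omega)\subseteq\mathcal G^*(\Omega)$ is the set of classes of regular nets. Let $(N_p)$ be another positive sequence with $N_0=1$, $(M.1)$, $(M.3)'$, and associated function $N$, such that for every $l>0$ there is $C>0$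 with $2M(t)\le N(lt)+C$ for all $t\ge0$. Let $\phi$ be an even function whose Fourier transform $\widehat\phi(\xi)=\int\phi(x)e^{ix\cdot\xi}dx$ belongs to $\mathcal D^{(N_p)}(\mathbb R^d)$, equals $1$ for $|\xi|\le1$ and $0$ for $|\xi|\ge2$, and let $\phi_\varepsilon(x)=\varepsilon^{-d}\phi(x/\varepsilon)$. **Theorem.** For every $f\in{\mathcal D^*}'(\Omega)$ there is exactly one element $\iota(f)\in\mathcal G^*(\Omega)$ such that, whenever $\theta\in\mathcal D^*(\Omega)$ equals $1$ on an open set $U\subseteq\Omega$, the restriction of $\iota(f)$ to $U$ is the class in $\mathcal G^*(U)$ of the net $\big((\theta f)*\phi_\varepsilon\big)_\varepsilon$, where $((\theta f)*\phi_\varepsilon)(x)=\langle f,\theta\,\phi_\varepsilon(x-\cdot)\rangle$. For the map $\iota:{\mathcal D^*}'(\Omega)\to\mathcal G^*(\Omega)$ so defined, $$\mathcal G^{*,\infty}(\Omega)\cap\iota\big({\mathcal D^*}'(\Omega)\big)=\iota\big(\mathcal E^*(\Omega)\big),$$ and an ultradistribution $f\in{\mathcal D^*}'(\Omega)$ belongs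 to $\mathcal E^*(\Omega)$ if and only if $\iota(f)\in\mathcal G^{*,\infty}(\Omega)$. -/

import Mathlib

open scoped NNReal ContDiff
open MeasureTheory

noncomputable section

namespace UltraAlg

/-- The Euclidean space `ℝ^d`. -/
abbrev Euc (d : ℕ) := EuclideanSpace ℝ (Fin d)

/-! ### Weight sequences -/

/-- A positive weight sequence `(M_p)` with `M_0 = 1`, satisfying `(M.1)` and `(M.3)'`. -/
structure WeightSequence where
  seq : ℕ → ℝ
  pos : ∀ p, 0 < seq p
  zero : seq 0 = 1
  logConvex : ∀ p, seq (p + 1) ^ 2 ≤ seq p * seq (p + 2)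
  nonQuasianalytic : Summable fun p => seq p / seq (p + 1)

namespace WeightSequence

/-- Condition `(M.2)`. -/
def ModerateGrowth (M : WeightSequence) : Prop :=
  ∃ A H : ℝ, 1 ≤ A ∧ 1 ≤ H ∧ ∀ p q, M.seq (p + q) ≤ A * H ^ (p + q) * M.seq p * M.seq q

/-- The associated function `M(t) = sup_p log (t^p / M_p)`, for `t ≥ 0`. The supremum is finite,
by `exists_pow_le`; at `t = 0` the value is `0`. -/
def assoc (M : WeightSequence) (t : ℝ) : ℝ := ⨆ p : ℕ, Real.log (t ^ p / M.seq p)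

theorem exists_pow_le (M : WeightSequence) {t : ℝ} (ht : 0 ≤ t) :
    ∃ B : ℝ, 0 < B ∧ ∀ p, t ^ p ≤ B * M.seq p := by
  have h0 := M.nonQuasianalytic.tendsto_atTop_zero
  have h1 : ∀ᶠ p in Filter.atTop, M.seq p / M.seq (p + 1) < (t + 1)⁻¹ :=
    h0.eventually_lt_const (by positivity)
  obtain ⟨n, hn⟩ := Filter.eventually_atTop.1 h1
  have key : ∀ p, n ≤ p → t ^ p ≤ (t ^ n / M.seq n) * M.seq p := by
    intro p hp
    induction p, hp using Nat.le_induction with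
    | base => rw [div_mul_cancel₀ _ (M.pos n).ne']
    | succ p hp ih =>
      have h2 := hn p hp
      have hp0 := M.pos p
      have hp1 := M.pos (p + 1)
      rw [div_lt_iff₀ hp1, inv_mul_eq_div, lt_div_iff₀ (by positivity)] at h2
      have hM := M.pos n
      calc t ^ (p + 1) = t ^ p * t := pow_succ _ _
        _ ≤ (t ^ n / M.seq n * M.seq p) * t := by gcongr
        _ = (t ^ n / M.seq n) * (M.seq p * t) := by ring
        _ ≤ (t ^ n / M.seq n) * M.seq (p + 1) := by
          gcongr
          nlinarith
  refine ⟨(∑ p ∈ Finset.range (n + 1), t ^ p / M.seq p) + 1, ?_, ?_⟩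
  · have : 0 ≤ ∑ p ∈ Finset.range (n + 1), t ^ p / M.seq p :=
      Finset.sum_nonneg fun p _ => div_nonneg (by positivity) (M.pos p).le
    linarith
  · intro p
    have hsum : ∀ q, q ≤ n → t ^ q / M.seq q ≤ ∑ p ∈ Finset.range (n + 1), t ^ p / M.seq p := by
      intro q hq
      exact Finset.single_le_sum (f := fun p => t ^ p / M.seq p)
        (fun i _ => div_nonneg (by positivity) (M.pos i).le) (by simp; omega)
    have hp0 := M.pos p
    rcases le_total p n with h | h
    · rw [← div_le_iff₀ hp0]
      linarith [hsum p h]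
    · refine (key p h).trans ?_
      gcongr
      linarith [hsum n le_rfl]

theorem bddAbove_assoc (M : WeightSequence) {t : ℝ} (ht : 0 ≤ t) :
    BddAbove (Set.range fun p : ℕ => Real.log (t ^ p / M.seq p)) := by
  obtain ⟨B, hB, h⟩ := M.exists_pow_le ht
  refine ⟨max (Real.log B) 0, ?_⟩
  rintro _ ⟨p, rfl⟩
  rcases (div_nonneg (pow_nonneg ht p) (M.pos p).le).eq_or_lt with h1 | h1
  · simp [← h1]
  · refine le_max_of_le_left (Real.log_le_log h1 ?_)
    rw [div_le_iff₀ (M.pos p)]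
    exact h p

theorem assoc_mono (M : WeightSequence) {s t : ℝ} (hs : 0 < s) (hst : s ≤ t) :
    M.assoc s ≤ M.assoc t := by
  refine ciSup_mono (M.bddAbove_assoc (hs.le.trans hst)) fun p => ?_
  have := M.pos p
  exact Real.log_le_log (by positivity) (by gcongr)

theorem mul_le (M : WeightSequence) (i j : ℕ) : M.seq i * M.seq j ≤ M.seq (i + j) := by
  have mono : ∀ i j, M.seq (j + 1) * M.seq (i + j) ≤ M.seq (i + j + 1) * M.seq j := by
    intro i j
    induction i with
    | zero => simp
    | succ i ih =>
      have h1 := M.logConvex (i + j)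
      have hp := M.pos (i + j)
      have hp1 := M.pos (i + j + 1)
      have hj := M.pos j
      have e : i + 1 + j = i + j + 1 := by ring
      rw [e]
      have h2 : M.seq (i + j) * (M.seq (j + 1) * M.seq (i + j + 1)) ≤
          M.seq (i + j) * (M.seq (i + j + 1 + 1) * M.seq j) := by
        nlinarith
      exact le_of_mul_le_mul_left h2 hp
  induction j with
  | zero => simp [M.zero]
  | succ j ih =>
    have h1 := mono i j
    have hj := M.pos j
    have hj1 := M.pos (j + 1)
    have h2 : M.seq j * (M.seq i * M.seq (j + 1)) ≤ M.seq j * M.seq (i + (j + 1)) := by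
      rw [← add_assoc]
      nlinarith
    exact le_of_mul_le_mul_left h2 hj

end WeightSequence

/-! ### Ultradifferentiable functions -/

/-- The two classes `* = (M_p)` and `* = {M_p}`. -/
inductive UltraClass
  | beurling
  | roumieu

variable {d : ℕ}

/-- The partial derivative `∂_{w 0} ⋯ ∂_{w (n-1)} φ (x)`. For smooth `φ` these are, as `w` runs over
`Fin n → Fin d`, exactly the derivatives `φ^(α) (x)` with `|α| = n` (some of them repeated). -/
def partialDeriv (φ : Euc d → ℂ) (n : ℕ) (w : Fin n → Fin d) (x : Euc d) : ℂ :=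
  iteratedFDeriv ℝ n φ x fun j => EuclideanSpace.single (w j) (1 : ℝ)

/-- The norm `sup_{x ∈ K, α} |φ^(α) (x)| / (h^|α| M_|α|)`, with values in `[0, ∞]`. -/
def ultraNorm (M : WeightSequence) (h : ℝ) (K : Set (Euc d)) (φ : Euc d → ℂ) : ENNReal :=
  ⨆ x ∈ K, ⨆ n : ℕ, ⨆ w : Fin n → Fin d,
    ENNReal.ofReal (‖partialDeriv φ n w x‖ / (h ^ n * M.seq n))

/-- The norms of `φ` on `K` are finite for all `h > 0` (resp. for some `h > 0`). -/
def HasUltraBound (c : UltraClass) (M : WeightSequence) (K : Set (Euc d)) (φ : Euc d → ℂ) : Prop :=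
  match c with
  | .beurling => ∀ h : ℝ, 0 < h → ultraNorm M h K φ < ⊤
  | .roumieu => ∃ h : ℝ, 0 < h ∧ ultraNorm M h K φ < ⊤

theorem ultraNorm_le_iff (M : WeightSequence) {h : ℝ} (hh : 0 < h) (K : Set (Euc d))
    (φ : Euc d → ℂ) (C : ℝ≥0) :
    ultraNorm M h K φ ≤ C ↔
      ∀ x ∈ K, ∀ n (w : Fin n → Fin d), ‖partialDeriv φ n w x‖ ≤ C * (h ^ n * M.seq n) := by
  simp only [ultraNorm, iSup_le_iff]
  refine forall₄_congr fun x _ n w => ?_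
  have := M.pos n
  rw [← ENNReal.ofReal_coe_nnreal, ENNReal.ofReal_le_ofReal_iff C.coe_nonneg, div_le_iff₀ (by positivity)]

theorem ultraNorm_anti (M : WeightSequence) {h h' : ℝ} (hh : 0 < h) (hh' : h ≤ h')
    (K : Set (Euc d)) (φ : Euc d → ℂ) : ultraNorm M h' K φ ≤ ultraNorm M h K φ := by
  refine iSup₂_mono fun x _ => iSup_mono fun n => iSup_mono fun w => ?_
  have := M.pos n
  gcongr

theorem ultraNorm_add_le (M : WeightSequence) {h : ℝ} (hh : 0 < h) {K : Set (Euc d)}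
    {φ ψ : Euc d → ℂ} (hφ : ∀ x ∈ K, ContDiffAt ℝ ∞ φ x) (hψ : ∀ x ∈ K, ContDiffAt ℝ ∞ ψ x) :
    ultraNorm M h K (φ + ψ) ≤ ultraNorm M h K φ + ultraNorm M h K ψ := by
  refine iSup₂_le fun x hx => iSup_le fun n => iSup_le fun w => ?_
  have hn : (n : ℕ∞ω) ≤ ∞ := by exact_mod_cast le_top
  have h1 : partialDeriv (φ + ψ) n w x = partialDeriv φ n w x + partialDeriv ψ n w x := by
    simp only [partialDeriv]
    rw [iteratedFDeriv_add_apply ((hφ x hx).of_le hn) ((hψ x hx).of_le hn)]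
    rfl
  have := M.pos n
  have h2 : ∀ χ : Euc d → ℂ, ENNReal.ofReal (‖partialDeriv χ n w x‖ / (h ^ n * M.seq n)) ≤
      ultraNorm M h K χ := fun χ =>
    le_iSup₂_of_le x hx (le_iSup_of_le n (le_iSup_of_le w le_rfl))
  refine le_trans ?_ (add_le_add (h2 φ) (h2 ψ))
  rw [← ENNReal.ofReal_add (by positivity) (by positivity), ← add_div, h1]
  gcongr
  exact norm_add_le _ _

theorem ultraNorm_smul_le (M : WeightSequence) (a : ℂ) {h : ℝ} {K : Set (Euc d)}
    {φ : Euc d → ℂ} (hφ : ∀ x ∈ K, ContDiffAt ℝ ∞ φ x) :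
    ultraNorm M h K (a • φ) ≤ ‖a‖₊ * ultraNorm M h K φ := by
  refine iSup₂_le fun x hx => iSup_le fun n => iSup_le fun w => ?_
  have hn : (n : ℕ∞ω) ≤ ∞ := by exact_mod_cast le_top
  have h1 : partialDeriv (a • φ) n w x = a * partialDeriv φ n w x := by
    simp only [partialDeriv]
    rw [iteratedFDeriv_const_smul_apply ((hφ x hx).of_le hn)]
    rfl
  have h2 : ENNReal.ofReal (‖partialDeriv φ n w x‖ / (h ^ n * M.seq n)) ≤
      ultraNorm M h K φ :=
    le_iSup₂_of_le x hx (le_iSup_of_le n (le_iSup_of_le w le_rfl))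
  refine le_trans ?_ (mul_le_mul_right h2 _)
  rw [h1, norm_mul, mul_div_assoc, ENNReal.ofReal_mul (norm_nonneg _), ofReal_norm]
  rfl

theorem ultraNorm_zero (M : WeightSequence) (h : ℝ) (K : Set (Euc d)) :
    ultraNorm M h K (0 : Euc d → ℂ) = 0 := by
  simp [ultraNorm, partialDeriv]

theorem HasUltraBound.add {c : UltraClass} {M : WeightSequence} {K : Set (Euc d)}
    {φ ψ : Euc d → ℂ} (hφ : ∀ x ∈ K, ContDiffAt ℝ ∞ φ x) (hψ : ∀ x ∈ K, ContDiffAt ℝ ∞ ψ x)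
    (h1 : HasUltraBound c M K φ) (h2 : HasUltraBound c M K ψ) :
    HasUltraBound c M K (φ + ψ) := by
  cases c with
  | beurling =>
    exact fun h hh => (ultraNorm_add_le M hh hφ hψ).trans_lt (ENNReal.add_lt_top.2 ⟨h1 h hh, h2 h hh⟩)
  | roumieu =>
    obtain ⟨h, hh, b⟩ := h1
    obtain ⟨h', hh', b'⟩ := h2
    have hm : 0 < max h h' := lt_max_of_lt_left hh
    exact ⟨max h h', hm, (ultraNorm_add_le M hm hφ hψ).trans_lt (ENNReal.add_lt_top.2
      ⟨(ultraNorm_anti M hh (le_max_left _ _) K φ).trans_lt b,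
        (ultraNorm_anti M hh' (le_max_right _ _) K ψ).trans_lt b'⟩)⟩

theorem HasUltraBound.smul {c : UltraClass} {M : WeightSequence} {K : Set (Euc d)} (a : ℂ)
    {φ : Euc d → ℂ} (hφ : ∀ x ∈ K, ContDiffAt ℝ ∞ φ x) (h1 : HasUltraBound c M K φ) :
    HasUltraBound c M K (a • φ) := by
  cases c with
  | beurling =>
    exact fun h hh => (ultraNorm_smul_le M a hφ).trans_lt
      (ENNReal.mul_lt_top ENNReal.coe_lt_top (h1 h hh))
  | roumieu =>
    obtain ⟨h, hh, b⟩ := h1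
    exact ⟨h, hh, (ultraNorm_smul_le M a hφ).trans_lt (ENNReal.mul_lt_top ENNReal.coe_lt_top b)⟩

theorem HasUltraBound.zero (c : UltraClass) (M : WeightSequence) (K : Set (Euc d)) :
    HasUltraBound c M K (0 : Euc d → ℂ) := by
  cases c with
  | beurling => intro h _; simp [ultraNorm_zero]
  | roumieu => exact ⟨1, one_pos, by simp [ultraNorm_zero]⟩

theorem contDiffAt_of_mem {Ω : TopologicalSpace.Opens (Euc d)} {φ : Euc d → ℂ}
    (h : ContDiffOn ℝ ∞ φ Ω) {K : Set (Euc d)} (hK : K ⊆ Ω) : ∀ x ∈ K, ContDiffAt ℝ ∞ φ x :=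
  fun _ hx => h.contDiffAt (Ω.isOpen.mem_nhds (hK hx))

/-- The space `E^*(Ω)` of ultradifferentiable functions on `Ω`. Its elements are given as functions
on `ℝ^d`; only their restrictions to `Ω` matter in everything below. -/
def ultraSmooth (c : UltraClass) (M : WeightSequence) (Ω : TopologicalSpace.Opens (Euc d)) :
    Submodule ℂ (Euc d → ℂ) where
  carrier := {φ | ContDiffOn ℝ ∞ φ Ω ∧
    ∀ K : Set (Euc d), IsCompact K → K ⊆ Ω → HasUltraBound c M K φ}
  add_mem' := fun hφ hψ => ⟨hφ.1.add hψ.1, fun K hK hKΩ =>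
    (hφ.2 K hK hKΩ).add (contDiffAt_of_mem hφ.1 hKΩ) (contDiffAt_of_mem hψ.1 hKΩ) (hψ.2 K hK hKΩ)⟩
  zero_mem' := ⟨contDiffOn_const, fun K _ _ => HasUltraBound.zero c M K⟩
  smul_mem' := fun a _ hφ => ⟨contDiffOn_const.smul hφ.1, fun K hK hKΩ =>
    (hφ.2 K hK hKΩ).smul a (contDiffAt_of_mem hφ.1 hKΩ)⟩

/-- The space `D^*(Ω)` of ultradifferentiable functions with compact support in `Ω`. -/
def testFunctions (c : UltraClass) (M : WeightSequence) (Ω : TopologicalSpace.Opens (Euc d)) :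
    Submodule ℂ (Euc d → ℂ) where
  carrier := {φ | ContDiff ℝ ∞ φ ∧ HasCompactSupport φ ∧ tsupport φ ⊆ Ω ∧
    HasUltraBound c M Set.univ φ}
  add_mem' := fun hφ hψ => ⟨hφ.1.add hψ.1, hφ.2.1.add hψ.2.1,
    (tsupport_add _ _).trans (Set.union_subset hφ.2.2.1 hψ.2.2.1),
    hφ.2.2.2.add (fun _ _ => hφ.1.contDiffAt) (fun _ _ => hψ.1.contDiffAt) hψ.2.2.2⟩
  zero_mem' := ⟨contDiff_const, HasCompactSupport.zero, by simp [tsupport],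
    HasUltraBound.zero c M _⟩
  smul_mem' := fun a _ hφ => ⟨contDiff_const.smul hφ.1, hφ.2.1.smul_left (f := fun _ => a),
    (tsupport_smul_subset_right (fun _ => a) _).trans hφ.2.2.1,
    hφ.2.2.2.smul a (fun _ _ => hφ.1.contDiffAt)⟩

/-! ### Ultradistributions -/

/-- Continuity of a linear functional on `D^*(Ω)` for the usual locally convex topology. Beurling
case: the inductive limit over compact `K ⊆ Ω` of the projective limits over `h → 0`. Roumieu case:
the inductive limit over compact `K ⊆ Ω` and `h → ∞`. -/
def IsUltraContinuous (c : UltraClass) (M : WeightSequence) (Ω : TopologicalSpace.Opens (Euc d))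
    (f : testFunctions c M Ω →ₗ[ℂ] ℂ) : Prop :=
  ∀ K : Set (Euc d), IsCompact K → K ⊆ Ω →
    match c with
    | .beurling => ∃ h : ℝ, 0 < h ∧ ∃ C : ℝ≥0, ∀ ψ : testFunctions .beurling M Ω,
        tsupport (ψ : Euc d → ℂ) ⊆ K → ‖f ψ‖ₑ ≤ C * ultraNorm M h K ψ
    | .roumieu => ∀ h : ℝ, 0 < h → ∃ C : ℝ≥0, ∀ ψ : testFunctions .roumieu M Ω,
        tsupport (ψ : Euc d → ℂ) ⊆ K → ‖f ψ‖ₑ ≤ C * ultraNorm M h K ψ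

/-- The space `D^*'(Ω)` of ultradistributions of class `*` on `Ω`. -/
def Ultradistribution (c : UltraClass) (M : WeightSequence)
    (Ω : TopologicalSpace.Opens (Euc d)) : Type :=
  {f : testFunctions c M Ω →ₗ[ℂ] ℂ // IsUltraContinuous c M Ω f}

theorem integrable_mul_test {c : UltraClass} {M : WeightSequence}
    {Ω : TopologicalSpace.Opens (Euc d)} (u : ultraSmooth c M Ω) (ψ : testFunctions c M Ω) :
    Integrable (fun x => (u : Euc d → ℂ) x * (ψ : Euc d → ℂ) x) (volume.restrict Ω) := by
  have hc : ContinuousOn (fun x => (u : Euc d → ℂ) x * (ψ : Euc d → ℂ) x)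
      (tsupport (ψ : Euc d → ℂ)) :=
    (u.2.1.continuousOn.mono ψ.2.2.2.1).mul ψ.2.1.continuous.continuousOn
  have h1 : IntegrableOn (fun x => (u : Euc d → ℂ) x * (ψ : Euc d → ℂ) x)
      (tsupport (ψ : Euc d → ℂ)) := hc.integrableOn_compact ψ.2.2.1
  have h2 : Integrable (fun x => (u : Euc d → ℂ) x * (ψ : Euc d → ℂ) x) := by
    rw [← integrableOn_iff_integrable_of_support_subset (s := tsupport (ψ : Euc d → ℂ))]
    · exact h1
    · intro x hx
      refine subset_tsupport _ ?_
      intro h0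
      exact hx (by simp [h0])
  exact h2.restrict

theorem enorm_integral_mul_test_le {c : UltraClass} {M : WeightSequence}
    {Ω : TopologicalSpace.Opens (Euc d)} (u : ultraSmooth c M Ω) {K : Set (Euc d)}
    (hK : IsCompact K) (hKΩ : K ⊆ Ω) : ∃ C : ℝ≥0, ∀ h : ℝ, 0 < h →
      ∀ ψ : testFunctions c M Ω, tsupport (ψ : Euc d → ℂ) ⊆ K →
        ‖∫ x in (Ω : Set (Euc d)), (u : Euc d → ℂ) x * (ψ : Euc d → ℂ) x‖ₑ ≤
          C * ultraNorm M h K ψ := by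
  have hu : IntegrableOn (u : Euc d → ℂ) K :=
    (u.2.1.continuousOn.mono hKΩ).integrableOn_compact hK
  have hfin : ∫⁻ x in K, ‖(u : Euc d → ℂ) x‖ₑ < ⊤ := hu.2
  refine ⟨(∫⁻ x in K, ‖(u : Euc d → ℂ) x‖ₑ).toNNReal, fun h hh ψ hψ => ?_⟩
  rw [ENNReal.coe_toNNReal hfin.ne]
  have hpt : ∀ x ∈ K, ‖(ψ : Euc d → ℂ) x‖ₑ ≤ ultraNorm M h K ψ := by
    intro x hx
    refine le_trans ?_ (le_iSup₂_of_le x hx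
      (le_iSup_of_le 0 (le_iSup_of_le (fun i => i.elim0) le_rfl)))
    simp [partialDeriv, M.zero]
  calc ‖∫ x in (Ω : Set (Euc d)), (u : Euc d → ℂ) x * (ψ : Euc d → ℂ) x‖ₑ
      ≤ ∫⁻ x in (Ω : Set (Euc d)), ‖(u : Euc d → ℂ) x * (ψ : Euc d → ℂ) x‖ₑ :=
        enorm_integral_le_lintegral_enorm _
    _ ≤ ∫⁻ x, ‖(u : Euc d → ℂ) x * (ψ : Euc d → ℂ) x‖ₑ := setLIntegral_le_lintegral _ _
    _ = ∫⁻ x in K, ‖(u : Euc d → ℂ) x * (ψ : Euc d → ℂ) x‖ₑ := by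
        rw [← lintegral_indicator hK.measurableSet]
        congr 1
        ext x
        by_cases hx : x ∈ K
        · simp [hx]
        · have : (ψ : Euc d → ℂ) x = 0 := by
            by_contra h0
            exact hx (hψ (subset_tsupport _ h0))
          simp [this, hx]
    _ ≤ ∫⁻ x in K, ‖(u : Euc d → ℂ) x‖ₑ * ultraNorm M h K ψ := by
        refine setLIntegral_mono' hK.measurableSet fun x hx => ?_
        rw [enorm_mul]
        gcongr
        exact hpt x hx
    _ ≤ (∫⁻ x in K, ‖(u : Euc d → ℂ) x‖ₑ) * ultraNorm M h K ψ := by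
        rw [lintegral_mul_const'' _ hu.1.enorm]

/-- The inclusion `E^*(Ω) ⊆ D^*'(Ω)`: the function `u` acts by `ψ ↦ ∫_Ω u ψ`. -/
def ofUltraSmooth {c : UltraClass} {M : WeightSequence} {Ω : TopologicalSpace.Opens (Euc d)}
    (u : ultraSmooth c M Ω) : Ultradistribution c M Ω where
  val :=
    { toFun := fun ψ => ∫ x in (Ω : Set (Euc d)), (u : Euc d → ℂ) x * (ψ : Euc d → ℂ) x
      map_add' := fun ψ₁ ψ₂ => by
        rw [← integral_add (integrable_mul_test u ψ₁) (integrable_mul_test u ψ₂)]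
        simp [mul_add]
      map_smul' := fun a ψ => by
        simp only [RingHom.id_apply, smul_eq_mul, ← integral_const_mul]
        congr 1
        ext x
        simp only [Submodule.coe_smul, Pi.smul_apply, smul_eq_mul]
        ring }
  property := by
    intro K hK hKΩ
    obtain ⟨C, hC⟩ := enorm_integral_mul_test_le u hK hKΩ
    cases c with
    | beurling => exact ⟨1, one_pos, C, hC 1 one_pos⟩
    | roumieu => exact fun h hh => ⟨C, hC h hh⟩

/-! ### The algebra of generalized functions

Only the linear structure of the quotient enters the statement, so the quotient is built as a
quotient of vector spaces. -/

/-- Nets of functions indexed by `ε ∈ (0, 1]`. -/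
abbrev Net (d : ℕ) := Set.Ioc (0 : ℝ) 1 → Euc d → ℂ

/-- `‖f_ε‖ = O(b(ε))` as `ε → 0⁺`, for the norm with parameters `h` and `K`. -/
def NormBigO (M : WeightSequence) (h : ℝ) (K : Set (Euc d)) (f : Net d) (b : ℝ → ℝ) : Prop :=
  ∃ C : ℝ≥0, ∃ ε₀ : ℝ, 0 < ε₀ ∧ ∀ ε : Set.Ioc (0 : ℝ) 1, (ε : ℝ) < ε₀ →
    ultraNorm M h K (f ε) ≤ C * ENNReal.ofReal (b ε)

/-- The growth scale `ε ↦ e^{M(k/ε)}`. -/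
def growth (M : WeightSequence) (k ε : ℝ) : ℝ := Real.exp (M.assoc (k / ε))

/-- The decay scale `ε ↦ e^{-M(k/ε)}`. -/
def decay (M : WeightSequence) (k ε : ℝ) : ℝ := Real.exp (-M.assoc (k / ε))

theorem growth_mono (M : WeightSequence) {k k' : ℝ} (hk : 0 < k) (hkk : k ≤ k')
    (ε : Set.Ioc (0 : ℝ) 1) : growth M k ε ≤ growth M k' ε := by
  have := ε.2.1
  exact Real.exp_le_exp.2 (M.assoc_mono (by positivity) (by gcongr))

theorem decay_anti (M : WeightSequence) {k k' : ℝ} (hk : 0 < k) (hkk : k ≤ k')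
    (ε : Set.Ioc (0 : ℝ) 1) : decay M k' ε ≤ decay M k ε := by
  have := ε.2.1
  exact Real.exp_le_exp.2 (neg_le_neg (M.assoc_mono (by positivity) (by gcongr)))

theorem NormBigO.weaken {M : WeightSequence} {h h' : ℝ} {K : Set (Euc d)} {f : Net d}
    {b b' : ℝ → ℝ} (H : NormBigO M h K f b) (hh : 0 < h) (hh' : h ≤ h')
    (hb : ∀ ε : Set.Ioc (0 : ℝ) 1, b ε ≤ b' ε) : NormBigO M h' K f b' := by
  obtain ⟨C, ε₀, h0, H⟩ := H
  refine ⟨C, ε₀, h0, fun ε hε => (ultraNorm_anti M hh hh' K _).trans ((H ε hε).trans ?_)⟩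
  gcongr
  exact hb ε

theorem NormBigO.add {M : WeightSequence} {h : ℝ} (hh : 0 < h) {K : Set (Euc d)} {f g : Net d}
    {b : ℝ → ℝ} (hf : ∀ ε, ∀ x ∈ K, ContDiffAt ℝ ∞ (f ε) x)
    (hg : ∀ ε, ∀ x ∈ K, ContDiffAt ℝ ∞ (g ε) x)
    (H : NormBigO M h K f b) (H' : NormBigO M h K g b) : NormBigO M h K (f + g) b := by
  obtain ⟨C, ε₀, h0, H⟩ := H
  obtain ⟨C', ε₁, h1, H'⟩ := H'
  refine ⟨C + C', min ε₀ ε₁, lt_min h0 h1, fun ε hε => ?_⟩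
  refine (ultraNorm_add_le M hh (hf ε) (hg ε)).trans ?_
  rw [ENNReal.coe_add, add_mul]
  exact add_le_add (H ε (hε.trans_le (min_le_left _ _))) (H' ε (hε.trans_le (min_le_right _ _)))

theorem NormBigO.smul {M : WeightSequence} {h : ℝ} {K : Set (Euc d)} {f : Net d}
    {b : ℝ → ℝ} (a : ℂ) (hf : ∀ ε, ∀ x ∈ K, ContDiffAt ℝ ∞ (f ε) x)
    (H : NormBigO M h K f b) : NormBigO M h K (a • f) b := by
  obtain ⟨C, ε₀, h0, H⟩ := H
  refine ⟨‖a‖₊ * C, ε₀, h0, fun ε hε => (ultraNorm_smul_le M a (hf ε)).trans ?_⟩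
  rw [ENNReal.coe_mul, mul_assoc]
  gcongr
  exact H ε hε

theorem NormBigO.zero (M : WeightSequence) (h : ℝ) (K : Set (Euc d)) (b : ℝ → ℝ) :
    NormBigO M h K (0 : Net d) b :=
  ⟨0, 1, one_pos, fun ε _ => by simp [ultraNorm_zero]⟩

/-- The growth condition on a net over a compact set `K` in the definition of moderate nets. -/
def ModerateOn (c : UltraClass) (M : WeightSequence) (K : Set (Euc d)) (f : Net d) : Prop :=
  match c with
  | .beurling => ∀ h : ℝ, 0 < h → ∃ k : ℝ, 0 < k ∧ NormBigO M h K f (growth M k)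
  | .roumieu => ∀ k : ℝ, 0 < k → ∃ h : ℝ, 0 < h ∧ NormBigO M h K f (growth M k)

/-- The growth condition on a net over a compact set `K` in the definition of regular nets. -/
def RegularOn (c : UltraClass) (M : WeightSequence) (K : Set (Euc d)) (f : Net d) : Prop :=
  match c with
  | .beurling => ∃ k : ℝ, 0 < k ∧ ∀ h : ℝ, 0 < h → NormBigO M h K f (growth M k)
  | .roumieu => ∃ h : ℝ, 0 < h ∧ ∀ k : ℝ, 0 < k → NormBigO M h K f (growth M k)

/-- The decay condition on a net over a compact set `K` in the definition of negligible nets. -/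
def NegligibleOn (c : UltraClass) (M : WeightSequence) (K : Set (Euc d)) (f : Net d) : Prop :=
  match c with
  | .beurling => ∀ h : ℝ, 0 < h → ∀ k : ℝ, 0 < k → NormBigO M h K f (decay M k)
  | .roumieu => ∃ k : ℝ, 0 < k ∧ ∃ h : ℝ, 0 < h ∧ NormBigO M h K f (decay M k)

section closure

variable {c : UltraClass} {M : WeightSequence} {K : Set (Euc d)} {f g : Net d}

theorem ModerateOn.add (hf : ∀ ε, ∀ x ∈ K, ContDiffAt ℝ ∞ (f ε) x)
    (hg : ∀ ε, ∀ x ∈ K, ContDiffAt ℝ ∞ (g ε) x)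
    (H : ModerateOn c M K f) (H' : ModerateOn c M K g) : ModerateOn c M K (f + g) := by
  cases c with
  | beurling =>
    intro h hh
    obtain ⟨k, hk, b⟩ := H h hh
    obtain ⟨k', hk', b'⟩ := H' h hh
    exact ⟨max k k', lt_max_of_lt_left hk, NormBigO.add hh hf hg
      (b.weaken hh le_rfl (growth_mono M hk (le_max_left _ _)))
      (b'.weaken hh le_rfl (growth_mono M hk' (le_max_right _ _)))⟩
  | roumieu =>
    intro k hk
    obtain ⟨h, hh, b⟩ := H k hk
    obtain ⟨h', hh', b'⟩ := H' k hk
    exact ⟨max h h', lt_max_of_lt_left hh, NormBigO.add (lt_max_of_lt_left hh) hf hg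
      (b.weaken hh (le_max_left _ _) fun _ => le_rfl)
      (b'.weaken hh' (le_max_right _ _) fun _ => le_rfl)⟩

theorem ModerateOn.smul (a : ℂ) (hf : ∀ ε, ∀ x ∈ K, ContDiffAt ℝ ∞ (f ε) x)
    (H : ModerateOn c M K f) : ModerateOn c M K (a • f) := by
  cases c with
  | beurling =>
    intro h hh
    obtain ⟨k, hk, b⟩ := H h hh
    exact ⟨k, hk, b.smul a hf⟩
  | roumieu =>
    intro k hk
    obtain ⟨h, hh, b⟩ := H k hk
    exact ⟨h, hh, b.smul a hf⟩

theorem ModerateOn.zero : ModerateOn c M K (0 : Net d) := by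
  cases c with
  | beurling => exact fun h _ => ⟨1, one_pos, NormBigO.zero M h K _⟩
  | roumieu => exact fun k _ => ⟨1, one_pos, NormBigO.zero M 1 K _⟩

theorem RegularOn.add (hf : ∀ ε, ∀ x ∈ K, ContDiffAt ℝ ∞ (f ε) x)
    (hg : ∀ ε, ∀ x ∈ K, ContDiffAt ℝ ∞ (g ε) x)
    (H : RegularOn c M K f) (H' : RegularOn c M K g) : RegularOn c M K (f + g) := by
  cases c with
  | beurling =>
    obtain ⟨k, hk, b⟩ := H
    obtain ⟨k', hk', b'⟩ := H'
    exact ⟨max k k', lt_max_of_lt_left hk, fun h hh => NormBigO.add hh hf hg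
      ((b h hh).weaken hh le_rfl (growth_mono M hk (le_max_left _ _)))
      ((b' h hh).weaken hh le_rfl (growth_mono M hk' (le_max_right _ _)))⟩
  | roumieu =>
    obtain ⟨h, hh, b⟩ := H
    obtain ⟨h', hh', b'⟩ := H'
    exact ⟨max h h', lt_max_of_lt_left hh, fun k hk => NormBigO.add (lt_max_of_lt_left hh) hf hg
      ((b k hk).weaken hh (le_max_left _ _) fun _ => le_rfl)
      ((b' k hk).weaken hh' (le_max_right _ _) fun _ => le_rfl)⟩

theorem RegularOn.smul (a : ℂ) (hf : ∀ ε, ∀ x ∈ K, ContDiffAt ℝ ∞ (f ε) x)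
    (H : RegularOn c M K f) : RegularOn c M K (a • f) := by
  cases c with
  | beurling =>
    obtain ⟨k, hk, b⟩ := H
    exact ⟨k, hk, fun h hh => (b h hh).smul a hf⟩
  | roumieu =>
    obtain ⟨h, hh, b⟩ := H
    exact ⟨h, hh, fun k hk => (b k hk).smul a hf⟩

theorem RegularOn.zero : RegularOn c M K (0 : Net d) := by
  cases c with
  | beurling => exact ⟨1, one_pos, fun h _ => NormBigO.zero M h K _⟩
  | roumieu => exact ⟨1, one_pos, fun k _ => NormBigO.zero M 1 K _⟩

theorem NegligibleOn.add (hf : ∀ ε, ∀ x ∈ K, ContDiffAt ℝ ∞ (f ε) x)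
    (hg : ∀ ε, ∀ x ∈ K, ContDiffAt ℝ ∞ (g ε) x)
    (H : NegligibleOn c M K f) (H' : NegligibleOn c M K g) : NegligibleOn c M K (f + g) := by
  cases c with
  | beurling => exact fun h hh k hk => NormBigO.add hh hf hg (H h hh k hk) (H' h hh k hk)
  | roumieu =>
    obtain ⟨k, hk, h, hh, b⟩ := H
    obtain ⟨k', hk', h', hh', b'⟩ := H'
    exact ⟨min k k', lt_min hk hk', max h h', lt_max_of_lt_left hh,
      NormBigO.add (lt_max_of_lt_left hh) hf hg
        (b.weaken hh (le_max_left _ _) (decay_anti M (lt_min hk hk') (min_le_left _ _)))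
        (b'.weaken hh' (le_max_right _ _) (decay_anti M (lt_min hk hk') (min_le_right _ _)))⟩

theorem NegligibleOn.smul (a : ℂ) (hf : ∀ ε, ∀ x ∈ K, ContDiffAt ℝ ∞ (f ε) x)
    (H : NegligibleOn c M K f) : NegligibleOn c M K (a • f) := by
  cases c with
  | beurling => exact fun h hh k hk => (H h hh k hk).smul a hf
  | roumieu =>
    obtain ⟨k, hk, h, hh, b⟩ := H
    exact ⟨k, hk, h, hh, b.smul a hf⟩

theorem NegligibleOn.zero : NegligibleOn c M K (0 : Net d) := by
  cases c with
  | beurling => exact fun h _ k _ => NormBigO.zero M h K _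
  | roumieu => exact ⟨1, one_pos, 1, one_pos, NormBigO.zero M 1 K _⟩

end closure

/-- The space of `*`-moderate nets on `Ω`. -/
def moderateNets (c : UltraClass) (M : WeightSequence) (Ω : TopologicalSpace.Opens (Euc d)) :
    Submodule ℂ (Net d) where
  carrier := {f | (∀ ε, f ε ∈ ultraSmooth c M Ω) ∧
    ∀ K : Set (Euc d), IsCompact K → K ⊆ Ω → ModerateOn c M K f}
  add_mem' := fun hf hg => ⟨fun ε => add_mem (hf.1 ε) (hg.1 ε), fun K hK hKΩ =>
    ModerateOn.add (fun ε => contDiffAt_of_mem (hf.1 ε).1 hKΩ)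
      (fun ε => contDiffAt_of_mem (hg.1 ε).1 hKΩ) (hf.2 K hK hKΩ) (hg.2 K hK hKΩ)⟩
  zero_mem' := ⟨fun _ => zero_mem _, fun _ _ _ => ModerateOn.zero⟩
  smul_mem' := fun a _ hf => ⟨fun ε => Submodule.smul_mem _ a (hf.1 ε), fun K hK hKΩ =>
    ModerateOn.smul a (fun ε => contDiffAt_of_mem (hf.1 ε).1 hKΩ) (hf.2 K hK hKΩ)⟩

/-- The space of regular nets on `Ω`, the numerator of the algebra of regular generalized
functions. -/
def regularNets (c : UltraClass) (M : WeightSequence) (Ω : TopologicalSpace.Opens (Euc d)) :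
    Submodule ℂ (Net d) where
  carrier := {f | (∀ ε, f ε ∈ ultraSmooth c M Ω) ∧
    ∀ K : Set (Euc d), IsCompact K → K ⊆ Ω → RegularOn c M K f}
  add_mem' := fun hf hg => ⟨fun ε => add_mem (hf.1 ε) (hg.1 ε), fun K hK hKΩ =>
    RegularOn.add (fun ε => contDiffAt_of_mem (hf.1 ε).1 hKΩ)
      (fun ε => contDiffAt_of_mem (hg.1 ε).1 hKΩ) (hf.2 K hK hKΩ) (hg.2 K hK hKΩ)⟩
  zero_mem' := ⟨fun _ => zero_mem _, fun _ _ _ => RegularOn.zero⟩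
  smul_mem' := fun a _ hf => ⟨fun ε => Submodule.smul_mem _ a (hf.1 ε), fun K hK hKΩ =>
    RegularOn.smul a (fun ε => contDiffAt_of_mem (hf.1 ε).1 hKΩ) (hf.2 K hK hKΩ)⟩

/-- The space of `*`-negligible nets on `Ω`. -/
def negligibleNets (c : UltraClass) (M : WeightSequence) (Ω : TopologicalSpace.Opens (Euc d)) :
    Submodule ℂ (Net d) where
  carrier := {f | (∀ ε, f ε ∈ ultraSmooth c M Ω) ∧
    ∀ K : Set (Euc d), IsCompact K → K ⊆ Ω → NegligibleOn c M K f}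
  add_mem' := fun hf hg => ⟨fun ε => add_mem (hf.1 ε) (hg.1 ε), fun K hK hKΩ =>
    NegligibleOn.add (fun ε => contDiffAt_of_mem (hf.1 ε).1 hKΩ)
      (fun ε => contDiffAt_of_mem (hg.1 ε).1 hKΩ) (hf.2 K hK hKΩ) (hg.2 K hK hKΩ)⟩
  zero_mem' := ⟨fun _ => zero_mem _, fun _ _ _ => NegligibleOn.zero⟩
  smul_mem' := fun a _ hf => ⟨fun ε => Submodule.smul_mem _ a (hf.1 ε), fun K hK hKΩ =>
    NegligibleOn.smul a (fun ε => contDiffAt_of_mem (hf.1 ε).1 hKΩ) (hf.2 K hK hKΩ)⟩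

theorem regularNets_le (c : UltraClass) (M : WeightSequence)
    (Ω : TopologicalSpace.Opens (Euc d)) : regularNets c M Ω ≤ moderateNets c M Ω := by
  refine fun f hf => ⟨hf.1, fun K hK hKΩ => ?_⟩
  have h := hf.2 K hK hKΩ
  cases c with
  | beurling =>
    obtain ⟨k, hk, b⟩ := h
    exact fun h hh => ⟨k, hk, b h hh⟩
  | roumieu =>
    obtain ⟨h, hh, b⟩ := h
    exact fun k hk => ⟨h, hh, b k hk⟩

/-- The generalized functions `G^*(Ω)`: moderate nets modulo negligible nets. -/
abbrev GenFun (c : UltraClass) (M : WeightSequence) (Ω : TopologicalSpace.Opens (Euc d)) : Type :=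
  moderateNets c M Ω ⧸ (negligibleNets c M Ω).submoduleOf (moderateNets c M Ω)

/-- The class `[(f_ε)_ε]` of a moderate net. -/
def GenFun.mk {c : UltraClass} {M : WeightSequence} {Ω : TopologicalSpace.Opens (Euc d)} :
    moderateNets c M Ω →ₗ[ℂ] GenFun c M Ω :=
  ((negligibleNets c M Ω).submoduleOf (moderateNets c M Ω)).mkQ

/-- The regular generalized functions `G^{*,∞}(Ω)`: the classes of regular nets. -/
def regularGenFun (c : UltraClass) (M : WeightSequence) (Ω : TopologicalSpace.Opens (Euc d)) :
    Submodule ℂ (GenFun c M Ω) :=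
  ((regularNets c M Ω).submoduleOf (moderateNets c M Ω)).map GenFun.mk

/-! ### Mollifiers and the embedding -/

/-- An even function `φ` in `F⁻¹(D^{(N_p)}(ℝ^d))` with `φ̂ = 1` on `|ξ| ≤ 1` and `φ̂ = 0` on
`|ξ| ≥ 2`, where `φ̂(ξ) = ∫ φ(x) e^{i x·ξ} dx`. The field `hat` is `φ̂`. -/
structure Mollifier (N : WeightSequence) (d : ℕ) where
  toFun : Euc d → ℂ
  hat : Euc d → ℂ
  hat_mem : hat ∈ testFunctions .beurling N ⊤
  toFun_eq : ∀ x, toFun x =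
    ((2 * Real.pi) ^ d)⁻¹ * ∫ ξ : Euc d, hat ξ * Complex.exp (-(inner ℝ x ξ : ℝ) * Complex.I)
  even : ∀ x, toFun (-x) = toFun x
  hat_eq_one : ∀ ξ, ‖ξ‖ ≤ 1 → hat ξ = 1
  hat_eq_zero : ∀ ξ, 2 ≤ ‖ξ‖ → hat ξ = 0

/-- The net of mollifiers `φ_ε(x) = ε^{-d} φ(x/ε)`. -/
def Mollifier.net {N : WeightSequence} (φ : Mollifier N d) (ε : Set.Ioc (0 : ℝ) 1) (x : Euc d) : ℂ :=
  ((ε : ℝ) ^ d)⁻¹ * φ.toFun ((ε : ℝ)⁻¹ • x)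

section productBounds

/-- The operator norm of the `n`-th derivative is controlled by the partial derivatives. -/
theorem norm_iteratedFDeriv_le_of_partialDeriv {φ : Euc d → ℂ} {n : ℕ} {x : Euc d} {B : ℝ}
    (hB : 0 ≤ B) (h : ∀ w : Fin n → Fin d, ‖partialDeriv φ n w x‖ ≤ B) :
    ‖iteratedFDeriv ℝ n φ x‖ ≤ (d : ℝ) ^ n * B := by
  refine ContinuousMultilinearMap.opNorm_le_bound (by positivity) fun m => ?_
  have hm : m = fun j => ∑ i : Fin d, (m j) i • EuclideanSpace.single i (1 : ℝ) := by
    ext j i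
    simp [Pi.single_apply]
  have h1 : iteratedFDeriv ℝ n φ x m = ∑ w : Fin n → Fin d,
      (∏ j, (m j) (w j)) • partialDeriv φ n w x := by
    conv_lhs => rw [hm]
    rw [ContinuousMultilinearMap.map_sum]
    refine Finset.sum_congr rfl fun w _ => ?_
    rw [ContinuousMultilinearMap.map_smul_univ]
    rfl
  rw [h1]
  calc ‖∑ w : Fin n → Fin d, (∏ j, (m j) (w j)) • partialDeriv φ n w x‖
      ≤ ∑ _w : Fin n → Fin d, (∏ j, ‖m j‖) * B := by
        refine norm_sum_le_of_le _ fun w _ => ?_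
        rw [norm_smul, norm_prod]
        refine mul_le_mul (Finset.prod_le_prod (fun _ _ => norm_nonneg _)
          fun j _ => PiLp.norm_apply_le _ _) (h w) (norm_nonneg _)
          (Finset.prod_nonneg fun _ _ => norm_nonneg _)
    _ = (d : ℝ) ^ n * B * ∏ j, ‖m j‖ := by
        simp [Finset.sum_const, Finset.card_univ]
        ring

theorem norm_partialDeriv_le (φ : Euc d → ℂ) (n : ℕ) (w : Fin n → Fin d) (x : Euc d) :
    ‖partialDeriv φ n w x‖ ≤ ‖iteratedFDeriv ℝ n φ x‖ := by
  refine (ContinuousMultilinearMap.le_opNorm _ _).trans ?_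
  simp

/-- Multiplying a test function by a smooth function all of whose derivatives are bounded by
`C R^n` gives a test function. -/
theorem mul_mem_testFunctions {c : UltraClass} {M : WeightSequence}
    {Ω : TopologicalSpace.Opens (Euc d)} (θ : testFunctions c M Ω) {g : Euc d → ℂ}
    (hg : ContDiff ℝ ∞ g) {C R : ℝ} (hR : 0 ≤ R)
    (hC : ∀ n y, ‖iteratedFDeriv ℝ n g y‖ ≤ C * R ^ n) :
    (fun y => (θ : Euc d → ℂ) y * g y) ∈ testFunctions c M Ω := by
  have hC0 : 0 ≤ C := by simpa using (norm_nonneg _).trans (hC 0 0)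
  have key : ∀ h h' : ℝ, 0 < h → 0 < h' → 2 * (d + 1) * h ≤ h' →
      ultraNorm M h Set.univ (θ : Euc d → ℂ) < ⊤ →
      ultraNorm M h' Set.univ (fun y => (θ : Euc d → ℂ) y * g y) < ⊤ := by
    intro h h' hh hh' hle hfin
    obtain ⟨B, hB, hRB⟩ := M.exists_pow_le (t := R / h) (by positivity)
    set A : ℝ≥0 := (ultraNorm M h Set.univ (θ : Euc d → ℂ)).toNNReal with hA
    have hAle : ultraNorm M h Set.univ (θ : Euc d → ℂ) ≤ A := by
      rw [hA, ENNReal.coe_toNNReal hfin.ne]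
    rw [ultraNorm_le_iff M hh] at hAle
    have hθ : ∀ n y, ‖iteratedFDeriv ℝ n (θ : Euc d → ℂ) y‖ ≤
        ((d + 1) * h) ^ n * (A * M.seq n) := by
      intro n y
      have hMn := M.pos n
      refine (norm_iteratedFDeriv_le_of_partialDeriv (B := A * (h ^ n * M.seq n)) (by positivity)
        fun w => hAle y trivial n w).trans ?_
      calc (d : ℝ) ^ n * (A * (h ^ n * M.seq n)) ≤ (d + 1 : ℝ) ^ n * (A * (h ^ n * M.seq n)) := by
            gcongr; linarith
        _ = _ := by rw [mul_pow]; ring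
    have hgb : ∀ n y, ‖iteratedFDeriv ℝ n g y‖ ≤ ((d + 1) * h) ^ n * (C * B * M.seq n) := by
      intro n y
      have hMn := M.pos n
      have h1 := hRB n
      rw [div_pow, div_le_iff₀ (by positivity)] at h1
      calc ‖iteratedFDeriv ℝ n g y‖ ≤ C * R ^ n := hC n y
        _ ≤ C * (B * M.seq n * h ^ n) := by gcongr
        _ = h ^ n * (C * B * M.seq n) := by ring
        _ ≤ ((d + 1) * h) ^ n * (C * B * M.seq n) := by
          gcongr
          nlinarith [(Nat.cast_nonneg d : (0 : ℝ) ≤ d)]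
    obtain ⟨D, hD⟩ : ∃ D : ℝ≥0, (D : ℝ) = A * (C * B) :=
      CanLift.prf (A * (C * B) : ℝ) (by positivity)
    refine lt_of_le_of_lt ((ultraNorm_le_iff M hh' _ _ D).2 ?_)
      ENNReal.coe_lt_top
    intro y _ n w
    have hMn := M.pos n
    refine (norm_partialDeriv_le _ n w y).trans ?_
    have hn : (n : ℕ∞ω) ≤ ∞ := by exact_mod_cast le_top
    refine (norm_iteratedFDeriv_mul_le (N := ∞) θ.2.1 hg y hn).trans ?_
    have hterm : ∀ i ∈ Finset.range (n + 1),
        (n.choose i : ℝ) * ‖iteratedFDeriv ℝ i (θ : Euc d → ℂ) y‖ *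
          ‖iteratedFDeriv ℝ (n - i) g y‖ ≤
        (n.choose i : ℝ) * (((d + 1) * h) ^ n * (A * (C * B) * M.seq n)) := by
      intro i hi
      have hin : i + (n - i) = n := by
        have := Finset.mem_range.1 hi
        omega
      have hMi := M.pos i
      have hMni := M.pos (n - i)
      have hmul := M.mul_le i (n - i)
      rw [hin] at hmul
      rw [mul_assoc]
      refine mul_le_mul_of_nonneg_left ?_ (by positivity)
      calc ‖iteratedFDeriv ℝ i (θ : Euc d → ℂ) y‖ * ‖iteratedFDeriv ℝ (n - i) g y‖
          ≤ (((d + 1) * h) ^ i * (A * M.seq i)) *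
            (((d + 1) * h) ^ (n - i) * (C * B * M.seq (n - i))) :=
            mul_le_mul (hθ i y) (hgb _ y) (norm_nonneg _) (by positivity)
        _ = (((d + 1) * h) ^ i * ((d + 1) * h) ^ (n - i)) *
            (A * (C * B) * (M.seq i * M.seq (n - i))) := by ring
        _ = ((d + 1) * h) ^ n * (A * (C * B) * (M.seq i * M.seq (n - i))) := by
            rw [← pow_add, hin]
        _ ≤ _ := by gcongr
    refine (Finset.sum_le_sum hterm).trans ?_
    rw [← Finset.sum_mul]
    have h2 : (∑ i ∈ Finset.range (n + 1), (n.choose i : ℝ)) = 2 ^ n := by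
      exact_mod_cast Nat.sum_range_choose n
    rw [h2]
    calc (2 : ℝ) ^ n * (((d + 1) * h) ^ n * (A * (C * B) * M.seq n))
        = (2 * (d + 1) * h) ^ n * (A * (C * B) * M.seq n) := by
          rw [← mul_assoc, ← mul_pow]; ring_nf
      _ ≤ h' ^ n * (A * (C * B) * M.seq n) := by gcongr
      _ = _ := by rw [hD]; ring
  refine ⟨θ.2.1.mul hg, θ.2.2.1.mul_right, (tsupport_mul_subset_left).trans θ.2.2.2.1, ?_⟩
  have hb := θ.2.2.2.2
  cases c with
  | beurling =>
    intro h hh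
    exact key (h / (2 * (d + 1))) h (by positivity) hh
      (by rw [mul_div_cancel₀]; positivity) (hb _ (by positivity))
  | roumieu =>
    obtain ⟨h, hh, hfin⟩ := hb
    exact ⟨2 * (d + 1) * h, by positivity, key h _ hh (by positivity) le_rfl hfin⟩

open VectorFourier in
/-- The functions `y ↦ φ_ε(x - y)` are smooth, with derivatives bounded by `C R^n`. -/
theorem Mollifier.net_bound {N : WeightSequence} (φ : Mollifier N d) (ε : Set.Ioc (0 : ℝ) 1)
    (x : Euc d) : ContDiff ℝ ∞ (fun y => φ.net ε (x - y)) ∧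
      ∃ C R : ℝ, 0 ≤ R ∧ ∀ n y, ‖iteratedFDeriv ℝ n (fun y => φ.net ε (x - y)) y‖ ≤ C * R ^ n := by
  have hε : (0 : ℝ) < ε := ε.2.1
  set L : Euc d →L[ℝ] Euc d →L[ℝ] ℝ := (-(2 * Real.pi * ε)⁻¹ : ℝ) • innerSL ℝ with hL
  set G : Euc d → ℂ := fun ξ => (((ε : ℝ) ^ d)⁻¹ * ((2 * Real.pi) ^ d)⁻¹ : ℂ) *
    (φ.hat ξ * Complex.exp (-(inner ℝ ((ε : ℝ)⁻¹ • x) ξ : ℝ) * Complex.I)) with hG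
  have hhat := φ.hat_mem
  have hhc : Continuous φ.hat := hhat.1.continuous
  have hGc : Continuous G := by
    have : Continuous fun ξ : Euc d => inner ℝ ((ε : ℝ)⁻¹ • x) ξ := by fun_prop
    fun_prop
  have hGs : HasCompactSupport G := by
    refine HasCompactSupport.mul_left ?_
    exact hhat.2.1.mul_right
  have hGi : ∀ n : ℕ, Integrable (fun v => ‖v‖ ^ n * ‖G v‖) := by
    intro n
    refine Continuous.integrable_of_hasCompactSupport (by fun_prop) ?_
    exact hGs.norm.mul_left
  have hG2 : ∀ v, 2 ≤ ‖v‖ → G v = 0 := by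
    intro v hv
    simp [hG, φ.hat_eq_zero v hv]
  have heq : (fun y => φ.net ε (x - y)) =
      fourierIntegral Real.fourierChar volume L.toLinearMap₁₂ G := by
    ext y
    simp only [Mollifier.net, φ.toFun_eq, fourierIntegral]
    rw [← mul_assoc, ← integral_const_mul]
    refine integral_congr_ae (Filter.Eventually.of_forall fun ξ => ?_)
    simp only [hG, Circle.smul_def, Real.fourierChar_apply, smul_eq_mul]
    rw [mul_left_comm (Complex.exp _), mul_left_comm (Complex.exp _), ← Complex.exp_add]
    simp only [Complex.ofReal_inv, Complex.ofReal_pow, Complex.ofReal_mul, Complex.ofReal_ofNat]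
    congr 3
    have e1 : L.toLinearMap₁₂ ξ y = -(2 * Real.pi * ε)⁻¹ * inner ℝ ξ y := by
      simp only [hL, ContinuousLinearMap.toLinearMap₁₂_apply]
      rfl
    have hpi := Real.pi_pos.ne'
    rw [e1, smul_sub, inner_sub_left, real_inner_smul_left y ξ, real_inner_comm ξ y]
    have e2 : 2 * Real.pi * -(-(2 * Real.pi * (ε : ℝ))⁻¹ * inner ℝ ξ y) =
        (ε : ℝ)⁻¹ * inner ℝ ξ y := by
      field_simp
    have e3 := congrArg Complex.ofReal e2
    push_cast at e3 ⊢
    linear_combination (-Complex.I) * e3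
  rw [heq]
  refine ⟨contDiff_fourierIntegral L (N := ⊤) fun n _ => hGi n, ∫ v, ‖G v‖,
    2 * Real.pi * ‖L‖ * 2, by positivity, fun n y => ?_⟩
  rw [iteratedFDeriv_fourierIntegral L (N := ⊤) (fun n _ => hGi n) hGc.aestronglyMeasurable
    (by exact_mod_cast le_top)]
  refine (norm_fourierIntegral_le_integral_norm _ _ _ _ _).trans ?_
  rw [← integral_mul_const]
  have hI : Integrable G := hGc.integrable_of_hasCompactSupport hGs
  refine integral_mono_of_nonneg (Filter.Eventually.of_forall fun _ => norm_nonneg _)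
    (hI.norm.mul_const _) (Filter.Eventually.of_forall fun v => ?_)
  refine (norm_fourierPowSMulRight_le L G v n).trans ?_
  rcases le_total 2 ‖v‖ with hv | hv
  · simp [hG2 v hv]
  · calc (2 * Real.pi * ‖L‖) ^ n * ‖v‖ ^ n * ‖G v‖
        ≤ (2 * Real.pi * ‖L‖) ^ n * 2 ^ n * ‖G v‖ := by gcongr
      _ = ‖G v‖ * (2 * Real.pi * ‖L‖ * 2) ^ n := by rw [mul_pow _ 2]; ring

end productBounds

/-- For `θ ∈ D^*(Ω)`, the test function `y ↦ θ(y) φ_ε(x - y)`. -/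
def kernelTest {c : UltraClass} {M N : WeightSequence} {Ω : TopologicalSpace.Opens (Euc d)}
    (φ : Mollifier N d) (θ : testFunctions c M Ω) (ε : Set.Ioc (0 : ℝ) 1) (x : Euc d) :
    testFunctions c M Ω :=
  ⟨fun y => (θ : Euc d → ℂ) y * φ.net ε (x - y), by
    obtain ⟨h, C, R, hR, hC⟩ := φ.net_bound ε x
    exact mul_mem_testFunctions θ h hR hC⟩

/-- The net `((θ f) * φ_ε)_ε`, where `θ f` is the compactly supported ultradistribution obtained by
multiplying `f ∈ D^*'(Ω)` with the cut-off `θ ∈ D^*(Ω)`. -/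
def mollify {c : UltraClass} {M N : WeightSequence} {Ω : TopologicalSpace.Opens (Euc d)}
    (φ : Mollifier N d) (θ : testFunctions c M Ω) (f : Ultradistribution c M Ω) : Net d :=
  fun ε x => f.1 (kernelTest φ θ ε x)

/-- `g ∈ G^*(Ω)` is the image of `f ∈ D^*'(Ω)` under the sheaf embedding which extends the
embedding `T ↦ [(T * φ_ε)_ε]` of compactly supported ultradistributions: whenever `θ ∈ D^*(Ω)`
equals `1` on an open set `U ⊆ Ω`, so that `f` and `θ f` agree on `U`, the restriction of `g` to `U`
is the class in `G^*(U)` of the net `((θ f) * φ_ε)_ε`. -/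
def IsImage {c : UltraClass} {M N : WeightSequence} {Ω : TopologicalSpace.Opens (Euc d)}
    (φ : Mollifier N d) (f : Ultradistribution c M Ω) (g : GenFun c M Ω) : Prop :=
  ∃ r : moderateNets c M Ω, GenFun.mk r = g ∧
    ∀ (U : TopologicalSpace.Opens (Euc d)) (θ : testFunctions c M Ω), U ≤ Ω →
      (∀ x ∈ U, (θ : Euc d → ℂ) x = 1) → (r : Net d) - mollify φ θ f ∈ negligibleNets c M U

/-- The embedding `ι : D^*'(Ω) → G^*(Ω)`. The value `ι f` is the unique `g` with `IsImage φ f g`;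
that there is exactly one such `g` for every `f` is asserted in the regularity theorem itself. -/
def embedding {c : UltraClass} {M N : WeightSequence} {Ω : TopologicalSpace.Opens (Euc d)}
    (φ : Mollifier N d) (f : Ultradistribution c M Ω) : GenFun c M Ω :=
  Classical.epsilon fun g => IsImage φ f g

end UltraAlg

end

open UltraAlg

open scoped FourierTransform

namespace UltraAlg

variable {d : ℕ}

/-! ### Weight sequences and their associated functions -/

namespace WeightSequence

variable (M : WeightSequence)

/-! The argument takes place on the Fourier side. For a cut-off `θ` the function `localFourier f θ`,
ζ ↦ f(θ e^{2πiζ·y}), is the transform of θf. It is continuous and bounded by B e^{M(2π|ζ|/s)}, for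
some s (Beurling) or for every s (Roumieu). The net (θf) * φ_ε is the Fourier transform of `φ.symbol
ε` times this function, where the symbol equals 1 for 2π|ζ| ≤ 1/ε and 0 for 2π|ζ| ≥ 2/ε. Condition
(M.2) enters only as e^{4M(t)} ≤ A e^{M(Ht)}: a dilation of the argument pays for the few extra
exponentials that are needed to estimate derivatives, to integrate over frequencies and to reach a
prescribed rate.

Moderateness follows at once, since only frequencies of size O(1/ε) occur (`mollify_derivBound`).
Locality is the point where N enters. Since the transform of φ lies in D^{(N_p)}, φ_ε(z) and its
derivatives are, up to powers of 1/ε, of size e^{-N(2π|z|/ε)}, and N dominates 2M at every scale;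
hence (ρf) * φ_ε is negligible wherever ρ vanishes (`normBigO_mollify_decay`). A partition of unity
then glues the local nets (`exists_isImage`), and uniqueness only needs cut-offs.

If f is a function u of class *, the transform of θu decays like e^{-M(κ·2π|ζ|)}, and u - (θu) * φ_ε
involves only the frequencies 2π|ζ| ≥ 1/ε. The difference is therefore negligible, and ι(u) is the
class of the constant net u, which is regular.

Conversely, let the net of f be regular and let θ = 1 near supp χ. At frequency ξ, write the
transform of χf as a pairing of the transforms of χe^{2πiξ·y} and θf, and split it with the symbol
for ε = 1/(4π|ξ|) (`localFourier_decay_aux`). The low part is the transform of χ((θf) * φ_ε) at -ξ: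
smoothness gives e^{-M(2π|ξ|/h)}, and regularity allows h to be small compared with 1/k (Beurling)
or k to be small compared with 1/h (Roumieu), so the growth e^{M(k/ε)} is absorbed. The high part
has |ζ| ≥ 2|ξ|, hence |ζ - ξ| ≥ |ζ|/2, and is controlled by the decay of the transform of χ. So χf
is a function of class *; its constant net differs from the given regular net by a negligible one,
the local functions agree because a constant negligible net vanishes, and they glue to u with f = u.
-/

theorem assoc_nonneg {t : ℝ} (ht : 0 ≤ t) : 0 ≤ M.assoc t := by
  have h := le_ciSup (M.bddAbove_assoc ht) 0
  simp only [pow_zero, M.zero, div_one, Real.log_one] at h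
  exact h

theorem one_le_exp_assoc {t : ℝ} (ht : 0 ≤ t) : 1 ≤ Real.exp (M.assoc t) :=
  Real.one_le_exp (M.assoc_nonneg ht)

theorem exp_neg_assoc_le_one {t : ℝ} (ht : 0 ≤ t) : Real.exp (-M.assoc t) ≤ 1 :=
  Real.exp_le_one_iff.2 (neg_nonpos.2 (M.assoc_nonneg ht))

theorem assoc_mono' {s t : ℝ} (hs : 0 ≤ s) (hst : s ≤ t) : M.assoc s ≤ M.assoc t := by
  rcases hs.eq_or_lt with rfl | hs
  · have h0 : M.assoc 0 ≤ 0 := by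
      refine ciSup_le fun p => ?_
      -- At t = 0 the term p = 0 is log 1, and the others are log 0, which is 0 by convention.
      rcases p with _ | p <;> simp [M.zero]
    exact h0.trans (M.assoc_nonneg hst)
  · exact M.assoc_mono hs hst

theorem pow_le_mul_exp_assoc {t : ℝ} (ht : 0 ≤ t) (p : ℕ) :
    t ^ p ≤ M.seq p * Real.exp (M.assoc t) := by
  have hp := M.pos p
  rcases (pow_nonneg ht p).eq_or_lt with h | h
  · rw [← h]; positivity
  · have h1 := le_ciSup (M.bddAbove_assoc ht) p
    rw [mul_comm, ← div_le_iff₀ hp]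
    exact (Real.log_le_iff_le_exp (div_pos h hp)).1 h1

/-- The factor e^{-M(t)} is the infimum of M_p/t^p, so bounds for all p combine into exponential
decay. Every decay estimate from derivative bounds below passes through this lemma. -/
theorem le_mul_exp_neg_assoc {t x C : ℝ} (ht : 0 ≤ t) (hC : 0 ≤ C)
    (h : ∀ p, t ^ p * x ≤ C * M.seq p) : x ≤ C * Real.exp (-M.assoc t) := by
  rcases le_or_gt x 0 with hx | hx
  · exact hx.trans (by positivity)
  have h0 : x ≤ C := by simpa [M.zero] using h 0
  have hCpos : 0 < C := hx.trans_le h0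
  have h1 : M.assoc t ≤ Real.log (C / x) := by
    refine ciSup_le fun p => ?_
    have hp := M.pos p
    rcases (div_nonneg (pow_nonneg ht p) hp.le).eq_or_lt with h2 | h2
    · rw [← h2, Real.log_zero]
      exact Real.log_nonneg ((one_le_div hx).2 h0)
    · refine Real.log_le_log h2 ?_
      rw [div_le_div_iff₀ hp hx]
      exact h p
  have h2 : Real.exp (M.assoc t) ≤ C / x := by
    rwa [← Real.le_log_iff_exp_le (by positivity)]
  rw [Real.exp_neg, ← div_eq_mul_inv, le_div_iff₀ (Real.exp_pos _)]
  rw [le_div_iff₀ hx] at h2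
  linarith

/-- `t^p ≤ k^p M_p e^{M(t/k)}`. -/
theorem pow_le_pow_mul {t k : ℝ} (ht : 0 ≤ t) (hk : 0 < k) (p : ℕ) :
    t ^ p ≤ k ^ p * M.seq p * Real.exp (M.assoc (t / k)) := by
  have h := M.pow_le_mul_exp_assoc (t := t / k) (by positivity) p
  rw [div_pow, div_le_iff₀ (by positivity)] at h
  linarith

/-- Condition (M.2) with q = p gives (Ht)^{2p} ≤ M_{2p} e^{M(Ht)} ≤ A H^{2p} M_p² e^{M(Ht)}. After
cancelling H^{2p}, the square root bounds t^p by C M_p with C² = A e^{M(Ht)}, and the infimum over p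
gives e^{M(t)} ≤ C. -/
theorem ModerateGrowth.exp_two_le {M : WeightSequence} (hM : M.ModerateGrowth) :
    ∃ A H : ℝ, 1 ≤ A ∧ 1 ≤ H ∧ ∀ t : ℝ, 0 ≤ t →
      Real.exp (2 * M.assoc t) ≤ A * Real.exp (M.assoc (H * t)) := by
  obtain ⟨A, H, hA, hH, h⟩ := hM
  refine ⟨A, H, hA, hH, fun t ht => ?_⟩
  set C : ℝ := √(A * Real.exp (M.assoc (H * t))) with hC
  have hC2 : C ^ 2 = A * Real.exp (M.assoc (H * t)) := Real.sq_sqrt (by positivity)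
  have hC0 : 0 ≤ C := Real.sqrt_nonneg _
  have key : 1 ≤ C * Real.exp (-M.assoc t) := by
    refine M.le_mul_exp_neg_assoc ht hC0 fun p => ?_
    have hp := M.pos p
    have h1 := M.pow_le_mul_exp_assoc (t := H * t) (by positivity) (p + p)
    have h2 := h p p
    have h3 : (H ^ (p + p) * (t ^ p) ^ 2) ≤ H ^ (p + p) * (C * M.seq p) ^ 2 := by
      calc H ^ (p + p) * (t ^ p) ^ 2 = (H * t) ^ (p + p) := by ring
        _ ≤ _ := h1
        _ ≤ (A * H ^ (p + p) * M.seq p * M.seq p) * Real.exp (M.assoc (H * t)) := by gcongr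
        _ = H ^ (p + p) * (C * M.seq p) ^ 2 := by rw [mul_pow, hC2]; ring
    have h4 := le_of_mul_le_mul_left h3 (by positivity)
    rw [mul_one]
    exact le_of_sq_le_sq h4 (by positivity)
  rw [Real.exp_neg, ← div_eq_mul_inv, le_div_iff₀ (Real.exp_pos _), one_mul] at key
  rw [two_mul, Real.exp_add, ← hC2, sq]
  exact mul_le_mul key key (Real.exp_pos _).le hC0

/-- The doubling estimate applied twice. Four factors are enough for every later estimate. -/
theorem ModerateGrowth.exp_four_le {M : WeightSequence} (hM : M.ModerateGrowth) :
    ∃ A H : ℝ, 1 ≤ A ∧ 1 ≤ H ∧ ∀ t : ℝ, 0 ≤ t →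
      Real.exp (M.assoc t) ^ 4 ≤ A * Real.exp (M.assoc (H * t)) := by
  obtain ⟨A, H, hA, hH, h⟩ := hM.exp_two_le
  refine ⟨A ^ 2 * A, H * H, one_le_mul_of_one_le_of_one_le (one_le_pow₀ hA) hA,
    one_le_mul_of_one_le_of_one_le hH hH, fun t ht => ?_⟩
  have h1 := h t ht
  have h2 := h (H * t) (by positivity)
  calc Real.exp (M.assoc t) ^ 4 = Real.exp (2 * M.assoc t) ^ 2 := by
        simp only [← Real.exp_nat_mul]; push_cast; ring_nf
    _ ≤ (A * Real.exp (M.assoc (H * t))) ^ 2 := by gcongr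
    _ = A ^ 2 * Real.exp (2 * M.assoc (H * t)) := by
        rw [mul_pow, ← Real.exp_nat_mul]; push_cast; ring_nf
    _ ≤ A ^ 2 * (A * Real.exp (M.assoc (H * (H * t)))) := by gcongr
    _ = _ := by rw [mul_assoc H H t]; ring

/-- `e^{-M(Ht)} ≤ A e^{-4M(t)}`. -/
theorem ModerateGrowth.exp_neg_le {M : WeightSequence} (hM : M.ModerateGrowth) :
    ∃ A H : ℝ, 1 ≤ A ∧ 1 ≤ H ∧
      (∀ t : ℝ, 0 ≤ t → Real.exp (M.assoc t) ^ 4 ≤ A * Real.exp (M.assoc (H * t))) ∧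
      ∀ t : ℝ, 0 ≤ t → Real.exp (-M.assoc (H * t)) ≤ A * Real.exp (-M.assoc t) ^ 4 := by
  obtain ⟨A, H, hA, hH, h⟩ := hM.exp_four_le
  refine ⟨A, H, hA, hH, h, fun t ht => ?_⟩
  have h1 := h t ht
  rw [Real.exp_neg, Real.exp_neg, inv_pow, ← div_eq_mul_inv, inv_eq_one_div,
    div_le_div_iff₀ (by positivity) (by positivity)]
  linarith

/-- Powers are dominated by `e^{M}`. -/
theorem one_add_pow_le (m : ℕ) {q : ℝ} (hq : 0 < q) :
    ∃ C : ℝ, 0 ≤ C ∧ ∀ t : ℝ, 0 ≤ t → (1 + t) ^ m ≤ C * Real.exp (M.assoc (q * t)) := by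
  have hm := M.pos m
  refine ⟨2 ^ m * (1 + q⁻¹ ^ m * M.seq m), by positivity, fun t ht => ?_⟩
  have h1 : (1 + t) ^ m ≤ 2 ^ m * (1 + t ^ m) := by
    have h2 : (1 + t) ^ m ≤ 2 ^ (m - 1) * (1 ^ m + t ^ m) :=
      add_pow_le zero_le_one ht m
    rw [one_pow] at h2
    refine h2.trans ?_
    gcongr
    · norm_num
    · omega
  have h3 := M.pow_le_pow_mul ht (inv_pos.2 hq) m
  rw [div_inv_eq_mul, mul_comm t q] at h3
  have h4 := M.one_le_exp_assoc (t := q * t) (by positivity)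
  calc (1 + t) ^ m ≤ 2 ^ m * (1 + t ^ m) := h1
    _ ≤ 2 ^ m * (Real.exp (M.assoc (q * t)) + q⁻¹ ^ m * M.seq m * Real.exp (M.assoc (q * t))) := by
      gcongr
    _ = _ := by ring

theorem ratio_anti : Antitone fun p => M.seq p / M.seq (p + 1) := by
  refine antitone_nat_of_succ_le fun p => ?_
  have h1 := M.pos (p + 1)
  have h2 := M.pos (p + 2)
  rw [div_le_div_iff₀ h2 h1]
  linarith [M.logConvex p]

/-- The ratios M_p/M_{p+1} decrease and are summable, so n + 1 times the n-th one is at most their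
sum. This absorbs the Leibniz factor n + 1 created by multiplication with a coordinate. -/
theorem exists_nat_mul_le : ∃ S : ℝ, 0 ≤ S ∧ ∀ n : ℕ,
    (n + 1 : ℝ) * M.seq n ≤ S * M.seq (n + 1) := by
  have h0 : ∀ p, 0 ≤ M.seq p / M.seq (p + 1) := fun p => (div_pos (M.pos _) (M.pos _)).le
  refine ⟨∑' p, M.seq p / M.seq (p + 1), tsum_nonneg h0, fun n => ?_⟩
  have h1 := M.pos (n + 1)
  have h2 := M.nonQuasianalytic.sum_le_tsum (Finset.range (n + 1)) fun p _ => h0 p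
  have h3 : ((Finset.range (n + 1)).card : ℝ) * (M.seq n / M.seq (n + 1)) ≤
      ∑ p ∈ Finset.range (n + 1), M.seq p / M.seq (p + 1) := by
    rw [← nsmul_eq_mul]
    exact Finset.card_nsmul_le_sum _ _ _ fun p hp =>
      M.ratio_anti (Nat.lt_succ_iff.1 (Finset.mem_range.1 hp))
  rw [Finset.card_range] at h3
  push_cast at h3
  have h4 := h3.trans h2
  rwa [← mul_div_assoc, div_le_iff₀ h1] at h4

/-- The term p = 1 of the supremum already gives this rate, which suffices to see that the decay
scale tends to 0. -/
theorem exp_neg_assoc_tendsto {k : ℝ} (hk : 0 < k) :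
    ∃ C : ℝ, 0 ≤ C ∧ ∀ ε : ℝ, 0 < ε → Real.exp (-M.assoc (k / ε)) ≤ C * ε := by
  have h1 := M.pos 1
  refine ⟨M.seq 1 / k, by positivity, fun ε hε => ?_⟩
  have h := M.pow_le_mul_exp_assoc (t := k / ε) (by positivity) 1
  rw [pow_one] at h
  rw [Real.exp_neg, inv_le_iff_one_le_mul₀ (Real.exp_pos _)]
  rw [div_le_iff₀ hε] at h
  rw [div_mul_eq_mul_div, div_mul_eq_mul_div, le_div_iff₀ hk]
  linarith

end WeightSequence

/-! ### Bounds on the total derivatives -/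

/-- The bounds `‖D^n g(x)‖ ≤ C h^n M_n` for `x ∈ S`. -/
def DerivBound (M : WeightSequence) (h C : ℝ) (S : Set (Euc d)) (g : Euc d → ℂ) : Prop :=
  ∀ x ∈ S, ∀ n, ‖iteratedFDeriv ℝ n g x‖ ≤ C * (h ^ n * M.seq n)

namespace DerivBound

variable {M : WeightSequence} {h h' C C' : ℝ} {S S' : Set (Euc d)} {f g : Euc d → ℂ}

theorem subset (H : DerivBound M h C S g) (hS : S' ⊆ S) : DerivBound M h C S' g :=
  fun x hx => H x (hS hx)

theorem congr (H : DerivBound M h C S g) {U : Set (Euc d)} (hU : IsOpen U) (hS : S ⊆ U)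
    (hfg : ∀ x ∈ U, f x = g x) : DerivBound M h C S f := fun x hx n => by
  have : f =ᶠ[nhds x] g := by
    filter_upwards [hU.mem_nhds (hS hx)] with y hy using hfg y hy
  rw [(this.iteratedFDeriv ℝ n).eq_of_nhds]
  exact H x hx n

theorem add (hf : ∀ x ∈ S, ContDiffAt ℝ ∞ f x) (hg : ∀ x ∈ S, ContDiffAt ℝ ∞ g x)
    (H : DerivBound M h C S f) (H' : DerivBound M h C' S g) :
    DerivBound M h (C + C') S (f + g) := fun x hx n => by
  have hn : (n : ℕ∞ω) ≤ ∞ := by exact_mod_cast le_top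
  rw [iteratedFDeriv_add_apply ((hf x hx).of_le hn) ((hg x hx).of_le hn), add_mul]
  exact (norm_add_le _ _).trans (add_le_add (H x hx n) (H' x hx n))

/-- The Leibniz rule together with M_i M_{n-i} ≤ M_n leaves the binomial sum of (h + h')^n. -/
theorem mul (hf : ∀ x ∈ S, ContDiffAt ℝ ∞ f x) (hg : ∀ x ∈ S, ContDiffAt ℝ ∞ g x)
    (hh : 0 ≤ h) (hh' : 0 ≤ h') (hC : 0 ≤ C)
    (H : DerivBound M h C S f) (H' : DerivBound M h' C' S g) :
    DerivBound M (h + h') (C * C') S (fun y => f y * g y) := fun x hx n => by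
  have hn : (n : ℕ∞ω) ≤ ∞ := by exact_mod_cast le_top
  -- Smoothness is assumed only at the points of S, so the Leibniz estimate is applied within an
  -- open neighbourhood on which both factors are of class C^n.
  obtain ⟨u, hu, hfu⟩ := (hf x hx).contDiffOn hn (by simp)
  obtain ⟨v, hv, hgv⟩ := (hg x hx).contDiffOn hn (by simp)
  set s := interior (u ∩ v) with hs
  have hso : IsOpen s := isOpen_interior
  have hxs : x ∈ s := mem_interior_iff_mem_nhds.2 (Filter.inter_mem hu hv)
  have h1 := norm_iteratedFDerivWithin_mul_le (s := s) (hfu.mono (interior_subset.trans Set.inter_subset_left))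
    (hgv.mono (interior_subset.trans Set.inter_subset_right)) hso.uniqueDiffOn hxs (n := n) le_rfl
  have e : ∀ (i : ℕ) (k : Euc d → ℂ), iteratedFDerivWithin ℝ i k s x = iteratedFDeriv ℝ i k x :=
    fun i _ => iteratedFDerivWithin_of_isOpen i hso hxs
  simp only [e] at h1
  refine h1.trans ?_
  have h2 : ∀ i ∈ Finset.range (n + 1),
      (n.choose i : ℝ) * ‖iteratedFDeriv ℝ i f x‖ * ‖iteratedFDeriv ℝ (n - i) g x‖ ≤
        (C * C' * M.seq n) * (h ^ i * h' ^ (n - i) * n.choose i) := by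
    intro i hi
    have hin : i + (n - i) = n := by have := Finset.mem_range.1 hi; omega
    have h3 := M.mul_le i (n - i)
    rw [hin] at h3
    have hi0 := M.pos i
    have hj0 := M.pos (n - i)
    calc (n.choose i : ℝ) * ‖iteratedFDeriv ℝ i f x‖ * ‖iteratedFDeriv ℝ (n - i) g x‖
        ≤ n.choose i * (C * (h ^ i * M.seq i)) * (C' * (h' ^ (n - i) * M.seq (n - i))) := by
          gcongr
          · exact H x hx i
          · exact H' x hx (n - i)
      _ = (C * C' * (M.seq i * M.seq (n - i))) * (h ^ i * h' ^ (n - i) * n.choose i) := by ring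
      _ ≤ _ := by
        have := (norm_nonneg _).trans (H' x hx 0)
        rw [pow_zero, one_mul, M.zero, mul_one] at this
        gcongr
  refine (Finset.sum_le_sum h2).trans (le_of_eq ?_)
  rw [← Finset.mul_sum, ← add_pow]
  ring

theorem nonneg (H : DerivBound M h C S g) (hS : S.Nonempty) : 0 ≤ C := by
  obtain ⟨x, hx⟩ := hS
  simpa [M.zero] using (norm_nonneg _).trans (H x hx 0)

/-- Passing from partial to total derivatives costs d^n. The factor d + 1 in place of d keeps the
parameter positive in every dimension. -/
theorem of_ultraNorm (hh : 0 < h) {C : ℝ≥0} (H : ultraNorm M h S g ≤ C) :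
    DerivBound M ((d + 1) * h) C S g := fun x hx n => by
  rw [ultraNorm_le_iff M hh] at H
  have hn := M.pos n
  refine (norm_iteratedFDeriv_le_of_partialDeriv (by positivity) (H x hx n)).trans ?_
  calc (d : ℝ) ^ n * (C * (h ^ n * M.seq n)) ≤ (d + 1 : ℝ) ^ n * (C * (h ^ n * M.seq n)) := by
        gcongr; linarith
    _ = _ := by rw [mul_pow]; ring

theorem ultraNorm_le (hh : 0 < h) {C : ℝ≥0} (H : DerivBound M h C S g) : ultraNorm M h S g ≤ C :=
  (ultraNorm_le_iff M hh S g C).2 fun x hx n w =>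
    (norm_partialDeriv_le g n w x).trans (H x hx n)

theorem ultraNorm_le_ofReal (hh : 0 < h) (hC : 0 ≤ C) (H : DerivBound M h C S g) :
    ultraNorm M h S g ≤ ENNReal.ofReal C := by
  lift C to ℝ≥0 using hC
  simpa using H.ultraNorm_le hh

theorem of_ultraNorm_lt_top (hh : 0 < h) (H : ultraNorm M h S g < ⊤) :
    ∃ C : ℝ, 0 ≤ C ∧ DerivBound M ((d + 1) * h) C S g :=
  ⟨(ultraNorm M h S g).toNNReal, NNReal.coe_nonneg _,
    of_ultraNorm hh (by rw [ENNReal.coe_toNNReal H.ne])⟩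

/-- The derivatives at points outside `tsupport g` vanish. -/
theorem univ_of_tsupport (hh : 0 ≤ h) (hC : 0 ≤ C) (H : DerivBound M h C (tsupport g) g) :
    DerivBound M h C S g := fun x _ n => by
  by_cases hx : x ∈ tsupport g
  · exact H x hx n
  · have := M.pos n
    rw [show iteratedFDeriv ℝ n g x = 0 from by
      by_contra h0
      exact hx (support_iteratedFDeriv_subset n h0), norm_zero]
    positivity

end DerivBound

/-- A function of class `*` has derivative bounds for all `h > 0` (resp. for some `h > 0`). -/
theorem HasUltraBound.derivBound {c : UltraClass} {M : WeightSequence} {S : Set (Euc d)}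
    {g : Euc d → ℂ} (H : HasUltraBound c M S g) :
    match c with
    | .beurling => ∀ h : ℝ, 0 < h → ∃ C : ℝ, 0 ≤ C ∧ DerivBound M h C S g
    | .roumieu => ∃ h : ℝ, 0 < h ∧ ∃ C : ℝ, 0 ≤ C ∧ DerivBound M h C S g := by
  have hd : (0 : ℝ) < d + 1 := by positivity
  cases c with
  | beurling =>
    intro h hh
    have := DerivBound.of_ultraNorm_lt_top (div_pos hh hd) (H (h / (d + 1)) (div_pos hh hd))
    rwa [mul_div_cancel₀ _ hd.ne'] at this
  | roumieu =>
    obtain ⟨h, hh, H⟩ := H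
    exact ⟨(d + 1) * h, by positivity, DerivBound.of_ultraNorm_lt_top hh H⟩

theorem HasUltraBound.of_derivBound {c : UltraClass} {M : WeightSequence} {S : Set (Euc d)}
    {g : Euc d → ℂ} (H : match c with
      | .beurling => ∀ h : ℝ, 0 < h → ∃ C : ℝ, 0 ≤ C ∧ DerivBound M h C S g
      | .roumieu => ∃ h : ℝ, 0 < h ∧ ∃ C : ℝ, 0 ≤ C ∧ DerivBound M h C S g) :
    HasUltraBound c M S g := by
  cases c with
  | beurling =>
    intro h hh
    obtain ⟨C, hC, H⟩ := H h hh
    exact (H.ultraNorm_le_ofReal hh hC).trans_lt ENNReal.ofReal_lt_top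
  | roumieu =>
    obtain ⟨h, hh, C, hC, H⟩ := H
    exact ⟨h, hh, (H.ultraNorm_le_ofReal hh hC).trans_lt ENNReal.ofReal_lt_top⟩

/-! ### Fourier transforms -/

/-- An integrable weight on `ℝ^d`. -/
noncomputable def polyWeight (ζ : Euc d) : ℝ := ((1 + ‖ζ‖) ^ (d + 1))⁻¹

theorem polyWeight_pos (ζ : Euc d) : 0 < polyWeight ζ := by
  unfold polyWeight; positivity

theorem integrable_polyWeight : Integrable (polyWeight : Euc d → ℝ) := by
  have h := integrable_one_add_norm (E := Euc d) (μ := volume) (r := (d + 1 : ℕ)) (by simp)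
  refine h.congr (Filter.Eventually.of_forall fun ζ => ?_)
  simp only [polyWeight]
  rw [Real.rpow_neg (by positivity), Real.rpow_natCast]

theorem exp_neg_assoc_le_polyWeight (M : WeightSequence) {q : ℝ} (hq : 0 < q) :
    ∃ C : ℝ, 0 ≤ C ∧ ∀ ζ : Euc d, Real.exp (-M.assoc (q * ‖ζ‖)) ≤ C * polyWeight ζ := by
  obtain ⟨C, hC, h⟩ := M.one_add_pow_le (d + 1) hq
  refine ⟨C, hC, fun ζ => ?_⟩
  rw [polyWeight, Real.exp_neg, ← div_eq_mul_inv, inv_eq_one_div,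
    div_le_div_iff₀ (Real.exp_pos _) (by positivity), one_mul]
  exact h _ (norm_nonneg ζ)

section

variable {M : WeightSequence}

/-- A Fourier transform is smooth with derivative bounds if the symbol decays. -/
theorem derivBound_fourier {a : Euc d → ℂ} (ha : AEStronglyMeasurable a) {h : ℝ} {w : Euc d → ℝ}
    (hw : Integrable w)
    (haw : ∀ (n : ℕ) ζ, (2 * Real.pi * ‖ζ‖) ^ n * ‖a ζ‖ ≤ h ^ n * M.seq n * w ζ) :
    ContDiff ℝ ∞ (𝓕 a) ∧ DerivBound M h (∫ ζ, w ζ) Set.univ (𝓕 a) := by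
  have hint : ∀ n : ℕ, Integrable fun ζ => ‖ζ‖ ^ n * ‖a ζ‖ := by
    intro n
    refine Integrable.mono' (g := fun ζ => ((2 * Real.pi) ^ n)⁻¹ * (h ^ n * M.seq n * w ζ))
      ((hw.const_mul _).const_mul _) ?_ (Filter.Eventually.of_forall fun ζ => ?_)
    · exact (by fun_prop : Continuous fun ζ : Euc d => ‖ζ‖ ^ n).aestronglyMeasurable.mul ha.norm
    · rw [Real.norm_of_nonneg (by positivity), ← div_eq_inv_mul, le_div_iff₀ (by positivity)]
      refine le_trans (le_of_eq ?_) (haw n ζ)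
      rw [mul_pow]; ring
  refine ⟨Real.contDiff_fourier (N := ⊤) fun n _ => hint n, fun x _ n => ?_⟩
  rw [Real.iteratedFDeriv_fourier (N := ⊤) (fun n _ => hint n) ha (by exact_mod_cast le_top)]
  refine (VectorFourier.norm_fourierIntegral_le_integral_norm _ _ _ _ _).trans ?_
  rw [← integral_mul_const]
  refine integral_mono_of_nonneg (Filter.Eventually.of_forall fun _ => norm_nonneg _)
    (hw.mul_const _) (Filter.Eventually.of_forall fun ζ => ?_)
  refine (VectorFourier.norm_fourierPowSMulRight_le _ a ζ n).trans ?_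
  calc (2 * Real.pi * ‖innerSL ℝ (E := Euc d)‖) ^ n * ‖ζ‖ ^ n * ‖a ζ‖
      ≤ (2 * Real.pi * 1) ^ n * ‖ζ‖ ^ n * ‖a ζ‖ := by
        gcongr; exact norm_innerSL_le _
    _ = (2 * Real.pi * ‖ζ‖) ^ n * ‖a ζ‖ := by
        rw [mul_one, mul_pow (2 * Real.pi) ‖ζ‖]
    _ ≤ h ^ n * M.seq n * w ζ := haw n ζ
    _ = _ := by ring

theorem partialDeriv_fourier {a : Euc d → ℂ} (ha : AEStronglyMeasurable a)
    (hint : ∀ n : ℕ, Integrable fun ζ => ‖ζ‖ ^ n * ‖a ζ‖) (n : ℕ) (w : Fin n → Fin d) (x : Euc d) :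
    partialDeriv (𝓕 a) n w x =
      𝓕 (fun ζ : Euc d => (-(2 * Real.pi * Complex.I)) ^ n * ((∏ j, ζ (w j) : ℝ) * a ζ)) x := by
  rw [partialDeriv, Real.iteratedFDeriv_fourier (N := ⊤) (fun n _ => hint n) ha
    (by exact_mod_cast le_top), Real.fourier_continuousMultilinearMap_apply]
  · refine congrFun (congrArg _ (funext fun ζ => ?_)) x
    rw [VectorFourier.fourierPowSMulRight_apply]
    have e : ∀ i, innerSL ℝ ζ (EuclideanSpace.single (w i) (1 : ℝ)) = ζ (w i) := fun i => by
      refine (EuclideanSpace.inner_single_right (w i) (1 : ℝ) ζ).trans ?_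
      simp
    simp [e]
  · exact VectorFourier.integrable_fourierPowSMulRight _ (hint n) ha

/-- The multilinear map is evaluated at the constant tuple (ζ, …, ζ), where the pairing is |ζ|², and
|ζ|^n is divided out. -/
theorem pow_mul_norm_le_norm_fourierPowSMulRight (n : ℕ) (g : Euc d → ℂ) (ζ : Euc d) :
    (2 * Real.pi * ‖ζ‖) ^ n * ‖g ζ‖ ≤
      ‖VectorFourier.fourierPowSMulRight (-innerSL ℝ) g ζ n‖ := by
  have h2 := ContinuousMultilinearMap.le_opNorm (VectorFourier.fourierPowSMulRight
    (-innerSL ℝ) g ζ n) fun _ => ζ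
  rw [VectorFourier.fourierPowSMulRight_apply] at h2
  have e : innerSL ℝ ζ ζ = ‖ζ‖ ^ 2 := real_inner_self_eq_norm_sq ζ
  simp only [neg_apply, Finset.prod_const, Finset.card_univ, Fintype.card_fin, norm_smul, norm_pow,
    norm_neg, e, norm_mul, Complex.norm_I, mul_one, Complex.norm_real, Complex.norm_ofNat,
    Real.norm_eq_abs, abs_norm, abs_of_pos Real.pi_pos] at h2
  rcases eq_or_ne ζ 0 with rfl | hζ
  · rcases n with _ | n
    · simpa using h2
    · simp
  · have hζ' : 0 < ‖ζ‖ := norm_pos_iff.2 hζ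
    refine le_of_mul_le_mul_right (le_trans (le_of_eq ?_) h2) (pow_pos hζ' n)
    rw [mul_pow (2 * Real.pi), ← pow_mul, mul_comm 2 n, pow_mul, sq]; ring

/-- The Fourier transform of a compactly supported function of class `*` decays. -/
theorem norm_fourier_le {v : Euc d → ℂ} (hv : ContDiff ℝ ∞ v) (hvc : HasCompactSupport v)
    {K : Set (Euc d)} (hK : IsCompact K) (hvK : tsupport v ⊆ K) {h C : ℝ} (hh : 0 < h) (hC : 0 ≤ C)
    (H : DerivBound M h C K v) (ζ : Euc d) :
    ‖𝓕 v ζ‖ ≤ C * volume.real K * Real.exp (-M.assoc (2 * Real.pi * ‖ζ‖ / h)) := by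
  -- It remains to bound (2π|ζ|)^n times the transform of v by that of D^n v, whose integral norm is
  -- at most C h^n M_n vol(K), for each n.
  refine M.le_mul_exp_neg_assoc (by positivity) (by positivity) fun n => ?_
  have hn := M.pos n
  have hn' : ∀ n : ℕ, (n : ℕ∞ω) ≤ ∞ := fun n => by exact_mod_cast le_top
  have hint : ∀ n : ℕ, Integrable (iteratedFDeriv ℝ n v) := fun n =>
    (hv.continuous_iteratedFDeriv (hn' n)).integrable_of_hasCompactSupport (hvc.iteratedFDeriv n)
  have h1 : ‖𝓕 (iteratedFDeriv ℝ n v) ζ‖ ≤ C * (h ^ n * M.seq n) * volume.real K := by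
    refine (VectorFourier.norm_fourierIntegral_le_integral_norm _ _ _ _ _).trans ?_
    rw [← setIntegral_eq_integral_of_forall_compl_eq_zero (s := K)]
    · refine (integral_mono_of_nonneg (g := fun _ => C * (h ^ n * M.seq n))
        (Filter.Eventually.of_forall fun _ => norm_nonneg _)
        (integrableOn_const hK.measure_lt_top.ne) ?_).trans (le_of_eq ?_)
      · filter_upwards [ae_restrict_mem hK.measurableSet] with x hx using H x hx n
      · rw [setIntegral_const, smul_eq_mul, mul_comm]
    · intro x hx
      rw [norm_eq_zero]
      by_contra h0
      exact hx (hvK (support_iteratedFDeriv_subset n h0))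
  rw [Real.fourier_iteratedFDeriv (N := ⊤) hv (fun n _ => hint n) (by exact_mod_cast le_top)] at h1
  rw [div_pow, div_mul_eq_mul_div, div_le_iff₀ (by positivity)]
  refine (pow_mul_norm_le_norm_fourierPowSMulRight n (𝓕 v) ζ).trans (h1.trans (le_of_eq ?_))
  ring

end

/-! ### Symbol estimates with decay or growth rates -/

section

variable {M : WeightSequence}

theorem integrable_of_decay {a : Euc d → ℂ} (ha : AEStronglyMeasurable a) {κ C : ℝ} (hκ : 0 < κ)
    (hC : 0 ≤ C) (h : ∀ ζ, ‖a ζ‖ ≤ C * Real.exp (-M.assoc (κ * (2 * Real.pi * ‖ζ‖)))) :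
    Integrable a := by
  obtain ⟨D, hD, hw⟩ := exp_neg_assoc_le_polyWeight (d := d) M (q := κ * (2 * Real.pi))
    (by positivity)
  refine (integrable_polyWeight.const_mul (C * D)).mono' ha (Filter.Eventually.of_forall fun ζ => ?_)
  refine (h ζ).trans ?_
  rw [mul_assoc C, ← mul_assoc κ]
  exact mul_le_mul_of_nonneg_left (hw ζ) hC

/-- The Fourier transform of a rapidly decaying symbol, vanishing on a ball, is small together with
its derivatives. -/
theorem derivBound_fourier_of_decay {A H : ℝ} (hA : 0 ≤ A) (hH : 0 < H)
    (hAH : ∀ t : ℝ, 0 ≤ t → Real.exp (-M.assoc (H * t)) ≤ A * Real.exp (-M.assoc t) ^ 4)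
    {κ : ℝ} (hκ : 0 < κ) : ∃ D : ℝ, 0 ≤ D ∧ ∀ (a : Euc d → ℂ) (C r : ℝ), AEStronglyMeasurable a →
      0 ≤ C → 0 ≤ r → (∀ ζ, ‖a ζ‖ ≤ C * Real.exp (-M.assoc (κ * (2 * Real.pi * ‖ζ‖)))) →
      (∀ ζ, 2 * Real.pi * ‖ζ‖ < r → a ζ = 0) → ContDiff ℝ ∞ (𝓕 a) ∧
        DerivBound M (H / κ) (C * D * Real.exp (-M.assoc (κ * r / H))) Set.univ (𝓕 a) := by
  obtain ⟨D, hD, hw⟩ := exp_neg_assoc_le_polyWeight (d := d) M (q := κ / H * (2 * Real.pi))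
    (by positivity)
  have hI : 0 ≤ ∫ ζ : Euc d, polyWeight ζ := integral_nonneg fun ζ => (polyWeight_pos ζ).le
  refine ⟨A * D * ∫ ζ : Euc d, polyWeight ζ, by positivity, fun a C r ha hC hr hadec har => ?_⟩
  have h0 := derivBound_fourier (M := M) ha (h := H / κ)
    (w := fun ζ => C * A * D * Real.exp (-M.assoc (κ * r / H)) * polyWeight ζ)
    (integrable_polyWeight.const_mul _) fun n ζ => ?_
  · refine ⟨h0.1, ?_⟩
    have e : ∫ ζ : Euc d, C * A * D * Real.exp (-M.assoc (κ * r / H)) * polyWeight ζ =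
        C * (A * D * ∫ ζ : Euc d, polyWeight ζ) * Real.exp (-M.assoc (κ * r / H)) := by
      rw [integral_const_mul]; ring
    rw [← e]
    exact h0.2
  have hn := M.pos n
  have hζ := (polyWeight_pos ζ).le
  rcases lt_or_ge (2 * Real.pi * ‖ζ‖) r with hlt | hge
  · rw [har ζ hlt, norm_zero, mul_zero]
    positivity
  set t := 2 * Real.pi * ‖ζ‖ with ht
  have ht0 : 0 ≤ t := by positivity
  set E := Real.exp (-M.assoc (κ * t / H)) with hE
  have hE0 : 0 < E := Real.exp_pos _
  have h1 : ‖a ζ‖ ≤ C * (A * E ^ 4) := by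
    refine (hadec ζ).trans (mul_le_mul_of_nonneg_left ?_ hC)
    have := hAH (κ * t / H) (by positivity)
    rwa [mul_div_cancel₀ _ hH.ne'] at this
  have h2 : t ^ n * E ≤ (H / κ) ^ n * M.seq n := by
    have := M.pow_le_pow_mul ht0 (k := H / κ) (by positivity) n
    rw [show t / (H / κ) = κ * t / H by field_simp] at this
    rw [hE, Real.exp_neg, ← div_eq_mul_inv, div_le_iff₀ (Real.exp_pos _)]
    exact this
  have h3 : E ≤ D * polyWeight ζ := by
    refine le_trans (le_of_eq ?_) (hw ζ)
    rw [hE, ht]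
    congr 3
    field_simp
  have h4 : E ≤ Real.exp (-M.assoc (κ * r / H)) := by
    refine Real.exp_le_exp.2 (neg_le_neg (M.assoc_mono' (by positivity) ?_))
    gcongr
  have h5 : E ≤ 1 := M.exp_neg_assoc_le_one (by positivity)
  -- The four factors E are spent one by one: on t^n, on the trivial bound 1, on the integrable
  -- weight, and on the smallness coming from t ≥ r.
  calc t ^ n * ‖a ζ‖ ≤ t ^ n * (C * (A * E ^ 4)) := by gcongr
    _ = C * A * (t ^ n * E) * E * E * E := by ring
    _ ≤ C * A * ((H / κ) ^ n * M.seq n) * 1 * (D * polyWeight ζ) *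
        Real.exp (-M.assoc (κ * r / H)) := by gcongr
    _ = _ := by ring

/-- The Fourier transform of a symbol of controlled growth, supported in a ball of radius `1 / ε`,
is of moderate growth. -/
theorem derivBound_fourier_of_growth {A H : ℝ} (hA : 0 ≤ A) (hH : 0 < H)
    (hAH : ∀ t : ℝ, 0 ≤ t → Real.exp (M.assoc t) ^ 4 ≤ A * Real.exp (M.assoc (H * t)))
    {h s k : ℝ} (hh : 0 < h) (hs : 0 < s) (hk : 0 < k) (hkh : 2 * H ≤ k * h) (hks : 2 * H ≤ k * s) :
    ∃ D : ℝ, 0 ≤ D ∧ ∀ (a : Euc d → ℂ) (C ε : ℝ), AEStronglyMeasurable a → 0 ≤ C → 0 < ε →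
      (∀ ζ, ‖a ζ‖ ≤ C * Real.exp (M.assoc (2 * Real.pi * ‖ζ‖ / s))) →
      (∀ ζ, 2 / ε ≤ 2 * Real.pi * ‖ζ‖ → a ζ = 0) → ContDiff ℝ ∞ (𝓕 a) ∧
        DerivBound M h (C * D * growth M k ε) Set.univ (𝓕 a) := by
  obtain ⟨D, hD, hw⟩ := M.one_add_pow_le (d + 1) (q := k / H) (by positivity)
  have hI : 0 ≤ ∫ ζ : Euc d, polyWeight ζ := integral_nonneg fun ζ => (polyWeight_pos ζ).le
  refine ⟨A * D * ∫ ζ : Euc d, polyWeight ζ, by positivity, fun a C ε ha hC hε hag hav => ?_⟩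
  have hg : 0 < growth M k ε := Real.exp_pos _
  have h0 := derivBound_fourier (M := M) ha (h := h)
    (w := fun ζ => C * A * D * growth M k ε * polyWeight ζ)
    (integrable_polyWeight.const_mul _) fun n ζ => ?_
  · refine ⟨h0.1, ?_⟩
    have e : ∫ ζ : Euc d, C * A * D * growth M k ε * polyWeight ζ =
        C * (A * D * ∫ ζ : Euc d, polyWeight ζ) * growth M k ε := by
      rw [integral_const_mul]; ring
    rw [← e]
    exact h0.2
  have hn := M.pos n
  have hζ := (polyWeight_pos ζ).le
  rcases le_or_gt (2 / ε) (2 * Real.pi * ‖ζ‖) with hge | hlt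
  · rw [hav ζ hge, norm_zero, mul_zero]
    positivity
  have hpi : 1 ≤ Real.pi := by linarith [Real.pi_gt_three]
  have hζε : ‖ζ‖ ≤ 1 / ε := by
    have : ‖ζ‖ ≤ Real.pi * ‖ζ‖ := le_mul_of_one_le_left (norm_nonneg _) hpi
    have e : 2 / ε = 2 * (1 / ε) := by ring
    rw [e, mul_assoc] at hlt
    linarith
  set t := 2 * Real.pi * ‖ζ‖ with ht
  have ht0 : 0 ≤ t := by positivity
  -- On the support t < 2/ε, so 2H ≤ kh and 2H ≤ ks put both t/h and t/s below k/(Hε). The dilation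
  -- by 1/H leaves room for E^4 ≤ A e^{M(k/ε)}.
  set E := Real.exp (M.assoc (k / (H * ε))) with hE
  have hE1 : 1 ≤ E := M.one_le_exp_assoc (by positivity)
  have hcomp : ∀ h' : ℝ, 0 < h' → 2 * H ≤ k * h' → Real.exp (M.assoc (t / h')) ≤ E := by
    intro h' hh' hkh'
    refine Real.exp_le_exp.2 (M.assoc_mono' (by positivity) ?_)
    rw [div_le_div_iff₀ hh' (by positivity)]
    rw [lt_div_iff₀ hε] at hlt
    nlinarith
  have h1 : t ^ n ≤ h ^ n * M.seq n * E :=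
    (M.pow_le_pow_mul ht0 hh n).trans (by gcongr; exact hcomp h hh hkh)
  have h2 : ‖a ζ‖ ≤ C * E := (hag ζ).trans (by gcongr; exact hcomp s hs hks)
  have h3 : 1 ≤ D * E * polyWeight ζ := by
    have h4 : (1 + ‖ζ‖) ^ (d + 1) ≤ D * E := by
      refine le_trans ?_ ((hw (1 / ε) (by positivity)).trans (le_of_eq ?_))
      · gcongr
      · rw [hE]; congr 3; field_simp
    rw [polyWeight, ← div_eq_mul_inv, le_div_iff₀ (by positivity), one_mul]
    exact h4
  have h5 : E ^ 4 ≤ A * growth M k ε := by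
    refine (hAH (k / (H * ε)) (by positivity)).trans (le_of_eq ?_)
    rw [growth]; congr 3; field_simp
  -- One factor E each pays for the derivatives, for the growth of a, and for the insertion of the
  -- integrable weight; the fourth only completes the power.
  calc t ^ n * ‖a ζ‖ ≤ (h ^ n * M.seq n * E) * (C * E) * 1 * 1 := by
        rw [mul_one, mul_one]; gcongr
    _ ≤ (h ^ n * M.seq n * E) * (C * E) * (D * E * polyWeight ζ) * E := by gcongr
    _ = h ^ n * M.seq n * (C * D * E ^ 4 * polyWeight ζ) := by ring
    _ ≤ h ^ n * M.seq n * (C * D * (A * growth M k ε) * polyWeight ζ) := by gcongr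
    _ = _ := by ring

/-! ### Exponentials -/

/-- The character `y ↦ e^{2πi ζ·y}`. -/
noncomputable def expFun (ζ y : Euc d) : ℂ := Real.fourierChar (inner ℝ ζ y)

theorem expFun_eq (ζ y : Euc d) :
    expFun ζ y = Complex.exp ((2 * Real.pi * inner ℝ ζ y : ℝ) * Complex.I) := by
  rw [expFun, Real.fourierChar_apply]

theorem norm_expFun (ζ y : Euc d) : ‖expFun ζ y‖ = 1 := Circle.norm_coe _

theorem expFun_add (ζ ζ' y : Euc d) : expFun (ζ + ζ') y = expFun ζ y * expFun ζ' y := by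
  simp [expFun, inner_add_left, AddChar.map_add_eq_mul]

theorem expFun_comm (ζ y : Euc d) : expFun ζ y = expFun y ζ := by
  rw [expFun, expFun, real_inner_comm]

theorem continuous_expFun_left (y : Euc d) : Continuous fun ζ : Euc d => expFun ζ y := by
  simp only [expFun_eq]; fun_prop

theorem contDiff_expFun (ζ : Euc d) : ContDiff ℝ ∞ (expFun ζ) := by
  have : expFun ζ = fun y => Complex.exp ((2 * Real.pi * inner ℝ ζ y : ℝ) * Complex.I) :=
    funext (expFun_eq ζ)
  rw [this]
  have h1 : ContDiff ℝ ∞ fun y : Euc d => 2 * Real.pi * inner ℝ ζ y :=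
    contDiff_const.mul (innerSL ℝ ζ).contDiff
  have h2 : ContDiff ℝ ∞ fun y : Euc d => ((2 * Real.pi * inner ℝ ζ y : ℝ) : ℂ) :=
    Complex.ofRealCLM.contDiff.comp h1
  exact (h2.mul contDiff_const).cexp

/-- The character is t ↦ e^{it} composed with the linear form y ↦ 2πζ·y. -/
theorem iteratedFDeriv_expFun_apply (ζ y : Euc d) (n : ℕ) (m : Fin n → Euc d) :
    iteratedFDeriv ℝ n (expFun ζ) y m =
      (2 * Real.pi * Complex.I) ^ n * (∏ j, inner ℝ ζ (m j) : ℝ) * expFun ζ y := by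
  set g : ℝ → ℂ := fun t => Complex.exp (t * Complex.I) with hg
  set L : Euc d →L[ℝ] ℝ := (2 * Real.pi) • innerSL ℝ ζ with hL
  have hgd : ∀ n, iteratedDeriv n g = fun t => Complex.I ^ n * g t := by
    intro n
    induction n with
    | zero => simp
    | succ n ih =>
      rw [iteratedDeriv_succ, ih]
      ext t
      have h1 : HasDerivAt (fun t : ℝ => (t : ℂ) * Complex.I) (1 * Complex.I) t :=
        Complex.ofRealCLM.hasDerivAt.mul_const _
      have h2 := (h1.cexp.const_mul (Complex.I ^ n)).deriv
      rw [h2]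
      simp only [hg]; ring
  have hgc : ContDiff ℝ ∞ g := (Complex.ofRealCLM.contDiff.mul contDiff_const).cexp
  have e : expFun ζ = g ∘ L := by
    ext y
    rw [expFun_eq]
    rfl
  have hn : (n : ℕ∞ω) ≤ ∞ := by exact_mod_cast le_top
  have hLm : ∀ j, L (m j) = 2 * Real.pi * inner ℝ ζ (m j) := fun _ => rfl
  rw [e, L.iteratedFDeriv_comp_right hgc y hn,
    ContinuousMultilinearMap.compContinuousLinearMap_apply,
    iteratedFDeriv_apply_eq_iteratedDeriv_mul_prod, hgd]
  simp only [hLm, Finset.prod_mul_distrib, Finset.prod_const, Finset.card_univ, Fintype.card_fin,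
    Complex.real_smul, Function.comp_apply]
  push_cast
  ring

theorem norm_iteratedFDeriv_expFun_le (ζ y : Euc d) (n : ℕ) :
    ‖iteratedFDeriv ℝ n (expFun ζ) y‖ ≤ (2 * Real.pi * ‖ζ‖) ^ n := by
  refine ContinuousMultilinearMap.opNorm_le_bound (by positivity) fun m => ?_
  rw [iteratedFDeriv_expFun_apply, norm_mul, norm_mul, norm_expFun, mul_one, Complex.norm_real,
    norm_prod]
  calc ‖(2 * Real.pi * Complex.I) ^ n‖ * ∏ j, ‖inner ℝ ζ (m j)‖
      ≤ (2 * Real.pi) ^ n * ∏ j, (‖ζ‖ * ‖m j‖) := by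
        gcongr with j
        · simp [abs_of_pos Real.pi_pos]
        · exact norm_inner_le_norm _ _
    _ = _ := by simp [Finset.prod_mul_distrib, mul_pow, mul_assoc]

theorem derivBound_expFun (ζ : Euc d) {s : ℝ} (hs : 0 < s) (S : Set (Euc d)) :
    DerivBound M s (Real.exp (M.assoc (2 * Real.pi * ‖ζ‖ / s))) S (expFun ζ) := fun y _ n => by
  refine (norm_iteratedFDeriv_expFun_le ζ y n).trans ?_
  rw [mul_comm (Real.exp _)]
  exact M.pow_le_pow_mul (by positivity) hs n

/-- Order zero uses |e^{iτ} - 1| ≤ |τ| on the ball. In higher order the constant 1 disappears, and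
(2π|δ|)^{n+1} contains one factor |δ| to keep, while the remaining |δ|^n is at most 1. -/
theorem derivBound_expFun_sub_one {s R : ℝ} (hs : 0 < s) (hR : 0 ≤ R) (δ : Euc d) (hδ : ‖δ‖ ≤ 1) :
    DerivBound M s ((2 * Real.pi * R + 1) * Real.exp (M.assoc (2 * Real.pi / s)) * ‖δ‖)
      (Metric.closedBall 0 R) (expFun δ - 1) := fun y hy n => by
  rw [mem_closedBall_zero_iff] at hy
  have hE := M.one_le_exp_assoc (t := 2 * Real.pi / s) (by positivity)
  rcases n with _ | n
  · have h1 : ‖expFun δ y - 1‖ ≤ 2 * Real.pi * (‖δ‖ * R) := by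
      rw [expFun_eq, mul_comm _ Complex.I]
      refine Real.norm_exp_I_mul_ofReal_sub_one_le.trans ?_
      rw [norm_mul, Real.norm_of_nonneg (by positivity)]
      refine mul_le_mul_of_nonneg_left ((norm_inner_le_norm δ y).trans ?_) (by positivity)
      gcongr
    simp only [norm_iteratedFDeriv_zero, Pi.sub_apply, Pi.one_apply, pow_zero, M.zero, mul_one]
    refine h1.trans ?_
    calc 2 * Real.pi * (‖δ‖ * R) = (2 * Real.pi * R + 0) * 1 * ‖δ‖ := by ring
      _ ≤ _ := by gcongr; norm_num
  · have e : iteratedFDeriv ℝ (n + 1) (expFun δ - 1) y = iteratedFDeriv ℝ (n + 1) (expFun δ) y := by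
      have hn : ((n + 1 : ℕ) : ℕ∞ω) ≤ ∞ := by exact_mod_cast le_top
      have h1 : ContDiffAt ℝ (n + 1 : ℕ) (1 : Euc d → ℂ) y := contDiffAt_const
      rw [iteratedFDeriv_sub_apply ((contDiff_expFun δ).contDiffAt.of_le hn) h1]
      have h2 : iteratedFDeriv ℝ (n + 1) (1 : Euc d → ℂ) = 0 := iteratedFDeriv_const_of_ne (by omega) 1
      rw [h2]; simp
    rw [e]
    refine (norm_iteratedFDeriv_expFun_le δ y (n + 1)).trans ?_
    have hM := M.pos (n + 1)
    calc (2 * Real.pi * ‖δ‖) ^ (n + 1) = (2 * Real.pi) ^ (n + 1) * ‖δ‖ * ‖δ‖ ^ n := by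
          rw [mul_pow, pow_succ ‖δ‖]; ring
      _ ≤ (s ^ (n + 1) * M.seq (n + 1) * Real.exp (M.assoc (2 * Real.pi / s))) * ‖δ‖ * 1 := by
        gcongr
        · exact M.pow_le_pow_mul (by positivity) hs (n + 1)
        · exact pow_le_one₀ (norm_nonneg _) hδ
      _ = (0 + 1) * Real.exp (M.assoc (2 * Real.pi / s)) * ‖δ‖ * (s ^ (n + 1) * M.seq (n + 1)) := by
        ring
      _ ≤ _ := by gcongr; positivity

/-- The exponentials depend continuously on the frequency. -/
theorem derivBound_expFun_sub {s R : ℝ} (hs : 0 < s) (hR : 0 ≤ R) (ζ : Euc d) :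
    ∃ C : ℝ, 0 ≤ C ∧ ∀ ζ' : Euc d, ‖ζ' - ζ‖ ≤ 1 →
      DerivBound M s (C * ‖ζ' - ζ‖) (Metric.closedBall 0 R) (expFun ζ' - expFun ζ) := by
  refine ⟨Real.exp (M.assoc (2 * Real.pi * ‖ζ‖ / (s / 2))) *
    ((2 * Real.pi * R + 1) * Real.exp (M.assoc (2 * Real.pi / (s / 2)))), by positivity,
    fun ζ' h => ?_⟩
  -- Factoring out the character of ζ reduces the claim to frequencies near 0. Each factor is given
  -- the parameter s/2, and the product rule adds them.
  have e : expFun ζ' - expFun ζ = fun y => expFun ζ y * (expFun (ζ' - ζ) - 1 : Euc d → ℂ) y := by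
    ext y
    have := expFun_add ζ (ζ' - ζ) y
    rw [add_sub_cancel] at this
    simp only [Pi.sub_apply, Pi.one_apply]
    rw [this]; ring
  rw [e, mul_assoc]
  have := DerivBound.mul (M := M) (S := Metric.closedBall 0 R)
    (fun x _ => (contDiff_expFun ζ).contDiffAt)
    (fun x _ => ((contDiff_expFun (ζ' - ζ)).sub contDiff_const).contDiffAt)
    (half_pos hs).le (half_pos hs).le (Real.exp_pos _).le
    (derivBound_expFun ζ (half_pos hs) (Metric.closedBall 0 R))
    (derivBound_expFun_sub_one (half_pos hs) hR (ζ' - ζ) h)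
  rwa [add_halves] at this

end

/-! ### Action of an ultradistribution on products with a fixed test function -/

section

variable {c : UltraClass} {M : WeightSequence} {Ω : TopologicalSpace.Opens (Euc d)}

/-- Continuity of `g ↦ f(θ g)`, with respect to the derivatives of `g` on the support of `θ`. -/
def TestBound (f : Ultradistribution c M Ω) (θ : testFunctions c M Ω) (s B : ℝ) : Prop :=
  ∀ (g : Euc d → ℂ) (C : ℝ) (_ : ContDiff ℝ ∞ g)
    (hθg : (fun y => (θ : Euc d → ℂ) y * g y) ∈ testFunctions c M Ω), 0 ≤ C →
    DerivBound M s C (tsupport (θ : Euc d → ℂ)) g → ‖f.1 ⟨_, hθg⟩‖ ≤ B * C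

theorem testBound_aux {f : testFunctions c M Ω →ₗ[ℂ] ℂ} {θ : testFunctions c M Ω} {h s A : ℝ}
    {C₀ : ℝ≥0} (hh : 0 < h) (hs : 0 < s) (hA : 0 ≤ A)
    (hf : ∀ ψ : testFunctions c M Ω, tsupport (ψ : Euc d → ℂ) ⊆ tsupport (θ : Euc d → ℂ) →
      ‖f ψ‖ₑ ≤ C₀ * ultraNorm M (h + s) (tsupport (θ : Euc d → ℂ)) ψ)
    (hθ : DerivBound M h A Set.univ (θ : Euc d → ℂ)) (g : Euc d → ℂ) (C : ℝ) (hg : ContDiff ℝ ∞ g)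
    (hθg : (fun y => (θ : Euc d → ℂ) y * g y) ∈ testFunctions c M Ω) (hC : 0 ≤ C)
    (H : DerivBound M s C (tsupport (θ : Euc d → ℂ)) g) : ‖f ⟨_, hθg⟩‖ ≤ C₀ * A * C := by
  have h1 : DerivBound M (h + s) (A * C) (tsupport (θ : Euc d → ℂ))
      (fun y => (θ : Euc d → ℂ) y * g y) :=
    DerivBound.mul (fun x _ => θ.2.1.contDiffAt) (fun x _ => hg.contDiffAt) hh.le hs.le hA
      (hθ.subset (Set.subset_univ _)) H
  have h2 := (hf ⟨_, hθg⟩ tsupport_mul_subset_left).trans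
    (mul_le_mul_right (h1.ultraNorm_le_ofReal (add_pos hh hs) (mul_nonneg hA hC)) _)
  rw [← ENNReal.ofReal_coe_nnreal, ← ENNReal.ofReal_mul C₀.coe_nonneg, ← ofReal_norm,
    ENNReal.ofReal_le_ofReal_iff (mul_nonneg C₀.coe_nonneg (mul_nonneg hA hC))] at h2
  exact h2.trans (le_of_eq (mul_assoc _ _ _).symm)

/-- The product rule places θg in the class with parameter h + s. In the Beurling case the
continuity of f fixes this sum, and θ, bounded for every parameter, takes half of it. In the Roumieu
case θ fixes h, but f is continuous for every h + s, so s is free. -/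
theorem exists_testBound (f : Ultradistribution c M Ω) (θ : testFunctions c M Ω) :
    match c with
    | .beurling => ∃ s : ℝ, 0 < s ∧ ∃ B : ℝ, 0 ≤ B ∧ TestBound f θ s B
    | .roumieu => ∀ s : ℝ, 0 < s → ∃ B : ℝ, 0 ≤ B ∧ TestBound f θ s B := by
  have hf := f.2 (tsupport (θ : Euc d → ℂ)) θ.2.2.1 θ.2.2.2.1
  have hθ := θ.2.2.2.2.derivBound
  cases c with
  | beurling =>
    obtain ⟨h, hh, C₀, hf⟩ := hf
    obtain ⟨A, hA, hθ⟩ := hθ (h / 2) (half_pos hh)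
    refine ⟨h / 2, half_pos hh, C₀ * A, by positivity, ?_⟩
    exact testBound_aux (half_pos hh) (half_pos hh) hA (by rwa [add_halves]) hθ
  | roumieu =>
    intro s hs
    obtain ⟨h, hh, A, hA, hθ⟩ := hθ
    obtain ⟨C₀, hf⟩ := hf (h + s) (add_pos hh hs)
    exact ⟨C₀ * A, by positivity, testBound_aux hh hs hA hf hθ⟩

/-- The test function `y ↦ θ(y) e^{2πi ζ·y}`. -/
noncomputable def expTest (θ : testFunctions c M Ω) (ζ : Euc d) : testFunctions c M Ω :=
  ⟨fun y => (θ : Euc d → ℂ) y * expFun ζ y,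
    mul_mem_testFunctions θ (contDiff_expFun ζ) (C := 1) (R := 2 * Real.pi * ‖ζ‖) (by positivity)
      fun n y => by rw [one_mul]; exact norm_iteratedFDeriv_expFun_le ζ y n⟩

/-- The Fourier transform of `θ f`. -/
noncomputable def localFourier (f : Ultradistribution c M Ω) (θ : testFunctions c M Ω)
    (ζ : Euc d) : ℂ :=
  f.1 (expTest θ ζ)

variable {f : Ultradistribution c M Ω} {θ : testFunctions c M Ω} {s B : ℝ}

theorem TestBound.norm_localFourier_le (H : TestBound f θ s B) (hs : 0 < s) (ζ : Euc d) :
    ‖localFourier f θ ζ‖ ≤ B * Real.exp (M.assoc (2 * Real.pi * ‖ζ‖ / s)) :=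
  H (expFun ζ) _ (contDiff_expFun ζ) (expTest θ ζ).2 (Real.exp_pos _).le (derivBound_expFun ζ hs _)

/-- The multipliers `g` with controlled derivatives on the support of `θ`. -/
def multiplierSpace (θ : testFunctions c M Ω) (s : ℝ) : Submodule ℂ (Euc d → ℂ) where
  carrier := {g | ContDiff ℝ ∞ g ∧ (fun y => (θ : Euc d → ℂ) y * g y) ∈ testFunctions c M Ω ∧
    ∃ C : ℝ, 0 ≤ C ∧ DerivBound M s C (tsupport (θ : Euc d → ℂ)) g}
  add_mem' := by
    rintro g g' ⟨h1, h2, C, hC, h3⟩ ⟨h1', h2', C', hC', h3'⟩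
    refine ⟨h1.add h1', ?_, C + C', add_nonneg hC hC',
      h3.add (fun _ _ => h1.contDiffAt) (fun _ _ => h1'.contDiffAt) h3'⟩
    convert! add_mem h2 h2' using 1
    ext y
    simp [mul_add]
  zero_mem' := by
    refine ⟨contDiff_const, ?_, 0, le_rfl, fun x _ n => by simp⟩
    convert! zero_mem (testFunctions c M Ω) using 1
    ext y
    simp
  smul_mem' := by
    rintro a g ⟨h1, h2, C, hC, h3⟩
    refine ⟨contDiff_const.smul h1, ?_, ‖a‖ * C, by positivity, fun x hx n => ?_⟩
    · convert! Submodule.smul_mem _ a h2 using 1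
      ext y
      simp only [Pi.smul_apply, smul_eq_mul]
      ring
    · have hn : (n : ℕ∞ω) ≤ ∞ := by exact_mod_cast le_top
      rw [iteratedFDeriv_const_smul_apply (h1.contDiffAt.of_le hn), norm_smul, mul_assoc]
      exact mul_le_mul_of_nonneg_left (h3 x hx n) (norm_nonneg _)

/-- `g ↦ f(θ g)`. -/
noncomputable def multiplierAction (f : Ultradistribution c M Ω) (θ : testFunctions c M Ω) (s : ℝ) :
    multiplierSpace θ s →ₗ[ℂ] ℂ where
  toFun g := f.1 ⟨_, g.2.2.1⟩
  map_add' g g' := by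
    rw [← map_add]
    congr 1
    ext y
    simp [mul_add]
  map_smul' a g := by
    rw [← map_smul]
    congr 1
    ext y
    simp only [Submodule.coe_smul, Pi.smul_apply, smul_eq_mul, RingHom.id_apply]
    ring

/-- The space of jets on `K`. -/
abbrev JetSpace (K : Set (Euc d)) : Type :=
  lp (fun i : ℕ × K => ContinuousMultilinearMap ℝ (fun _ : Fin i.1 => Euc d) ℂ) ⊤

/-- The jet of a multiplier along the support of `θ`. -/
noncomputable def jet (hs : 0 < s) :
    multiplierSpace θ s →ₗ[ℂ] JetSpace (tsupport (θ : Euc d → ℂ)) where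
  toFun g := ⟨fun i => ((s ^ i.1 * M.seq i.1)⁻¹ : ℝ) • iteratedFDeriv ℝ i.1 (g : Euc d → ℂ) i.2, by
    obtain ⟨-, -, C, hC, h⟩ := g.2
    refine memℓp_infty ⟨C, ?_⟩
    rintro _ ⟨⟨n, x⟩, rfl⟩
    have hn := M.pos n
    simp only [norm_smul, norm_inv, Real.norm_of_nonneg (show 0 ≤ s ^ n * M.seq n by positivity)]
    rw [inv_mul_le_iff₀ (by positivity), mul_comm]
    exact h x x.2 n⟩
  map_add' g g' := by
    ext i : 2
    have hn : (i.1 : ℕ∞ω) ≤ ∞ := by exact_mod_cast le_top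
    have := iteratedFDeriv_add_apply (x := (i.2 : Euc d)) (g.2.1.contDiffAt.of_le hn)
      (g'.2.1.contDiffAt.of_le hn)
    simp only [Submodule.coe_add, this, smul_add]
    rfl
  map_smul' a g := by
    ext i : 2
    have hn : (i.1 : ℕ∞ω) ≤ ∞ := by exact_mod_cast le_top
    have := iteratedFDeriv_const_smul_apply (x := (i.2 : Euc d)) (a := a)
      (g.2.1.contDiffAt.of_le hn)
    simp only [Submodule.coe_smul, this, RingHom.id_apply]
    rw [smul_comm]
    rfl

theorem jet_apply (hs : 0 < s) (g : multiplierSpace θ s)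
    (i : ℕ × tsupport (θ : Euc d → ℂ)) : (jet hs g : ∀ i : ℕ × tsupport (θ : Euc d → ℂ),
      ContinuousMultilinearMap ℝ (fun _ : Fin i.1 => Euc d) ℂ) i =
    ((s ^ i.1 * M.seq i.1)⁻¹ : ℝ) • iteratedFDeriv ℝ i.1 (g : Euc d → ℂ) i.2 := rfl

theorem norm_jet_le (hs : 0 < s) (g : multiplierSpace θ s) {C : ℝ} (hC : 0 ≤ C)
    (h : DerivBound M s C (tsupport (θ : Euc d → ℂ)) (g : Euc d → ℂ)) : ‖jet hs g‖ ≤ C := by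
  refine lp.norm_le_of_forall_le hC fun i => ?_
  have hn := M.pos i.1
  rw [jet_apply, norm_smul, norm_inv, Real.norm_of_nonneg (show 0 ≤ s ^ i.1 * M.seq i.1 by positivity),
    inv_mul_le_iff₀ (by positivity), mul_comm]
  exact h i.2 i.2.2 i.1

/-- The normalization by s^n M_n makes the supremum norm of the jet an admissible constant in
`DerivBound`. With it, `TestBound` becomes boundedness of g ↦ f(θg) with respect to the jet norm. -/
theorem derivBound_norm_jet (hs : 0 < s) (g : multiplierSpace θ s) :
    DerivBound M s ‖jet hs g‖ (tsupport (θ : Euc d → ℂ)) (g : Euc d → ℂ) := fun x hx n => by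
  have h := lp.norm_apply_le_norm ENNReal.top_ne_zero (jet hs g) (n, ⟨x, hx⟩)
  have hn := M.pos n
  rw [jet_apply, norm_smul, norm_inv, Real.norm_of_nonneg (by positivity),
    inv_mul_le_iff₀ (by positivity), mul_comm] at h
  exact h

/-- `g ↦ f(θ g)` is the restriction of a continuous functional on the space of jets. -/
theorem TestBound.exists_functional (H : TestBound f θ s B) (hs : 0 < s) :
    ∃ T : StrongDual ℂ (JetSpace (tsupport (θ : Euc d → ℂ))),
      ∀ g, T (jet hs g) = multiplierAction f θ s g := by
  set J := jet (θ := θ) hs with hJ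
  set L := multiplierAction f θ s with hL
  have hbound : ∀ g, ‖L g‖ ≤ B * ‖J g‖ := fun g =>
    H g _ g.2.1 g.2.2.1 (norm_nonneg _) (derivBound_norm_jet hs g)
  -- By the bound, f(θg) depends only on the jet of g. The action therefore descends to the range of
  -- the jet map, and Hahn–Banach extends it to the whole Banach space of jets.
  have hker : LinearMap.ker J ≤ LinearMap.ker L := by
    intro g hg
    rw [LinearMap.mem_ker] at hg ⊢
    have := hbound g
    rwa [hg, norm_zero, mul_zero, norm_le_zero_iff] at this
  set l : LinearMap.range J →ₗ[ℂ] ℂ :=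
    ((LinearMap.ker J).liftQ L hker) ∘ₗ J.quotKerEquivRange.symm.toLinearMap with hl
  have hlJ : ∀ g, l ⟨J g, LinearMap.mem_range_self J g⟩ = L g := by
    intro g
    have : J.quotKerEquivRange.symm ⟨J g, LinearMap.mem_range_self J g⟩ =
        (LinearMap.ker J).mkQ g := by
      rw [LinearEquiv.symm_apply_eq]
      rfl
    simp only [hl, LinearMap.comp_apply, LinearEquiv.coe_coe, this]
    exact Submodule.liftQ_apply _ _ _
  obtain ⟨T, hT, -⟩ := exists_extension_norm_eq (LinearMap.range J) (l.mkContinuous B (by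
    rintro ⟨_, g, rfl⟩
    rw [hlJ]
    exact hbound g))
  exact ⟨T, fun g => (hT ⟨J g, LinearMap.mem_range_self J g⟩).trans (hlJ g)⟩

end

/-! ### Integral representation of f through the local Fourier transform -/

section

variable {c : UltraClass} {M : WeightSequence} {Ω : TopologicalSpace.Opens (Euc d)}
variable {f : Ultradistribution c M Ω} {θ : testFunctions c M Ω} {s B : ℝ}

theorem expFun_mem_multiplierSpace (hs : 0 < s) (ζ : Euc d) : expFun ζ ∈ multiplierSpace θ s :=
  ⟨contDiff_expFun ζ, (expTest θ ζ).2, _, (Real.exp_pos _).le, derivBound_expFun ζ hs _⟩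

theorem continuous_of_locally_lipschitz {X : Type*} [NormedAddCommGroup X] {F : Euc d → X}
    (h : ∀ ζ, ∃ C : ℝ, 0 ≤ C ∧ ∀ ζ', ‖ζ' - ζ‖ ≤ 1 → ‖F ζ' - F ζ‖ ≤ C * ‖ζ' - ζ‖) :
    Continuous F := by
  refine continuous_iff_continuousAt.2 fun ζ => ?_
  obtain ⟨C, hC, h⟩ := h ζ
  rw [ContinuousAt, tendsto_iff_norm_sub_tendsto_zero]
  have h0 : Filter.Tendsto (fun ζ' : Euc d => C * ‖ζ' - ζ‖) (nhds ζ) (nhds 0) := by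
    have : Continuous fun ζ' : Euc d => C * ‖ζ' - ζ‖ := by fun_prop
    simpa using this.tendsto ζ
  refine squeeze_zero' (Filter.Eventually.of_forall fun _ => norm_nonneg _) ?_ h0
  filter_upwards [Metric.ball_mem_nhds ζ one_pos] with ζ' hζ'
  rw [mem_ball_iff_norm] at hζ'
  exact h ζ' hζ'.le

/-- Continuity as a map into the Banach space of jets provides the strong measurability required by
Bochner integrals of characters. It also yields the continuity of the local Fourier transform. -/
theorem continuous_jet_expFun (hs : 0 < s) :
    Continuous fun ζ : Euc d => jet (θ := θ) hs ⟨expFun ζ, expFun_mem_multiplierSpace hs ζ⟩ := by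
  obtain ⟨R, hR, hK⟩ := θ.2.2.1.isBounded.subset_closedBall_lt 0 0
  refine continuous_of_locally_lipschitz fun ζ => ?_
  obtain ⟨C, hC, h⟩ := derivBound_expFun_sub (M := M) hs hR.le ζ
  refine ⟨C, hC, fun ζ' hζ' => ?_⟩
  rw [← map_sub]
  exact norm_jet_le hs _ (by positivity) ((h ζ' hζ').subset hK)

theorem continuous_localFourier (f : Ultradistribution c M Ω) (θ : testFunctions c M Ω) :
    Continuous (localFourier f θ) := by
  obtain ⟨s, hs, B, H⟩ : ∃ s : ℝ, 0 < s ∧ ∃ B, TestBound f θ s B := by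
    have h := exists_testBound f θ
    cases c with
    | beurling => obtain ⟨s, hs, B, -, H⟩ := h; exact ⟨s, hs, B, H⟩
    | roumieu => obtain ⟨B, -, H⟩ := h 1 one_pos; exact ⟨1, one_pos, B, H⟩
  obtain ⟨T, hT⟩ := H.exists_functional hs
  have e : localFourier f θ = fun ζ =>
      T (jet (θ := θ) hs ⟨expFun ζ, expFun_mem_multiplierSpace hs ζ⟩) :=
    funext fun ζ => (hT ⟨expFun ζ, expFun_mem_multiplierSpace hs ζ⟩).symm
  rw [e]
  exact T.continuous.comp (continuous_jet_expFun hs)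

/-- The derivatives of an inverse Fourier transform. -/
theorem iteratedFDeriv_fourierInv {a : Euc d → ℂ} (ha : AEStronglyMeasurable a)
    (hint : ∀ n : ℕ, Integrable fun ζ => ‖ζ‖ ^ n * ‖a ζ‖) (n : ℕ) (y : Euc d) :
    iteratedFDeriv ℝ n (𝓕⁻ a) y = ∫ ζ, a ζ • iteratedFDeriv ℝ n (expFun ζ) y := by
  have ha' : AEStronglyMeasurable (fun ζ => a (-ζ)) :=
    ha.comp_measurePreserving (Measure.measurePreserving_neg volume)
  have hint' : ∀ n : ℕ, Integrable fun ζ => ‖ζ‖ ^ n * ‖a (-ζ)‖ := fun n => by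
    simpa using (hint n).comp_neg
  rw [Real.fourierInv_eq_fourier_comp_neg, Real.iteratedFDeriv_fourier (N := ⊤)
    (fun n _ => hint' n) ha' (by exact_mod_cast le_top), Real.fourier_eq, ← integral_neg_eq_self]
  refine integral_congr_ae (Filter.Eventually.of_forall fun ζ => ?_)
  ext m
  have e : ∀ i, innerSL ℝ (-ζ) (m i) = - inner ℝ ζ (m i) := fun i => by
    change inner ℝ (-ζ) (m i) = _
    exact inner_neg_left _ _
  simp only [smul_apply, VectorFourier.fourierPowSMulRight_apply,
    iteratedFDeriv_expFun_apply, neg_neg, inner_neg_left, e, Finset.prod_neg, Circle.smul_def]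
  -- One sign (-1)^n comes from the reflection ζ ↦ -ζ and one from the convention e^{-2πi}; they
  -- cancel.
  have h1 : ((-1 : ℂ) ^ n) * (-1) ^ n = 1 := by rw [← mul_pow]; simp
  rw [Finset.card_univ, Fintype.card_fin, neg_pow (2 * (Real.pi : ℂ) * Complex.I), expFun,
    Complex.real_smul]
  simp only [smul_eq_mul]
  push_cast
  linear_combination (Real.fourierChar (inner ℝ ζ y) : ℂ) * (2 * Real.pi * Complex.I) ^ n *
    (∏ x, (inner ℝ ζ (m x) : ℂ)) * a ζ * h1

/-- The action of `f` on the product of `θ` and an inverse Fourier transform. -/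
theorem TestBound.apply_fourierInv (H : TestBound f θ s B) (hs : 0 < s) {a : Euc d → ℂ}
    (ha : AEStronglyMeasurable a) {w : Euc d → ℝ} (hw : Integrable w)
    (haw : ∀ ζ, ‖a ζ‖ * Real.exp (M.assoc (2 * Real.pi * ‖ζ‖ / s)) ≤ w ζ) (ψ : testFunctions c M Ω)
    (hψ : ∀ y, (ψ : Euc d → ℂ) y = (θ : Euc d → ℂ) y * 𝓕⁻ a y) :
    f.1 ψ = ∫ ζ, a ζ * localFourier f θ ζ := by
  have ha' : AEStronglyMeasurable (fun ζ => a (-ζ)) :=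
    ha.comp_measurePreserving (Measure.measurePreserving_neg volume)
  have hpow : ∀ (n : ℕ) ζ, (2 * Real.pi * ‖ζ‖) ^ n * ‖a ζ‖ ≤ s ^ n * M.seq n * w ζ := by
    intro n ζ
    have hn := M.pos n
    have h1 := M.pow_le_pow_mul (t := 2 * Real.pi * ‖ζ‖) (by positivity) hs n
    calc (2 * Real.pi * ‖ζ‖) ^ n * ‖a ζ‖
        ≤ (s ^ n * M.seq n * Real.exp (M.assoc (2 * Real.pi * ‖ζ‖ / s))) * ‖a ζ‖ := by gcongr
      _ = s ^ n * M.seq n * (‖a ζ‖ * Real.exp (M.assoc (2 * Real.pi * ‖ζ‖ / s))) := by ring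
      _ ≤ _ := by gcongr; exact haw ζ
  have hint : ∀ n : ℕ, Integrable fun ζ => ‖ζ‖ ^ n * ‖a ζ‖ := by
    intro n
    refine Integrable.mono' (g := fun ζ => ((2 * Real.pi) ^ n)⁻¹ * (s ^ n * M.seq n * w ζ))
      ((hw.const_mul _).const_mul _) ?_ (Filter.Eventually.of_forall fun ζ => ?_)
    · exact (by fun_prop : Continuous fun ζ : Euc d => ‖ζ‖ ^ n).aestronglyMeasurable.mul ha.norm
    · rw [Real.norm_of_nonneg (by positivity), ← div_eq_inv_mul, le_div_iff₀ (by positivity)]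
      refine le_trans (le_of_eq ?_) (hpow n ζ)
      rw [mul_pow _ ‖ζ‖]; ring
  have hg := derivBound_fourier (M := M) ha' (h := s) (w := fun ζ => w (-ζ)) hw.comp_neg
    fun n ζ => by simpa using hpow n (-ζ)
  rw [← Real.fourierInv_eq_fourier_comp_neg] at hg
  have hmem : 𝓕⁻ a ∈ multiplierSpace θ s := by
    refine ⟨hg.1, ?_, _, hg.2.nonneg ⟨0, trivial⟩, hg.2.subset (Set.subset_univ _)⟩
    have : (ψ : Euc d → ℂ) = fun y => (θ : Euc d → ℂ) y * 𝓕⁻ a y := funext hψ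
    exact this ▸ ψ.2
  obtain ⟨T, hT⟩ := H.exists_functional hs
  set E : Euc d → JetSpace (tsupport (θ : Euc d → ℂ)) := fun ζ =>
    jet (θ := θ) hs ⟨expFun ζ, expFun_mem_multiplierSpace hs ζ⟩ with hE
  have hEint : Integrable fun ζ => a ζ • E ζ := by
    refine hw.mono' (ha.smul (continuous_jet_expFun hs).aestronglyMeasurable)
      (Filter.Eventually.of_forall fun ζ => ?_)
    rw [norm_smul]
    refine le_trans ?_ (haw ζ)
    exact mul_le_mul_of_nonneg_left (norm_jet_le hs _ (Real.exp_pos _).le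
      (derivBound_expFun ζ hs _)) (norm_nonneg _)
  -- The jet of the inverse transform is the Bochner integral of the jets of characters. Evaluation
  -- at one derivative and one point is continuous and commutes with the integral, so this is
  -- differentiation under the integral sign. The extension `T` then also commutes with the
  -- integral.
  have hjet : jet hs ⟨𝓕⁻ a, hmem⟩ = ∫ ζ, a ζ • E ζ := by
    ext i : 2
    set ev : JetSpace (tsupport (θ : Euc d → ℂ)) →L[ℂ]
        ContinuousMultilinearMap ℝ (fun _ : Fin i.1 => Euc d) ℂ :=
      LinearMap.mkContinuous
        { toFun := fun x => x i, map_add' := fun _ _ => rfl, map_smul' := fun _ _ => rfl } 1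
        fun x => by
          rw [one_mul]
          exact lp.norm_apply_le_norm ENNReal.top_ne_zero x i with hev
    change _ = ev (∫ ζ, a ζ • E ζ)
    rw [← ev.integral_comp_comm hEint, jet_apply, iteratedFDeriv_fourierInv ha hint, ← integral_smul]
    refine integral_congr_ae (Filter.Eventually.of_forall fun ζ => ?_)
    exact smul_comm _ _ _
  have e1 : f.1 ψ = multiplierAction f θ s ⟨𝓕⁻ a, hmem⟩ := by
    change f.1 ψ = f.1 _
    congr 1
    ext y
    exact hψ y
  rw [e1, ← hT, hjet, ← T.integral_comp_comm hEint]
  refine integral_congr_ae (Filter.Eventually.of_forall fun ζ => ?_)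
  change T (a ζ • E ζ) = _
  rw [map_smul, hT]
  rfl

end

/-! ### Estimates for nets -/

section

variable {c : UltraClass} {M N : WeightSequence} {Ω : TopologicalSpace.Opens (Euc d)}

theorem NormBigO.of_derivBound {h : ℝ} (hh : 0 < h) {K : Set (Euc d)} {r : Net d} {b : ℝ → ℝ}
    (hb : ∀ ε, 0 ≤ b ε) {C ε₀ : ℝ} (hC : 0 ≤ C) (hε₀ : 0 < ε₀)
    (H : ∀ ε : Set.Ioc (0 : ℝ) 1, (ε : ℝ) < ε₀ → DerivBound M h (C * b ε) K (r ε)) :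
    NormBigO M h K r b := by
  lift C to ℝ≥0 using hC
  refine ⟨C, ε₀, hε₀, fun ε hε => ?_⟩
  have := (H ε hε).ultraNorm_le_ofReal hh (mul_nonneg C.coe_nonneg (hb ε))
  refine this.trans (le_of_eq ?_)
  exact (ENNReal.ofReal_mul C.coe_nonneg).trans (by rw [ENNReal.ofReal_coe_nnreal])

theorem NormBigO.derivBound {h : ℝ} (hh : 0 < h) {K : Set (Euc d)} {r : Net d} {b : ℝ → ℝ}
    (hb : ∀ ε, 0 ≤ b ε) (H : NormBigO M h K r b) : ∃ C ε₀ : ℝ, 0 ≤ C ∧ 0 < ε₀ ∧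
      ∀ ε : Set.Ioc (0 : ℝ) 1, (ε : ℝ) < ε₀ → DerivBound M ((d + 1) * h) (C * b ε) K (r ε) := by
  obtain ⟨C, ε₀, hε₀, H⟩ := H
  refine ⟨C, ε₀, C.2, hε₀, fun ε hε => ?_⟩
  have h1 := H ε hε
  have e : (C : ENNReal) * ENNReal.ofReal (b ε) = ((C * (b ε).toNNReal : ℝ≥0) : ENNReal) := by
    rw [ENNReal.coe_mul]; rfl
  rw [e] at h1
  have h2 := DerivBound.of_ultraNorm hh h1
  rwa [NNReal.coe_mul, Real.coe_toNNReal _ (hb ε)] at h2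

/-! ### Mollifiers -/

/-- The Fourier transform of `φ_ε`. -/
noncomputable def Mollifier.symbol (φ : Mollifier N d) (ε : ℝ) (ζ : Euc d) : ℂ := φ.hat ((2 * Real.pi * ε) • ζ)

namespace Mollifier

variable (φ : Mollifier N d) {ε : ℝ}

theorem contDiff_symbol : ContDiff ℝ ∞ (φ.symbol ε) :=
  φ.hat_mem.1.comp (contDiff_const_smul _)

theorem continuous_symbol : Continuous (φ.symbol ε) := φ.contDiff_symbol.continuous

theorem exists_norm_symbol_le : ∃ C : ℝ, 1 ≤ C ∧ ∀ ε ζ, ‖φ.symbol ε ζ‖ ≤ C := by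
  obtain ⟨C, hC⟩ := φ.hat_mem.1.continuous.bounded_above_of_compact_support φ.hat_mem.2.1
  exact ⟨max C 1, le_max_right _ _, fun ε ζ => (hC _).trans (le_max_left _ _)⟩

theorem symbol_eq_one (hε : 0 < ε) {ζ : Euc d} (h : 2 * Real.pi * ‖ζ‖ ≤ 1 / ε) :
    φ.symbol ε ζ = 1 := by
  refine φ.hat_eq_one _ ?_
  rw [norm_smul, Real.norm_of_nonneg (by positivity)]
  rw [le_div_iff₀ hε] at h
  linarith

theorem symbol_eq_zero (hε : 0 < ε) {ζ : Euc d} (h : 2 / ε ≤ 2 * Real.pi * ‖ζ‖) :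
    φ.symbol ε ζ = 0 := by
  refine φ.hat_eq_zero _ ?_
  rw [norm_smul, Real.norm_of_nonneg (by positivity)]
  rw [div_le_iff₀ hε] at h
  linarith

theorem hasCompactSupport_symbol (hε : 0 < ε) : HasCompactSupport (φ.symbol ε) := by
  refine HasCompactSupport.of_support_subset_isCompact
    (isCompact_closedBall (0 : Euc d) (2 / ε / (2 * Real.pi))) fun ζ hζ => ?_
  rw [mem_closedBall_zero_iff, le_div_iff₀ (by positivity), mul_comm]
  by_contra h
  exact hζ (φ.symbol_eq_zero hε (not_le.1 h).le)

/-- The substitution ξ = 2πεζ converts the inversion formula, normalized with e^{-ix·ξ} and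
(2π)^{-d}, into the normalization of `𝓕`. -/
theorem net_eq_fourier (ε : Set.Ioc (0 : ℝ) 1) (z : Euc d) : φ.net ε z = 𝓕 (φ.symbol ε) z := by
  have hε : (0 : ℝ) < ε := ε.2.1
  have hc : 0 < 2 * Real.pi * (ε : ℝ) := by positivity
  have h := Measure.integral_comp_smul (volume : Measure (Euc d))
    (fun ξ => φ.hat ξ * Complex.exp (-(inner ℝ ((ε : ℝ)⁻¹ • z) ξ : ℝ) * Complex.I))
    (2 * Real.pi * (ε : ℝ))
  rw [finrank_euclideanSpace_fin, abs_of_pos (by positivity), Complex.real_smul] at h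
  rw [net, toFun_eq, ← mul_assoc, Real.fourier_eq']
  have e : ((((ε : ℝ) ^ d)⁻¹ : ℝ) : ℂ) * (((2 * Real.pi) ^ d)⁻¹ : ℝ) =
      (((2 * Real.pi * (ε : ℝ)) ^ d)⁻¹ : ℝ) := by
    push_cast
    rw [mul_pow]
    ring
  rw [e, ← h]
  refine integral_congr_ae (Filter.Eventually.of_forall fun ζ => ?_)
  simp only [symbol, smul_eq_mul]
  rw [mul_comm]
  congr 3
  rw [inner_smul_left, inner_smul_right, real_inner_comm]
  simp only [map_inv₀, conj_trivial]
  push_cast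
  have : ((ε : ℝ) : ℂ) ≠ 0 := by exact_mod_cast hε.ne'
  field_simp

end Mollifier

/-! ### The mollified nets on the Fourier side and their moderate growth -/

theorem exists_testBound' (f : Ultradistribution c M Ω) (θ : testFunctions c M Ω) :
    ∃ s : ℝ, 0 < s ∧ ∃ B : ℝ, 0 ≤ B ∧ TestBound f θ s B := by
  have h := exists_testBound f θ
  cases c with
  | beurling => exact h
  | roumieu => exact ⟨1, one_pos, h 1 one_pos⟩

theorem fourier_eq_expFun (a : Euc d → ℂ) (x : Euc d) : 𝓕 a x = ∫ ζ, a ζ * expFun ζ (-x) := by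
  rw [Real.fourier_eq]
  refine integral_congr_ae (Filter.Eventually.of_forall fun ζ => ?_)
  simp only [expFun, inner_neg_right, Circle.smul_def, smul_eq_mul]
  exact mul_comm _ _

theorem fourierInv_eq_expFun (a : Euc d → ℂ) (x : Euc d) : 𝓕⁻ a x = ∫ ζ, a ζ * expFun ζ x := by
  rw [Real.fourierInv_eq]
  refine integral_congr_ae (Filter.Eventually.of_forall fun ζ => ?_)
  simp only [expFun, Circle.smul_def, smul_eq_mul]
  exact mul_comm _ _

theorem expFun_add_right (ζ y y' : Euc d) : expFun ζ (y + y') = expFun ζ y * expFun ζ y' := by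
  simp [expFun, inner_add_right, AddChar.map_add_eq_mul]

/-- As a function of y, the transform of b at x - y is a superposition of the characters e^{2πiζ·y}
with coefficients b(ζ)e^{-2πiζ·x}, and f acts under the integral. Compact support of b makes the
weight e^{M(2π|ζ|/s)} harmless. -/
theorem apply_fourier_sub (f : Ultradistribution c M Ω) (θ : testFunctions c M Ω) {b : Euc d → ℂ}
    (hb : Continuous b) (hbc : HasCompactSupport b) (x : Euc d) (ψ : testFunctions c M Ω)
    (hψ : ∀ y, (ψ : Euc d → ℂ) y = (θ : Euc d → ℂ) y * 𝓕 b (x - y)) :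
    f.1 ψ = 𝓕 (fun ζ => b ζ * localFourier f θ ζ) x := by
  obtain ⟨s, hs, B, -, H⟩ := exists_testBound' f θ
  obtain ⟨R, hR, hbR⟩ := hbc.isBounded.subset_closedBall_lt 0 0
  have hcont : Continuous fun ζ => b ζ * expFun ζ (-x) := hb.mul (continuous_expFun_left _)
  rw [H.apply_fourierInv hs (a := fun ζ => b ζ * expFun ζ (-x)) hcont.aestronglyMeasurable
    (w := fun ζ => ‖b ζ‖ * Real.exp (M.assoc (2 * Real.pi * R / s)))
    ((hb.integrable_of_hasCompactSupport hbc).norm.mul_const _) ?_ ψ ?_, fourier_eq_expFun]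
  · refine integral_congr_ae (Filter.Eventually.of_forall fun ζ => ?_)
    simp only
    ring
  · intro ζ
    rw [norm_mul, norm_expFun, mul_one]
    rcases eq_or_ne (b ζ) 0 with h | h
    · simp [h]
    · have hζ : ‖ζ‖ ≤ R := by simpa using hbR (subset_tsupport _ h)
      refine mul_le_mul_of_nonneg_left (Real.exp_le_exp.2 (M.assoc_mono' (by positivity) ?_))
        (norm_nonneg _)
      gcongr
  · intro y
    rw [hψ, fourier_eq_expFun, fourierInv_eq_expFun]
    congr 1
    refine integral_congr_ae (Filter.Eventually.of_forall fun ζ => ?_)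
    simp only
    rw [show -(x - y) = -x + y by abel, expFun_add_right, mul_assoc]

/-- The net `(θ f) * φ_ε` as a Fourier transform. -/
theorem mollify_eq_fourier (φ : Mollifier N d) (θ : testFunctions c M Ω)
    (f : Ultradistribution c M Ω) (ε : Set.Ioc (0 : ℝ) 1) :
    mollify φ θ f ε = 𝓕 (fun ζ => φ.symbol ε ζ * localFourier f θ ζ) := by
  ext x
  refine apply_fourier_sub f θ φ.continuous_symbol (φ.hasCompactSupport_symbol ε.2.1) x _ fun y => ?_
  rw [← φ.net_eq_fourier]
  rfl

theorem mollify_derivBound_aux {A H : ℝ} (hA : 0 ≤ A) (hH : 0 < H)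
    (hAH : ∀ t : ℝ, 0 ≤ t → Real.exp (M.assoc t) ^ 4 ≤ A * Real.exp (M.assoc (H * t)))
    {h s k B : ℝ} (hh : 0 < h) (hs : 0 < s) (hk : 0 < k) (hkh : 2 * H ≤ k * h) (hks : 2 * H ≤ k * s)
    (φ : Mollifier N d) {θ : testFunctions c M Ω} {f : Ultradistribution c M Ω} (hB : 0 ≤ B)
    (hf : TestBound f θ s B) : ∃ D : ℝ, 0 ≤ D ∧ ∀ ε : Set.Ioc (0 : ℝ) 1,
      ContDiff ℝ ∞ (mollify φ θ f ε) ∧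
        DerivBound M h (D * growth M k ε) Set.univ (mollify φ θ f ε) := by
  obtain ⟨D, hD, key⟩ := derivBound_fourier_of_growth (d := d) hA hH hAH hh hs hk hkh hks
  obtain ⟨C, hC, hCφ⟩ := φ.exists_norm_symbol_le
  refine ⟨C * B * D, by positivity, fun ε => ?_⟩
  rw [mollify_eq_fourier]
  refine key _ (C * B) ε (φ.continuous_symbol.mul (continuous_localFourier f θ)).aestronglyMeasurable
    (by positivity) ε.2.1 (fun ζ => ?_) fun ζ hζ => ?_
  · rw [norm_mul, mul_assoc]
    exact mul_le_mul (hCφ ε ζ) (hf.norm_localFourier_le hs ζ) (norm_nonneg _) (by positivity)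
  · rw [φ.symbol_eq_zero ε.2.1 hζ, zero_mul]

/-- The constraints are 2H ≤ kh and 2H ≤ ks. In the Beurling case h and s are given and k =
2H/min(h, s) works; in the Roumieu case k is given and h = s = 2H/k is allowed because s is free. -/
theorem mollify_derivBound (hM : M.ModerateGrowth) (φ : Mollifier N d) (θ : testFunctions c M Ω)
    (f : Ultradistribution c M Ω) :
    match c with
    | .beurling => ∀ h : ℝ, 0 < h → ∃ k : ℝ, 0 < k ∧ ∃ D : ℝ, 0 ≤ D ∧ ∀ ε : Set.Ioc (0 : ℝ) 1,
        ContDiff ℝ ∞ (mollify φ θ f ε) ∧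
          DerivBound M h (D * growth M k ε) Set.univ (mollify φ θ f ε)
    | .roumieu => ∀ k : ℝ, 0 < k → ∃ h : ℝ, 0 < h ∧ ∃ D : ℝ, 0 ≤ D ∧ ∀ ε : Set.Ioc (0 : ℝ) 1,
        ContDiff ℝ ∞ (mollify φ θ f ε) ∧
          DerivBound M h (D * growth M k ε) Set.univ (mollify φ θ f ε) := by
  obtain ⟨A, H, hA, hH, hAH⟩ := hM.exp_four_le
  have hf := exists_testBound f θ
  cases c with
  | beurling =>
    intro h hh
    obtain ⟨s, hs, B, hB, hf⟩ := hf
    have hm : 0 < min h s := lt_min hh hs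
    refine ⟨2 * H / min h s, by positivity, mollify_derivBound_aux (by positivity) (by positivity) hAH
      hh hs (by positivity) ?_ ?_ φ hB hf⟩
    · rw [div_mul_eq_mul_div, le_div_iff₀ hm]
      exact mul_le_mul_of_nonneg_left (min_le_left _ _) (by positivity)
    · rw [div_mul_eq_mul_div, le_div_iff₀ hm]
      exact mul_le_mul_of_nonneg_left (min_le_right _ _) (by positivity)
  | roumieu =>
    intro k hk
    have hs : 0 < 2 * H / k := by positivity
    obtain ⟨B, hB, hf⟩ := hf _ hs
    have e : 2 * H ≤ k * (2 * H / k) := (mul_div_cancel₀ _ hk.ne').ge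
    exact ⟨_, hs, mollify_derivBound_aux (by positivity) (by positivity) hAH hs hs hk e e φ hB hf⟩

theorem contDiff_mollify (hM : M.ModerateGrowth) (φ : Mollifier N d) (θ : testFunctions c M Ω)
    (f : Ultradistribution c M Ω) (ε : Set.Ioc (0 : ℝ) 1) : ContDiff ℝ ∞ (mollify φ θ f ε) := by
  have H := mollify_derivBound hM φ θ f
  cases c with
  | beurling => obtain ⟨k, -, D, -, H⟩ := H 1 one_pos; exact (H ε).1
  | roumieu => obtain ⟨k, -, D, -, H⟩ := H 1 one_pos; exact (H ε).1

theorem hasUltraBound_mollify (hM : M.ModerateGrowth) (φ : Mollifier N d) (θ : testFunctions c M Ω)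
    (f : Ultradistribution c M Ω) (ε : Set.Ioc (0 : ℝ) 1) (K : Set (Euc d)) :
    HasUltraBound c M K (mollify φ θ f ε) := by
  have H := mollify_derivBound hM φ θ f
  refine HasUltraBound.of_derivBound ?_
  have hg : ∀ k, 0 ≤ growth M k ε := fun _ => (Real.exp_pos _).le
  cases c with
  | beurling =>
    intro h hh
    obtain ⟨k, -, D, hD, H⟩ := H h hh
    exact ⟨_, mul_nonneg hD (hg k), (H ε).2.subset (Set.subset_univ _)⟩
  | roumieu =>
    obtain ⟨h, hh, D, hD, H⟩ := H 1 one_pos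
    exact ⟨h, hh, _, mul_nonneg hD (hg 1), (H ε).2.subset (Set.subset_univ _)⟩

theorem mollify_mem_moderateNets (hM : M.ModerateGrowth) (φ : Mollifier N d)
    (θ : testFunctions c M Ω) (f : Ultradistribution c M Ω) (U : TopologicalSpace.Opens (Euc d)) :
    mollify φ θ f ∈ moderateNets c M U := by
  refine ⟨fun ε => ⟨(contDiff_mollify hM φ θ f ε).contDiffOn,
    fun K _ _ => hasUltraBound_mollify hM φ θ f ε K⟩, fun K _ _ => ?_⟩
  have H := mollify_derivBound hM φ θ f
  cases c with
  | beurling =>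
    intro h hh
    obtain ⟨k, hk, D, hD, H⟩ := H h hh
    exact ⟨k, hk, NormBigO.of_derivBound hh (fun _ => (Real.exp_pos _).le) hD one_pos
      fun ε _ => (H ε).2.subset (Set.subset_univ _)⟩
  | roumieu =>
    intro k hk
    obtain ⟨h, hh, D, hD, H⟩ := H k hk
    exact ⟨h, hh, NormBigO.of_derivBound hh (fun _ => (Real.exp_pos _).le) hD one_pos
      fun ε _ => (H ε).2.subset (Set.subset_univ _)⟩

end

/-! ### Decay of the mollifiers away from the origin -/

section

variable {c : UltraClass} {M N : WeightSequence} {Ω : TopologicalSpace.Opens (Euc d)}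

/-- The monomial `∏ ζ_i`, for `i` running over a list of indices. -/
def monomial (l : List (Fin d)) (ζ : Euc d) : ℝ := (l.map fun i => ζ i).prod

theorem monomial_append (l l' : List (Fin d)) (ζ : Euc d) :
    monomial (l ++ l') ζ = monomial l ζ * monomial l' ζ := by
  simp [monomial]

theorem monomial_ofFn {n : ℕ} (w : Fin n → Fin d) (ζ : Euc d) :
    monomial (List.ofFn w) ζ = ∏ j, ζ (w j) := by
  simp [monomial, List.map_ofFn, List.prod_ofFn]

theorem contDiff_monomial (l : List (Fin d)) :
    ContDiff ℝ ∞ fun ζ : Euc d => (monomial l ζ : ℂ) := by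
  induction l with
  | nil => simpa [monomial] using contDiff_const
  | cons i l ih =>
    have e : (fun ζ : Euc d => (monomial (i :: l) ζ : ℂ)) =
        fun ζ => ((ζ i : ℝ) : ℂ) * (monomial l ζ : ℂ) := by
      ext ζ; simp [monomial]
    rw [e]
    exact (Complex.ofRealCLM.contDiff.comp (EuclideanSpace.proj i).contDiff).mul ih

/-- A coordinate is linear, so only the Leibniz terms with at most one derivative on it survive. -/
theorem norm_iteratedFDeriv_coord_mul_le (i : Fin d) {g : Euc d → ℂ} (hg : ContDiff ℝ ∞ g)
    (ζ : Euc d) (k : ℕ) :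
    ‖iteratedFDeriv ℝ (k + 1) (fun ζ : Euc d => ((ζ i : ℝ) : ℂ) * g ζ) ζ‖ ≤
      ‖ζ‖ * ‖iteratedFDeriv ℝ (k + 1) g ζ‖ + (k + 1) * ‖iteratedFDeriv ℝ k g ζ‖ := by
  set L : Euc d →L[ℝ] ℂ := Complex.ofRealCLM ∘L EuclideanSpace.proj i with hL
  have hLn : ∀ x, ‖L x‖ ≤ 1 * ‖x‖ := fun x => by
    rw [one_mul]
    change ‖((x i : ℝ) : ℂ)‖ ≤ _
    rw [Complex.norm_real]
    exact PiLp.norm_apply_le _ _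
  have hn : ((k + 1 : ℕ) : ℕ∞ω) ≤ ∞ := by exact_mod_cast le_top
  have h := norm_iteratedFDeriv_mul_le (N := ∞) L.contDiff hg ζ hn
  have h2 : ∀ j, ‖iteratedFDeriv ℝ (j + 1 + 1) L ζ‖ = 0 := fun j => by
    rw [← norm_iteratedFDeriv_fderiv]
    have e : fderiv ℝ L = fun _ => L := funext fun x => L.fderiv
    rw [e, iteratedFDeriv_succ_const]
    simp
  have h1 : ‖iteratedFDeriv ℝ (0 + 1) L ζ‖ ≤ 1 := by
    rw [zero_add, norm_iteratedFDeriv_one, L.fderiv]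
    exact L.opNorm_le_bound zero_le_one hLn
  rw [Finset.sum_range_succ', Finset.sum_range_succ', Finset.sum_eq_zero fun j _ => by
    rw [h2]; ring] at h
  refine h.trans ?_
  rw [zero_add, add_comm]
  simp only [Nat.choose_zero_right, norm_iteratedFDeriv_zero, zero_add, Nat.choose_one_right,
    Nat.sub_zero, Nat.cast_one, one_mul]
  refine add_le_add ?_ ?_
  · gcongr
    simpa using hLn ζ
  · have := norm_nonneg (iteratedFDeriv ℝ k g ζ)
    rw [zero_add] at h1
    push_cast
    calc ((k : ℝ) + 1) * ‖iteratedFDeriv ℝ 1 L ζ‖ * ‖iteratedFDeriv ℝ k g ζ‖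
        ≤ (k + 1) * 1 * ‖iteratedFDeriv ℝ k g ζ‖ := by gcongr
      _ = _ := by ring

/-- In the Beurling class of N every parameter is available. The choice 1/(2π) is turned into ε by
the dilation 2πε. -/
theorem Mollifier.derivBound_symbol (φ : Mollifier N d) : ∃ C : ℝ, 0 ≤ C ∧ ∀ ε : ℝ, 0 < ε →
    DerivBound N ε C Set.univ (φ.symbol ε) := by
  obtain ⟨C, hC, h⟩ := (φ.hat_mem.2.2.2.derivBound) (2 * Real.pi)⁻¹ (by positivity)
  refine ⟨C, hC, fun ε hε x _ n => ?_⟩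
  set L : Euc d →L[ℝ] Euc d := (2 * Real.pi * ε) • ContinuousLinearMap.id ℝ (Euc d) with hL
  have e : φ.symbol ε = φ.hat ∘ L := rfl
  have hn : (n : ℕ∞ω) ≤ ∞ := by exact_mod_cast le_top
  have hN := N.pos n
  have hLn : ‖L‖ ≤ 2 * Real.pi * ε := by
    refine L.opNorm_le_bound (by positivity) fun x => ?_
    simp [hL, norm_smul, abs_of_pos Real.pi_pos, abs_of_pos hε]
  rw [e, L.iteratedFDeriv_comp_right φ.hat_mem.1 x hn]
  refine (ContinuousMultilinearMap.norm_compContinuousLinearMap_le _ _).trans ?_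
  rw [Finset.prod_const, Finset.card_univ, Fintype.card_fin]
  calc ‖iteratedFDeriv ℝ n φ.hat (L x)‖ * ‖L‖ ^ n
      ≤ C * ((2 * Real.pi)⁻¹ ^ n * N.seq n) * (2 * Real.pi * ε) ^ n := by
        gcongr; exact h _ trivial n
    _ = C * (((2 * Real.pi)⁻¹ * (2 * Real.pi * ε)) ^ n * N.seq n) := by
        rw [mul_pow (2 * Real.pi)⁻¹]; ring
    _ = _ := by rw [inv_mul_cancel_left₀ (by positivity)]

/-- Each coordinate costs a factor (1 + S)/ε: 1/ε because |ζ| ≤ 1/ε on the support, and S/ε because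
(n + 1)N_n ≤ S N_{n+1} and one power of ε is missing when the derivative falls on the coordinate. -/
theorem Mollifier.derivBound_monomial_symbol (φ : Mollifier N d) : ∃ C R : ℝ, 0 ≤ C ∧ 0 < R ∧
    ∀ (ε : ℝ) (l : List (Fin d)), 0 < ε → DerivBound N ε (C * (R / ε) ^ l.length) Set.univ
      (fun ζ => (monomial l ζ : ℂ) * φ.symbol ε ζ) := by
  obtain ⟨C, hC, h⟩ := φ.derivBound_symbol
  obtain ⟨S, hS, hSN⟩ := N.exists_nat_mul_le
  refine ⟨C, 1 + S, hC, by positivity, fun ε l hε => ?_⟩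
  induction l with
  | nil => simpa [monomial] using h ε hε
  | cons i l ih =>
    set g : Euc d → ℂ := fun ζ => (monomial l ζ : ℂ) * φ.symbol ε ζ with hg
    have hgd : ContDiff ℝ ∞ g := (contDiff_monomial l).mul φ.contDiff_symbol
    have e : (fun ζ : Euc d => (monomial (i :: l) ζ : ℂ) * φ.symbol ε ζ) =
        fun ζ : Euc d => ((ζ i : ℝ) : ℂ) * g ζ := by
      ext ζ; simp [monomial, hg, mul_assoc]
    rw [e]
    refine DerivBound.univ_of_tsupport hε.le (by positivity) fun ζ hζ n => ?_
    have hζ' : ‖ζ‖ ≤ 1 / ε := by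
      have h1 : tsupport (fun ζ : Euc d => ((ζ i : ℝ) : ℂ) * g ζ) ⊆
          Metric.closedBall 0 (1 / ε) := by
        refine closure_minimal (fun ζ hζ => ?_) Metric.isClosed_closedBall
        rw [mem_closedBall_zero_iff]
        by_contra hlt
        refine hζ ?_
        have : 2 / ε ≤ 2 * Real.pi * ‖ζ‖ := by
          have e : 2 / ε = 2 * (1 / ε) := by ring
          rw [e]
          nlinarith [Real.pi_gt_three, norm_nonneg ζ, not_le.1 hlt]
        simp [hg, φ.symbol_eq_zero hε this]
      simpa using h1 hζ
    have hn := N.pos n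
    set B := C * ((1 + S) / ε) ^ l.length with hB
    have hB0 : 0 ≤ B := by positivity
    have hgoal : C * ((1 + S) / ε) ^ (i :: l).length * (ε ^ n * N.seq n) =
        B * ((1 + S) / ε) * (ε ^ n * N.seq n) := by
      rw [List.length_cons, pow_succ, hB]; ring
    rw [hgoal]
    have hb := ih ζ trivial
    rcases n with _ | n
    · have h0 := hb 0
      rw [norm_iteratedFDeriv_zero] at h0 ⊢
      rw [norm_mul, Complex.norm_real]
      calc ‖ζ i‖ * ‖g ζ‖ ≤ (1 / ε) * (B * (ε ^ 0 * N.seq 0)) := by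
            gcongr
            exact (PiLp.norm_apply_le _ _).trans hζ'
        _ = B * (1 / ε) * (ε ^ 0 * N.seq 0) := by ring
        _ ≤ _ := by gcongr; linarith
    · refine (norm_iteratedFDeriv_coord_mul_le i hgd ζ n).trans ?_
      have h1 := hb (n + 1)
      have h2 := hb n
      have h3 := hSN n
      calc ‖ζ‖ * ‖iteratedFDeriv ℝ (n + 1) g ζ‖ + (n + 1) * ‖iteratedFDeriv ℝ n g ζ‖
          ≤ (1 / ε) * (B * (ε ^ (n + 1) * N.seq (n + 1))) +
            (n + 1) * (B * (ε ^ n * N.seq n)) := by gcongr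
        _ = (1 / ε) * (B * (ε ^ (n + 1) * N.seq (n + 1))) +
            B * ε ^ n * ((n + 1) * N.seq n) := by ring
        _ ≤ (1 / ε) * (B * (ε ^ (n + 1) * N.seq (n + 1))) +
            B * ε ^ n * (S * N.seq (n + 1)) := by gcongr
        _ = _ := by field_simp; ring

/-- The symbol obeys bounds of class N with parameter ε on a ball of radius 1/ε. The volume of the
ball produces the factor ε^{-d}, and the parameter produces e^{-N(2π|z|/ε)}. -/
theorem Mollifier.norm_fourier_monomial_symbol_le (φ : Mollifier N d) :
    ∃ C R : ℝ, 0 ≤ C ∧ 0 < R ∧ ∀ (ε : ℝ) (l : List (Fin d)) (z : Euc d), 0 < ε →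
      ‖𝓕 (fun ζ => (monomial l ζ : ℂ) * φ.symbol ε ζ) z‖ ≤
        C * (1 / ε) ^ d * (R / ε) ^ l.length * Real.exp (-N.assoc (2 * Real.pi * ‖z‖ / ε)) := by
  obtain ⟨C, R, hC, hR, h⟩ := φ.derivBound_monomial_symbol
  refine ⟨C * volume.real (Metric.ball (0 : Euc d) 1), R, by positivity, hR, fun ε l z hε => ?_⟩
  have hsub : tsupport (fun ζ => (monomial l ζ : ℂ) * φ.symbol ε ζ) ⊆
      Metric.closedBall 0 (1 / ε) := by
    refine closure_minimal (fun ζ hζ => ?_) Metric.isClosed_closedBall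
    rw [mem_closedBall_zero_iff]
    by_contra hlt
    refine hζ ?_
    have : 2 / ε ≤ 2 * Real.pi * ‖ζ‖ := by
      have e : 2 / ε = 2 * (1 / ε) := by ring
      rw [e]
      nlinarith [Real.pi_gt_three, norm_nonneg ζ, not_le.1 hlt]
    simp [φ.symbol_eq_zero hε this]
  have h1 := norm_fourier_le (M := N) ((contDiff_monomial l).mul φ.contDiff_symbol)
    ((φ.hasCompactSupport_symbol hε).mul_left) (isCompact_closedBall _ _) hsub hε (by positivity)
    ((h ε l hε).subset (Set.subset_univ _)) z
  refine h1.trans (le_of_eq ?_)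
  rw [Measure.addHaar_real_closedBall _ _ (by positivity), finrank_euclideanSpace_fin]
  ring

end

/-! ### Products of functions of class `*` -/

section

variable {c : UltraClass} {M N : WeightSequence} {Ω : TopologicalSpace.Opens (Euc d)}

theorem HasUltraBound.subset {K K' : Set (Euc d)} {g : Euc d → ℂ} (H : HasUltraBound c M K g)
    (hK : K' ⊆ K) : HasUltraBound c M K' g := by
  refine HasUltraBound.of_derivBound ?_
  have H := H.derivBound
  cases c with
  | beurling => exact fun h hh => let ⟨C, hC, H⟩ := H h hh; ⟨C, hC, H.subset hK⟩
  | roumieu => obtain ⟨h, hh, C, hC, H⟩ := H; exact ⟨h, hh, C, hC, H.subset hK⟩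

theorem HasUltraBound.congr {K U : Set (Euc d)} {f g : Euc d → ℂ} (H : HasUltraBound c M K g)
    (hU : IsOpen U) (hK : K ⊆ U) (hfg : ∀ x ∈ U, f x = g x) : HasUltraBound c M K f := by
  refine HasUltraBound.of_derivBound ?_
  have H := H.derivBound
  cases c with
  | beurling => exact fun h hh => let ⟨C, hC, H⟩ := H h hh; ⟨C, hC, H.congr hU hK hfg⟩
  | roumieu => obtain ⟨h, hh, C, hC, H⟩ := H; exact ⟨h, hh, C, hC, H.congr hU hK hfg⟩

theorem HasUltraBound.mul {K : Set (Euc d)} {f g : Euc d → ℂ}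
    (hf : ∀ x ∈ K, ContDiffAt ℝ ∞ f x) (hg : ∀ x ∈ K, ContDiffAt ℝ ∞ g x)
    (H : HasUltraBound c M K f) (H' : HasUltraBound c M K g) :
    HasUltraBound c M K (fun y => f y * g y) := by
  refine HasUltraBound.of_derivBound ?_
  have H := H.derivBound
  have H' := H'.derivBound
  cases c with
  | beurling =>
    intro h hh
    obtain ⟨C, hC, H⟩ := H _ (half_pos hh)
    obtain ⟨C', hC', H'⟩ := H' _ (half_pos hh)
    refine ⟨C * C', mul_nonneg hC hC', ?_⟩
    have := H.mul hf hg (half_pos hh).le (half_pos hh).le hC H'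
    rwa [add_halves] at this
  | roumieu =>
    obtain ⟨h, hh, C, hC, H⟩ := H
    obtain ⟨h', hh', C', hC', H'⟩ := H'
    exact ⟨h + h', add_pos hh hh', C * C', mul_nonneg hC hC', H.mul hf hg hh.le hh'.le hC H'⟩

theorem HasUltraBound.univ_of_tsupport {g : Euc d → ℂ} (H : HasUltraBound c M (tsupport g) g) :
    HasUltraBound c M Set.univ g := by
  refine HasUltraBound.of_derivBound ?_
  have H := H.derivBound
  cases c with
  | beurling => exact fun h hh => let ⟨C, hC, H⟩ := H h hh; ⟨C, hC, H.univ_of_tsupport hh.le hC⟩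
  | roumieu =>
    obtain ⟨h, hh, C, hC, H⟩ := H
    exact ⟨h, hh, C, hC, H.univ_of_tsupport hh.le hC⟩

/-- Only the behaviour of g at the support of θ matters, since elsewhere the product vanishes near
the point. Hence g may be a function defined meaningfully only on Ω. -/
theorem mul_mem_testFunctions' (θ : testFunctions c M Ω) {Ω' : TopologicalSpace.Opens (Euc d)}
    (hΩ' : tsupport (θ : Euc d → ℂ) ⊆ Ω') {g : Euc d → ℂ}
    (hg : ∀ x ∈ tsupport (θ : Euc d → ℂ), ContDiffAt ℝ ∞ g x)
    (H : HasUltraBound c M (tsupport (θ : Euc d → ℂ)) g) :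
    (fun y => (θ : Euc d → ℂ) y * g y) ∈ testFunctions c M Ω' := by
  refine ⟨contDiff_iff_contDiffAt.2 fun x => ?_, θ.2.2.1.mul_right,
    tsupport_mul_subset_left.trans hΩ', ?_⟩
  · by_cases hx : x ∈ tsupport (θ : Euc d → ℂ)
    · exact θ.2.1.contDiffAt.mul (hg x hx)
    · have h0 : (fun y => (θ : Euc d → ℂ) y * g y) =ᶠ[nhds x] fun _ => 0 := by
        filter_upwards [(notMem_tsupport_iff_eventuallyEq.1 hx)] with y hy
        simp [hy]
      exact contDiffAt_const.congr_of_eventuallyEq h0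
  · refine HasUltraBound.univ_of_tsupport (HasUltraBound.subset ?_ tsupport_mul_subset_left)
    exact HasUltraBound.mul (fun x _ => θ.2.1.contDiffAt) hg
      (θ.2.2.2.2.subset (Set.subset_univ _)) H

/-! ### Translated kernels and the estimate off the support of the cut-off -/

theorem norm_iteratedFDeriv_comp_const_sub (g : Euc d → ℂ) (x y : Euc d) (n : ℕ) :
    ‖iteratedFDeriv ℝ n (fun y => g (x - y)) y‖ = ‖iteratedFDeriv ℝ n g (x - y)‖ := by
  have e : (fun y => g (x - y)) = (fun z => g (x + z)) ∘ LinearIsometryEquiv.neg ℝ (E := Euc d) := by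
    ext y; simp [sub_eq_add_neg]
  rw [e, LinearIsometryEquiv.norm_iteratedFDeriv_comp_right, iteratedFDeriv_comp_add_left]
  simp [sub_eq_add_neg]

/-- On |ζ| ≤ R the factor (2π|ζ|)^n is at most h^n M_n e^{M(2πR/h)}, for every h. Band-limited
kernels therefore belong to both classes. -/
theorem derivBound_fourier_of_compact {b : Euc d → ℂ} (hb : Continuous b)
    (hbc : HasCompactSupport b) {h : ℝ} (hh : 0 < h) :
    ContDiff ℝ ∞ (𝓕 b) ∧ ∃ C : ℝ, 0 ≤ C ∧ DerivBound M h C Set.univ (𝓕 b) := by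
  obtain ⟨R, hR, hbR⟩ := hbc.isBounded.subset_closedBall_lt 0 0
  obtain ⟨h1, h2⟩ := derivBound_fourier (M := M) hb.aestronglyMeasurable (h := h)
    (w := fun ζ => Real.exp (M.assoc (2 * Real.pi * R / h)) * ‖b ζ‖)
    ((hb.integrable_of_hasCompactSupport hbc).norm.const_mul _) fun n ζ => by
      rcases eq_or_ne (b ζ) 0 with h0 | h0
      · simp [h0]
      · have hζ : ‖ζ‖ ≤ R := by simpa using hbR (subset_tsupport _ h0)
        rw [← mul_assoc]
        refine mul_le_mul_of_nonneg_right ?_ (norm_nonneg _)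
        refine le_trans ?_ (M.pow_le_pow_mul (t := 2 * Real.pi * R) (by positivity) hh n)
        gcongr
  exact ⟨h1, _, h2.nonneg ⟨0, trivial⟩, h2⟩

theorem mul_fourier_sub_mem (θ : testFunctions c M Ω) {b : Euc d → ℂ} (hb : Continuous b)
    (hbc : HasCompactSupport b) (x : Euc d) :
    (fun y => (θ : Euc d → ℂ) y * 𝓕 b (x - y)) ∈ testFunctions c M Ω := by
  refine mul_mem_testFunctions' θ θ.2.2.2.1 (g := fun y => 𝓕 b (x - y)) (fun y _ => ?_)
    (HasUltraBound.of_derivBound ?_)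
  · have h1 := (derivBound_fourier_of_compact (M := M) hb hbc one_pos).1
    exact (h1.comp (contDiff_const.sub contDiff_id)).contDiffAt
  · have key : ∀ h : ℝ, 0 < h → ∃ C : ℝ, 0 ≤ C ∧ DerivBound M h C (tsupport (θ : Euc d → ℂ))
        (fun y => 𝓕 b (x - y)) := fun h hh => by
      obtain ⟨-, C, hC, H⟩ := derivBound_fourier_of_compact (M := M) hb hbc hh
      refine ⟨C, hC, fun y _ n => ?_⟩
      rw [norm_iteratedFDeriv_comp_const_sub]
      exact H _ trivial n
    cases c with
    | beurling => exact key
    | roumieu => exact ⟨1, one_pos, key 1 one_pos⟩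

theorem integrable_pow_mul_of_compact {b : Euc d → ℂ} (hb : Continuous b)
    (hbc : HasCompactSupport b) (n : ℕ) : Integrable fun ζ => ‖ζ‖ ^ n * ‖b ζ‖ :=
  Continuous.integrable_of_hasCompactSupport (by fun_prop) hbc.norm.mul_left

/-- The derivatives of the Fourier transform of a monomial multiple of a symbol. -/
theorem partialDeriv_fourier_monomial {b : Euc d → ℂ} (hb : Continuous b)
    (hbc : HasCompactSupport b) (l : List (Fin d)) {n : ℕ} (w : Fin n → Fin d) (x : Euc d) :
    partialDeriv (𝓕 fun ζ => (monomial l ζ : ℂ) * b ζ) n w x =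
      (-(2 * Real.pi * Complex.I)) ^ n *
        𝓕 (fun ζ => (monomial (List.ofFn w ++ l) ζ : ℂ) * b ζ) x := by
  have h1 : Continuous fun ζ => (monomial l ζ : ℂ) * b ζ :=
    (contDiff_monomial l).continuous.mul hb
  rw [partialDeriv_fourier h1.aestronglyMeasurable
    (integrable_pow_mul_of_compact h1 hbc.mul_left), fourier_eq_expFun, fourier_eq_expFun,
    ← integral_const_mul]
  refine integral_congr_ae (Filter.Eventually.of_forall fun ζ => ?_)
  simp only [monomial_append, monomial_ofFn, Complex.ofReal_mul]
  ring

/-- `((ρ f) * φ_ε)_ε` is negligible off the support of `ρ`. -/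
theorem normBigO_mollify_decay (hM : M.ModerateGrowth)
    (hMN : ∀ l : ℝ, 0 < l → ∃ C : ℝ, 0 < C ∧ ∀ t : ℝ, 0 ≤ t →
      2 * M.assoc t ≤ N.assoc (l * t) + C)
    (φ : Mollifier N d) (ρ : testFunctions c M Ω) (f : Ultradistribution c M Ω)
    {U : Set (Euc d)} (hU : IsOpen U) (hρ : ∀ x ∈ U, (ρ : Euc d → ℂ) x = 0) {K : Set (Euc d)}
    (hK : IsCompact K) (hKU : K ⊆ U) {h k : ℝ} (hh : 0 < h) (hk : 0 < k) :
    NormBigO M h K (mollify φ ρ f) (decay M k) := by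
  obtain ⟨A, H, hA, hH, hAH⟩ := hM.exp_four_le
  obtain ⟨s, hs, B, hB, hf⟩ := exists_testBound' f ρ
  obtain ⟨C, R, hC, hR, hφ⟩ := φ.norm_fourier_monomial_symbol_le
  obtain ⟨D, hD, hpoly⟩ := M.one_add_pow_le d one_pos
  obtain ⟨δ, hδ, hKδ⟩ := hK.exists_thickening_subset_open hU hKU
  have hdist : ∀ x ∈ K, ∀ y ∈ tsupport (ρ : Euc d → ℂ), δ ≤ ‖x - y‖ := by
    intro x hx y hy
    by_contra hlt
    have hyU : y ∈ U := by
      refine hKδ (Metric.mem_thickening_iff.2 ⟨x, hx, ?_⟩)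
      rw [dist_comm, dist_eq_norm]
      exact not_le.1 hlt
    refine notMem_tsupport_iff_eventuallyEq.2 ?_ hy
    filter_upwards [hU.mem_nhds hyU] with z hz using hρ z hz
  -- The number q dominates the rates of all exponentials to come: the y-derivatives tested by f,
  -- the x-derivatives measured with h, the power ε^{-d}, and the prescribed decay k. Each of them
  -- is then at most E = e^{M(q/ε)}.
  set q : ℝ := max (max (2 * Real.pi * R * d / s) (2 * Real.pi * R / h)) (max 1 k) with hq
  have hq1 : 2 * Real.pi * R * d / s ≤ q := (le_max_left _ _).trans (le_max_left _ _)
  have hq2 : 2 * Real.pi * R / h ≤ q := (le_max_right _ _).trans (le_max_left _ _)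
  have hq3 : 1 ≤ q := (le_max_left _ _).trans (le_max_right _ _)
  have hq4 : k ≤ q := (le_max_right _ _).trans (le_max_right _ _)
  have hq0 : 0 < q := by linarith
  -- The scale l is chosen so that l·Hq/ε = 2πδ/ε, the argument in the decay of the kernel at
  -- distance δ.
  obtain ⟨C', hC', hN⟩ := hMN (2 * Real.pi * δ / (H * q)) (by positivity)
  set C₁ : ℝ := B * C * D * A * Real.exp C' with hC₁
  have hC₁0 : 0 ≤ C₁ := by positivity
  refine ⟨C₁.toNNReal, 1, one_pos, fun ε _ => ?_⟩
  have hε : (0 : ℝ) < ε := ε.2.1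
  have hdec : 0 < decay M k ε := Real.exp_pos _
  have e0 : (C₁.toNNReal : ENNReal) * ENNReal.ofReal (decay M k ε) =
      ((C₁ * decay M k ε).toNNReal : ℝ≥0) := by
    rw [Real.toNNReal_mul hC₁0, ENNReal.coe_mul]; rfl
  rw [e0, ultraNorm_le_iff M hh]
  intro x hx n w
  rw [Real.coe_toNNReal _ (by positivity)]
  have hMn := M.pos n
  set b : Euc d → ℂ := fun ζ => (monomial (List.ofFn w) ζ : ℂ) * φ.symbol ε ζ with hb
  have hbc : Continuous b := (contDiff_monomial _).continuous.mul φ.continuous_symbol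
  have hbs : HasCompactSupport b := (φ.hasCompactSupport_symbol hε).mul_left
  have hF := continuous_localFourier f ρ
  have h2pi : ‖(-(2 * Real.pi * Complex.I) : ℂ)‖ = 2 * Real.pi := by
    simp [abs_of_pos Real.pi_pos]
  -- Differentiating the net in x multiplies the symbol by a monomial, so the derivative is again f
  -- applied to ρ times a translated kernel.
  have e1 : partialDeriv (mollify φ ρ f ε) n w x = (-(2 * Real.pi * Complex.I)) ^ n *
      f.1 ⟨_, mul_fourier_sub_mem ρ hbc hbs x⟩ := by
    have h1 := partialDeriv_fourier_monomial (b := fun ζ => φ.symbol ε ζ * localFourier f ρ ζ)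
      (φ.continuous_symbol.mul hF) (φ.hasCompactSupport_symbol hε).mul_right [] w x
    rw [apply_fourier_sub f ρ hbc hbs x _ fun _ => rfl, mollify_eq_fourier]
    simp only [monomial, List.map_nil, List.prod_nil, Complex.ofReal_one, one_mul,
      List.append_nil] at h1
    rw [h1]
    congr 1
    refine congrFun (congrArg _ (funext fun ζ => ?_)) x
    simp only [hb, monomial]
    ring
  set T : ℝ := q / ε with hT
  have hTE : ∀ t : ℝ, 0 ≤ t → t ≤ q → Real.exp (M.assoc (t / ε)) ≤ Real.exp (M.assoc T) :=
    fun t ht htq => Real.exp_le_exp.2 (M.assoc_mono' (by positivity) (by rw [hT]; gcongr))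
  set E : ℝ := Real.exp (M.assoc T) with hE
  have hE0 : 0 < E := Real.exp_pos _
  set G : ℝ := Real.exp (-N.assoc (2 * Real.pi * δ / ε)) with hG
  set Q : ℝ := C * (1 / ε) ^ d * (2 * Real.pi * R / ε) ^ n * G with hQ
  have hQ0 : 0 ≤ Q := by positivity
  -- The y-derivatives bring m more coordinates into the symbol. Since y lies in supp ρ, the
  -- distance |x - y| is at least δ, and the kernel is of size G.
  have hg : DerivBound M s (Q / (2 * Real.pi) ^ n * E) (tsupport (ρ : Euc d → ℂ))
      (fun y => 𝓕 b (x - y)) := by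
    intro y hy m
    have hMm := M.pos m
    rw [norm_iteratedFDeriv_comp_const_sub]
    have h1 : ∀ w' : Fin m → Fin d, ‖partialDeriv (𝓕 b) m w' (x - y)‖ ≤
        Q / (2 * Real.pi) ^ n * (2 * Real.pi * R / ε) ^ m := by
      intro w'
      rw [partialDeriv_fourier_monomial φ.continuous_symbol (φ.hasCompactSupport_symbol hε), norm_mul,
        norm_pow, h2pi]
      have h2 := hφ ε (List.ofFn w' ++ List.ofFn w) (x - y) hε
      rw [List.length_append, List.length_ofFn, List.length_ofFn] at h2
      have h3 : Real.exp (-N.assoc (2 * Real.pi * ‖x - y‖ / ε)) ≤ G := by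
        refine Real.exp_le_exp.2 (neg_le_neg (N.assoc_mono' (by positivity) ?_))
        gcongr
        exact hdist x hx y hy
      calc (2 * Real.pi) ^ m * ‖𝓕 (fun ζ => (monomial (List.ofFn w' ++ List.ofFn w) ζ : ℂ) *
            φ.symbol ε ζ) (x - y)‖
          ≤ (2 * Real.pi) ^ m * (C * (1 / ε) ^ d * (R / ε) ^ (m + n) * G) := by
            refine mul_le_mul_of_nonneg_left (h2.trans ?_) (by positivity)
            gcongr
        _ = _ := by
          rw [hQ, pow_add, mul_div_assoc (2 * Real.pi), mul_pow (2 * Real.pi), mul_pow (2 * Real.pi)]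
          field_simp
    refine (norm_iteratedFDeriv_le_of_partialDeriv (by positivity) h1).trans ?_
    have h4 := M.pow_le_pow_mul (t := 2 * Real.pi * R * d / ε) (by positivity) hs m
    have h5 : Real.exp (M.assoc (2 * Real.pi * R * d / ε / s)) ≤ E := by
      rw [div_right_comm]
      exact hTE _ (by positivity) hq1
    calc (d : ℝ) ^ m * (Q / (2 * Real.pi) ^ n * (2 * Real.pi * R / ε) ^ m)
        = Q / (2 * Real.pi) ^ n * (2 * Real.pi * R * d / ε) ^ m := by
          rw [div_pow, div_pow, mul_pow _ (d : ℝ)]; ring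
      _ ≤ Q / (2 * Real.pi) ^ n * (s ^ m * M.seq m * E) := by
          gcongr
          exact h4.trans (by gcongr)
      _ = _ := by ring
  have hgc : ContDiff ℝ ∞ fun y => 𝓕 b (x - y) :=
    (derivBound_fourier_of_compact (M := M) hbc hbs one_pos).1.comp (contDiff_const.sub contDiff_id)
  have h6 := hf _ _ hgc (mul_fourier_sub_mem ρ hbc hbs x) (by positivity) hg
  rw [e1, norm_mul, norm_pow, h2pi]
  have h7 : (2 * Real.pi * R / ε) ^ n ≤ h ^ n * M.seq n * E := by
    refine (M.pow_le_pow_mul (by positivity) hh n).trans ?_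
    rw [div_right_comm]
    gcongr
    exact hTE _ (by positivity) hq2
  have h8 : (1 / ε : ℝ) ^ d ≤ D * E := by
    have h9 : (1 / ε : ℝ) ^ d ≤ (1 + 1 / ε) ^ d := by gcongr; linarith
    refine h9.trans ((hpoly (1 / ε) (by positivity)).trans ?_)
    rw [one_mul]
    gcongr
    exact hTE 1 zero_le_one hq3
  have h10 : E ^ 4 * G ≤ A * Real.exp C' := by
    have h11 := hAH T (by positivity)
    have h12 : Real.exp (M.assoc (H * T)) ≤ Real.exp C' * Real.exp (N.assoc (2 * Real.pi * δ / ε)) := by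
      rw [← Real.exp_add, Real.exp_le_exp]
      have h13 := hN (H * T) (by positivity)
      have h14 := M.assoc_nonneg (show 0 ≤ H * T by positivity)
      have e : 2 * Real.pi * δ / (H * q) * (H * T) = 2 * Real.pi * δ / ε := by
        rw [hT]; field_simp
      rw [e] at h13
      linarith
    rw [hG, Real.exp_neg, ← div_eq_mul_inv, div_le_iff₀ (Real.exp_pos _)]
    calc E ^ 4 ≤ A * Real.exp (M.assoc (H * T)) := h11
      _ ≤ A * (Real.exp C' * Real.exp (N.assoc (2 * Real.pi * δ / ε))) := by gcongr
      _ = _ := by ring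
  have h15 : 1 ≤ E * decay M k ε := by
    rw [decay, Real.exp_neg, ← div_eq_mul_inv, one_le_div (Real.exp_pos _)]
    exact hTE k hk.le hq4
  have hG0 : 0 < G := Real.exp_pos _
  -- The four factors E pay for ε^{-d}, for the x-derivatives, for the y-derivatives, and for the
  -- insertion of 1 ≤ E e^{-M(k/ε)}. The product E^4 G stays bounded because N dominates M.
  calc (2 * Real.pi) ^ n * ‖f.1 ⟨_, mul_fourier_sub_mem ρ hbc hbs x⟩‖
      ≤ (2 * Real.pi) ^ n * (B * (Q / (2 * Real.pi) ^ n * E)) := by gcongr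
    _ = B * C * ((1 / ε) ^ d * (2 * Real.pi * R / ε) ^ n * E * G) * 1 := by
        rw [hQ]; field_simp
    _ ≤ B * C * ((D * E) * (h ^ n * M.seq n * E) * E * G) * (E * decay M k ε) := by gcongr
    _ = B * C * D * (E ^ 4 * G) * (decay M k ε * (h ^ n * M.seq n)) := by ring
    _ ≤ B * C * D * (A * Real.exp C') * (decay M k ε * (h ^ n * M.seq n)) := by gcongr
    _ = _ := by rw [hC₁]; ring

end

/-! ### Cut-off functions -/

section

variable {c : UltraClass} {M N : WeightSequence} {Ω : TopologicalSpace.Opens (Euc d)}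

/-- The ratios N_{q+1}/N_q increase, so t^q/N_q grows up to q = p and decreases afterwards when t =
N_{p+1}/N_p. The supremum defining N(t) is thus attained at p. -/
theorem WeightSequence.exp_assoc_mul_seq_le (N : WeightSequence) (p : ℕ) :
    Real.exp (N.assoc (N.seq (p + 1) / N.seq p)) * N.seq p ≤ (N.seq (p + 1) / N.seq p) ^ p := by
  have h0 := N.pos p
  have h1 := N.pos (p + 1)
  set t := N.seq (p + 1) / N.seq p with ht
  have ht0 : 0 < t := div_pos h1 h0
  have hr : ∀ q, N.seq (q + 1) / N.seq q = (N.seq q / N.seq (q + 1))⁻¹ := fun q => (inv_div _ _).symm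
  have hup : ∀ q, p ≤ q → t * N.seq q ≤ N.seq (q + 1) := by
    intro q hq
    have h2 := N.ratio_anti hq
    have hq0 := N.pos q
    have hq1 := N.pos (q + 1)
    simp only at h2
    rw [ht, div_mul_eq_mul_div, div_le_iff₀ h0]
    rw [div_le_div_iff₀ hq1 h1] at h2
    linarith
  have hdown : ∀ q, q ≤ p → N.seq (q + 1) ≤ t * N.seq q := by
    intro q hq
    have h2 := N.ratio_anti hq
    have hq0 := N.pos q
    have hq1 := N.pos (q + 1)
    simp only at h2
    rw [ht, div_mul_eq_mul_div, le_div_iff₀ h0]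
    rw [div_le_div_iff₀ h1 hq1] at h2
    linarith
  have key : ∀ q, t ^ q * N.seq p ≤ t ^ p * N.seq q := by
    intro q
    rcases le_total p q with hq | hq
    · induction q, hq using Nat.le_induction with
      | base => exact le_rfl
      | succ q hq ih =>
        calc t ^ (q + 1) * N.seq p = t * (t ^ q * N.seq p) := by ring
          _ ≤ t * (t ^ p * N.seq q) := by gcongr
          _ = t ^ p * (t * N.seq q) := by ring
          _ ≤ t ^ p * N.seq (q + 1) := by gcongr; exact hup q hq
    · refine Nat.decreasingInduction' (P := fun q => t ^ q * N.seq p ≤ t ^ p * N.seq q) ?_ hq le_rfl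
      intro q hqp _ ih
      refine le_of_mul_le_mul_left ?_ ht0
      calc t * (t ^ q * N.seq p) = t ^ (q + 1) * N.seq p := by ring
        _ ≤ t ^ p * N.seq (q + 1) := ih
        _ ≤ t ^ p * (t * N.seq q) := by gcongr; exact hdown q hqp.le
        _ = t * (t ^ p * N.seq q) := by ring
  have h2 : N.assoc t ≤ Real.log (t ^ p / N.seq p) := by
    refine ciSup_le fun q => ?_
    have hq := N.pos q
    refine Real.log_le_log (by positivity) ?_
    rw [div_le_div_iff₀ hq h0]
    exact key q
  rw [← le_div_iff₀ h0]
  rwa [← Real.le_log_iff_exp_le (by positivity)]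

/-- The sequence `N` is smaller than `M`. -/
theorem exists_seq_le
    (hMN : ∀ l : ℝ, 0 < l → ∃ C : ℝ, 0 < C ∧ ∀ t : ℝ, 0 ≤ t →
      2 * M.assoc t ≤ N.assoc (l * t) + C) {l : ℝ} (hl : 0 < l) :
    ∃ C : ℝ, 0 ≤ C ∧ ∀ p, N.seq p ≤ C * (l ^ p * M.seq p) := by
  obtain ⟨C, hC, h⟩ := hMN l hl
  refine ⟨Real.exp C, (Real.exp_pos _).le, fun p => ?_⟩
  have h0 := N.pos p
  have h1 := N.pos (p + 1)
  have hM := M.pos p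
  have h2 := N.exp_assoc_mul_seq_le p
  -- At this t the supremum for N is attained at p. Comparing t^p with l^p M_p e^{M(t/l)} and
  -- cancelling e^{N(t)} transfers the inequality from associated functions to sequences.
  set t := N.seq (p + 1) / N.seq p with ht
  have ht0 : 0 < t := div_pos h1 h0
  have h3 := h (t / l) (by positivity)
  rw [mul_div_cancel₀ _ hl.ne'] at h3
  have h4 := M.assoc_nonneg (show 0 ≤ t / l by positivity)
  have h5 : Real.exp (M.assoc (t / l)) ≤ Real.exp C * Real.exp (N.assoc t) := by
    rw [← Real.exp_add, Real.exp_le_exp]; linarith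
  have h6 := M.pow_le_pow_mul ht0.le hl p
  refine le_of_mul_le_mul_left ?_ (Real.exp_pos (N.assoc t))
  calc Real.exp (N.assoc t) * N.seq p ≤ t ^ p := h2
    _ ≤ l ^ p * M.seq p * Real.exp (M.assoc (t / l)) := h6
    _ ≤ l ^ p * M.seq p * (Real.exp C * Real.exp (N.assoc t)) := by gcongr
    _ = _ := by ring

/-- The function `y ↦ φ^((y - x) / r)`, equal to `1` near `x`. -/
noncomputable def Mollifier.bump (φ : Mollifier N d) (x : Euc d) (r : ℝ) (y : Euc d) : ℂ :=
  φ.hat (r⁻¹ • (-x + y))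

/-- Since N_p ≤ C l^p M_p for every l, a dilated copy of the transform of φ satisfies the M-bounds
for every h. It serves as a bump in both classes, and no separate construction of test functions is
needed. -/
theorem Mollifier.bump_mem
    (hMN : ∀ l : ℝ, 0 < l → ∃ C : ℝ, 0 < C ∧ ∀ t : ℝ, 0 ≤ t →
      2 * M.assoc t ≤ N.assoc (l * t) + C)
    (φ : Mollifier N d) (x : Euc d) {r : ℝ} (hr : 0 < r)
    (hΩ : Metric.closedBall x (2 * r) ⊆ Ω) : φ.bump x r ∈ testFunctions c M Ω := by
  set L : Euc d →L[ℝ] Euc d := r⁻¹ • ContinuousLinearMap.id ℝ (Euc d) with hL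
  have e : φ.bump x r = fun y => (φ.hat ∘ L) (-x + y) := rfl
  have hsub : tsupport (φ.bump x r) ⊆ Metric.closedBall x (2 * r) := by
    refine closure_minimal (fun y hy => ?_) Metric.isClosed_closedBall
    rw [mem_closedBall_iff_norm]
    by_contra hlt
    refine hy (φ.hat_eq_zero _ ?_)
    rw [norm_smul, norm_inv, Real.norm_of_nonneg hr.le, neg_add_eq_sub, inv_mul_eq_div,
      le_div_iff₀ hr]
    exact (not_le.1 hlt).le
  have hc : ContDiff ℝ ∞ (φ.bump x r) :=
    (φ.hat_mem.1.comp L.contDiff).comp (contDiff_const.add contDiff_id)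
  have key : ∀ h : ℝ, 0 < h → ∃ C : ℝ, 0 ≤ C ∧ DerivBound M h C Set.univ (φ.bump x r) := by
    intro h hh
    obtain ⟨C, hC, hb⟩ := φ.hat_mem.2.2.2.derivBound 1 one_pos
    obtain ⟨D, hD, hN⟩ := exists_seq_le hMN (l := h * r) (by positivity)
    refine ⟨C * D, by positivity, fun y _ n => ?_⟩
    have hn : (n : ℕ∞ω) ≤ ∞ := by exact_mod_cast le_top
    have hLn : ‖L‖ ≤ r⁻¹ := by
      refine L.opNorm_le_bound (by positivity) fun x => ?_
      simp [hL, norm_smul, abs_of_pos hr]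
    have hMn := M.pos n
    have hNn := N.pos n
    rw [e, iteratedFDeriv_comp_add_left, L.iteratedFDeriv_comp_right φ.hat_mem.1 _ hn]
    refine (ContinuousMultilinearMap.norm_compContinuousLinearMap_le _ _).trans ?_
    rw [Finset.prod_const, Finset.card_univ, Fintype.card_fin]
    calc ‖iteratedFDeriv ℝ n φ.hat (L (-x + y))‖ * ‖L‖ ^ n
        ≤ C * (1 ^ n * N.seq n) * r⁻¹ ^ n := by
          gcongr; exact hb _ trivial n
      _ ≤ C * (1 ^ n * (D * ((h * r) ^ n * M.seq n))) * r⁻¹ ^ n := by gcongr; exact hN n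
      _ = C * D * (h ^ n * M.seq n) * (r * r⁻¹) ^ n := by rw [mul_pow, mul_pow]; ring
      _ = _ := by rw [mul_inv_cancel₀ hr.ne', one_pow, mul_one]
  refine ⟨hc, (isCompact_closedBall x (2 * r)).of_isClosed_subset (isClosed_tsupport _) hsub,
    hsub.trans hΩ, HasUltraBound.of_derivBound ?_⟩
  cases c with
  | beurling => exact key
  | roumieu => exact ⟨1, one_pos, key 1 one_pos⟩

theorem Mollifier.bump_eq_one (φ : Mollifier N d) {x y : Euc d} {r : ℝ} (hr : 0 < r)
    (hy : y ∈ Metric.ball x r) : φ.bump x r y = 1 := by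
  refine φ.hat_eq_one _ ?_
  rw [mem_ball_iff_norm] at hy
  rw [norm_smul, norm_inv, Real.norm_of_nonneg hr.le, neg_add_eq_sub, inv_mul_eq_div, div_le_one hr]
  exact hy.le

/-- Cut-off functions of class `*`. -/
theorem exists_cutoff
    (hMN : ∀ l : ℝ, 0 < l → ∃ C : ℝ, 0 < C ∧ ∀ t : ℝ, 0 ≤ t →
      2 * M.assoc t ≤ N.assoc (l * t) + C)
    (φ : Mollifier N d) (c : UltraClass) {K : Set (Euc d)} (hK : IsCompact K) (hKΩ : K ⊆ Ω) :
    ∃ (θ : testFunctions c M Ω) (V : TopologicalSpace.Opens (Euc d)), K ⊆ V ∧ V ≤ Ω ∧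
      ∀ x ∈ V, (θ : Euc d → ℂ) x = 1 := by
  refine hK.induction_on (p := fun K => ∃ (θ : testFunctions c M Ω)
    (V : TopologicalSpace.Opens (Euc d)), K ⊆ V ∧ V ≤ Ω ∧ ∀ x ∈ V, (θ : Euc d → ℂ) x = 1) ?_ ?_ ?_ ?_
  · exact ⟨0, ⊥, by simp, bot_le, fun x hx => absurd hx (by simp)⟩
  · rintro s t hst ⟨θ, V, h1, h2, h3⟩
    exact ⟨θ, V, hst.trans h1, h2, h3⟩
  · rintro s t ⟨θ, V, h1, h2, h3⟩ ⟨θ', V', h1', h2', h3'⟩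
    have hmul : (fun y => (θ : Euc d → ℂ) y * (θ' : Euc d → ℂ) y) ∈ testFunctions c M Ω :=
      mul_mem_testFunctions' θ θ.2.2.2.1 (fun x _ => θ'.2.1.contDiffAt)
        (θ'.2.2.2.2.subset (Set.subset_univ _))
    -- The combination is 1 - (1 - θ)(1 - θ'), which equals 1 wherever one of the two cut-offs does.
    refine ⟨θ + θ' - ⟨_, hmul⟩, V ⊔ V', ?_, sup_le h2 h2', ?_⟩
    · rw [TopologicalSpace.Opens.coe_sup]
      exact Set.union_subset_union h1 h1'
    · intro x hx
      simp only [Submodule.coe_sub, Submodule.coe_add, Pi.sub_apply, Pi.add_apply]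
      rcases hx with hx | hx
      · rw [h3 x hx]; ring
      · rw [h3' x hx]; ring
  · intro x hx
    obtain ⟨r, hr, hball⟩ := Metric.isOpen_iff.1 Ω.isOpen x (hKΩ hx)
    have h3 : Metric.closedBall x (2 * (r / 3)) ⊆ Ω :=
      (Metric.closedBall_subset_ball (by linarith)).trans hball
    refine ⟨Metric.ball x (r / 3), mem_nhdsWithin_of_mem_nhds (Metric.ball_mem_nhds x (by positivity)),
      ⟨_, φ.bump_mem hMN x (by positivity) h3⟩, ⟨Metric.ball x (r / 3), Metric.isOpen_ball⟩,
      subset_rfl, ?_, fun y hy => φ.bump_eq_one (by positivity) hy⟩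
    exact (Metric.ball_subset_ball (by linarith)).trans hball

end

/-! ### Localization of nets -/

section

variable {c : UltraClass} {M N : WeightSequence} {Ω : TopologicalSpace.Opens (Euc d)}

theorem ultraNorm_congr {h : ℝ} {K U : Set (Euc d)} {f g : Euc d → ℂ} (hU : IsOpen U) (hK : K ⊆ U)
    (hfg : ∀ x ∈ U, f x = g x) : ultraNorm M h K f = ultraNorm M h K g := by
  refine iSup_congr fun x => iSup_congr fun hx => ?_
  have : f =ᶠ[nhds x] g := by
    filter_upwards [hU.mem_nhds (hK hx)] with y hy using hfg y hy
  simp only [partialDeriv, fun n => (this.iteratedFDeriv ℝ n).eq_of_nhds]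

theorem NormBigO.congr {h : ℝ} {K U : Set (Euc d)} {q q' : Net d} {b : ℝ → ℝ} (hU : IsOpen U)
    (hK : K ⊆ U) (hq : ∀ ε, ∀ x ∈ U, q ε x = q' ε x) (H : NormBigO M h K q' b) :
    NormBigO M h K q b := by
  obtain ⟨C, ε₀, h0, H⟩ := H
  exact ⟨C, ε₀, h0, fun ε hε => (ultraNorm_congr hU hK (hq ε)).trans_le (H ε hε)⟩

theorem ModerateOn.congr {K U : Set (Euc d)} {q q' : Net d} (hU : IsOpen U)
    (hK : K ⊆ U) (hq : ∀ ε, ∀ x ∈ U, q ε x = q' ε x) (H : ModerateOn c M K q') :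
    ModerateOn c M K q := by
  cases c with
  | beurling => exact fun h hh => let ⟨k, hk, H⟩ := H h hh; ⟨k, hk, H.congr hU hK hq⟩
  | roumieu => exact fun k hk => let ⟨h, hh, H⟩ := H k hk; ⟨h, hh, H.congr hU hK hq⟩

theorem NegligibleOn.congr {K U : Set (Euc d)} {q q' : Net d} (hU : IsOpen U)
    (hK : K ⊆ U) (hq : ∀ ε, ∀ x ∈ U, q ε x = q' ε x) (H : NegligibleOn c M K q') :
    NegligibleOn c M K q := by
  cases c with
  | beurling => exact fun h hh k hk => (H h hh k hk).congr hU hK hq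
  | roumieu => obtain ⟨k, hk, h, hh, H⟩ := H; exact ⟨k, hk, h, hh, H.congr hU hK hq⟩

theorem mem_ultraSmooth_of_local {u : Euc d → ℂ}
    (H : ∀ K : Set (Euc d), IsCompact K → K ⊆ Ω → ∃ V : TopologicalSpace.Opens (Euc d), K ⊆ V ∧
      ∃ u' ∈ ultraSmooth c M V, ∀ x ∈ V, u x = u' x) : u ∈ ultraSmooth c M Ω := by
  refine ⟨fun x hx => ?_, fun K hK hKΩ => ?_⟩
  · obtain ⟨V, hV, u', hu', h⟩ := H {x} isCompact_singleton (by simpa using hx)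
    have hxV : x ∈ V := hV rfl
    have h1 : ContDiffAt ℝ ∞ u' x := hu'.1.contDiffAt (V.isOpen.mem_nhds hxV)
    refine (h1.congr_of_eventuallyEq ?_).contDiffWithinAt
    filter_upwards [V.isOpen.mem_nhds hxV] with y hy using h y hy
  · obtain ⟨V, hV, u', hu', h⟩ := H K hK hKΩ
    exact (hu'.2 K hK hV).congr V.isOpen hV h

theorem mem_moderateNets_of_local {q : Net d}
    (H : ∀ K : Set (Euc d), IsCompact K → K ⊆ Ω → ∃ V : TopologicalSpace.Opens (Euc d), K ⊆ V ∧
      ∃ q' ∈ moderateNets c M V, ∀ ε, ∀ x ∈ V, q ε x = q' ε x) : q ∈ moderateNets c M Ω := by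
  refine ⟨fun ε => mem_ultraSmooth_of_local fun K hK hKΩ => ?_, fun K hK hKΩ => ?_⟩
  · obtain ⟨V, hV, q', hq', h⟩ := H K hK hKΩ
    exact ⟨V, hV, q' ε, hq'.1 ε, h ε⟩
  · obtain ⟨V, hV, q', hq', h⟩ := H K hK hKΩ
    exact (hq'.2 K hK hV).congr V.isOpen hV h

theorem mem_negligibleNets_of_local {q : Net d}
    (H : ∀ K : Set (Euc d), IsCompact K → K ⊆ Ω → ∃ V : TopologicalSpace.Opens (Euc d), K ⊆ V ∧
      ∃ q' ∈ negligibleNets c M V, ∀ ε, ∀ x ∈ V, q ε x = q' ε x) : q ∈ negligibleNets c M Ω := by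
  refine ⟨fun ε => mem_ultraSmooth_of_local fun K hK hKΩ => ?_, fun K hK hKΩ => ?_⟩
  · obtain ⟨V, hV, q', hq', h⟩ := H K hK hKΩ
    exact ⟨V, hV, q' ε, hq'.1 ε, h ε⟩
  · obtain ⟨V, hV, q', hq', h⟩ := H K hK hKΩ
    exact (hq'.2 K hK hV).congr V.isOpen hV h

theorem negligibleNets_mono {U : TopologicalSpace.Opens (Euc d)} (hU : U ≤ Ω) :
    negligibleNets c M Ω ≤ negligibleNets c M U := fun _ hq =>
  ⟨fun ε => ⟨(hq.1 ε).1.mono hU, fun K hK hKU => (hq.1 ε).2 K hK (hKU.trans hU)⟩,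
    fun K hK hKU => hq.2 K hK (hKU.trans hU)⟩

theorem DerivBound.of_inter_tsupport {h C : ℝ} {K : Set (Euc d)} {χ g : Euc d → ℂ} (hh : 0 ≤ h)
    (hC : 0 ≤ C) (hg : tsupport g ⊆ tsupport χ) (H : DerivBound M h C (K ∩ tsupport χ) g) :
    DerivBound M h C K g := fun x hx n => by
  by_cases hxg : x ∈ tsupport g
  · exact H x ⟨hx, hg hxg⟩ n
  · have : iteratedFDeriv ℝ n g x = 0 := by
      by_contra h0
      exact hxg (support_iteratedFDeriv_subset n h0)
    rw [this, norm_zero]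
    have := M.pos n
    positivity

/-- The net is controlled only on K ∩ supp χ. For the pieces of the partition of unity this is the
set where decay is available. -/
theorem NormBigO.testMul {χ : Euc d → ℂ} (hχ : ContDiff ℝ ∞ χ) {q : Net d} {K : Set (Euc d)}
    (hq : ∀ ε, ∀ x ∈ K, ContDiffAt ℝ ∞ (q ε) x) {h h₂ A : ℝ} (hh : 0 < h) (hh₂ : 0 < h₂)
    (hA : 0 ≤ A) (Hχ : DerivBound M h₂ A Set.univ χ) {b : ℝ → ℝ} (hb : ∀ ε, 0 ≤ b ε)
    (H : NormBigO M h (K ∩ tsupport χ) q b) :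
    NormBigO M (h₂ + (d + 1) * h) K (fun ε x => χ x * q ε x) b := by
  obtain ⟨C, ε₀, hC, hε₀, H⟩ := H.derivBound hh hb
  refine NormBigO.of_derivBound (by positivity) hb (mul_nonneg hA hC) hε₀ fun ε hε => ?_
  rw [mul_assoc]
  exact DerivBound.of_inter_tsupport (by positivity) (mul_nonneg hA (mul_nonneg hC (hb ε)))
    tsupport_mul_subset_left
    ((Hχ.subset (Set.subset_univ _)).mul (fun x _ => hχ.contDiffAt) (fun x hx => hq ε x hx.1)
      hh₂.le (by positivity) hA (H ε hε))

theorem mul_mem_ultraSmooth (χ : testFunctions c M Ω) {U : TopologicalSpace.Opens (Euc d)}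
    {u : Euc d → ℂ} (hu : u ∈ ultraSmooth c M U) :
    (fun x => (χ : Euc d → ℂ) x * u x) ∈ ultraSmooth c M U :=
  ⟨χ.2.1.contDiffOn.mul hu.1, fun K hK hKU => HasUltraBound.mul (fun _ _ => χ.2.1.contDiffAt)
    (contDiffAt_of_mem hu.1 hKU) (χ.2.2.2.2.subset (Set.subset_univ _)) (hu.2 K hK hKU)⟩

theorem NormBigO.subset {h : ℝ} {K K' : Set (Euc d)} {q : Net d} {b : ℝ → ℝ}
    (H : NormBigO M h K q b) (hK : K' ⊆ K) : NormBigO M h K' q b := by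
  obtain ⟨C, ε₀, h0, H⟩ := H
  exact ⟨C, ε₀, h0, fun ε hε => (biSup_mono fun _ hx => hK hx).trans (H ε hε)⟩

theorem mul_mem_moderateNets (χ : testFunctions c M Ω) {U : TopologicalSpace.Opens (Euc d)}
    {q : Net d} (hq : q ∈ moderateNets c M U) :
    (fun ε x => (χ : Euc d → ℂ) x * q ε x) ∈ moderateNets c M U := by
  refine ⟨fun ε => mul_mem_ultraSmooth χ (hq.1 ε), fun K hK hKU => ?_⟩
  have hqK : ∀ ε, ∀ x ∈ K, ContDiffAt ℝ ∞ (q ε) x := fun ε => contDiffAt_of_mem (hq.1 ε).1 hKU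
  have H := hq.2 K hK hKU
  have hχ := χ.2.2.2.2.derivBound
  have hg : ∀ k ε, 0 ≤ growth M k ε := fun _ _ => (Real.exp_pos _).le
  cases c with
  | beurling =>
    intro h hh
    obtain ⟨A, hA, hχ⟩ := hχ (h / 2) (half_pos hh)
    obtain ⟨k, hk, H⟩ := H (h / 2 / (d + 1)) (by positivity)
    refine ⟨k, hk, ?_⟩
    have := NormBigO.testMul χ.2.1 hqK (by positivity) (half_pos hh) hA hχ (hg k)
      (H.subset Set.inter_subset_left)
    rwa [mul_div_cancel₀ _ (by positivity), add_halves] at this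
  | roumieu =>
    intro k hk
    obtain ⟨h₂, hh₂, A, hA, hχ⟩ := hχ
    obtain ⟨h, hh, H⟩ := H k hk
    exact ⟨h₂ + (d + 1) * h, by positivity, NormBigO.testMul χ.2.1 hqK hh hh₂ hA hχ (hg k)
      (H.subset Set.inter_subset_left)⟩

/-- Decay is required for all h and k in both classes, which is what the estimate off the support
supplies; only the bounds of χ depend on the class. -/
theorem mul_mem_negligibleNets (χ : testFunctions c M Ω) {U : TopologicalSpace.Opens (Euc d)}
    {q : Net d} (hq : ∀ ε, q ε ∈ ultraSmooth c M U)
    (H : ∀ K : Set (Euc d), IsCompact K → K ⊆ U → ∀ h : ℝ, 0 < h → ∀ k : ℝ, 0 < k →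
      NormBigO M h (K ∩ tsupport (χ : Euc d → ℂ)) q (decay M k)) :
    (fun ε x => (χ : Euc d → ℂ) x * q ε x) ∈ negligibleNets c M U := by
  refine ⟨fun ε => mul_mem_ultraSmooth χ (hq ε), fun K hK hKU => ?_⟩
  have hqK : ∀ ε, ∀ x ∈ K, ContDiffAt ℝ ∞ (q ε) x := fun ε => contDiffAt_of_mem (hq ε).1 hKU
  have H := H K hK hKU
  have hχ := χ.2.2.2.2.derivBound
  have hg : ∀ k ε, 0 ≤ decay M k ε := fun _ _ => (Real.exp_pos _).le
  cases c with
  | beurling =>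
    intro h hh k hk
    obtain ⟨A, hA, hχ⟩ := hχ (h / 2) (half_pos hh)
    have := NormBigO.testMul χ.2.1 hqK (by positivity) (half_pos hh) hA hχ (hg k)
      (H (h / 2 / (d + 1)) (by positivity) k hk)
    rwa [mul_div_cancel₀ _ (by positivity), add_halves] at this
  | roumieu =>
    obtain ⟨h₂, hh₂, A, hA, hχ⟩ := hχ
    exact ⟨1, one_pos, h₂ + (d + 1) * 1, by positivity, NormBigO.testMul χ.2.1 hqK one_pos hh₂ hA hχ
      (hg 1) (H 1 one_pos 1 one_pos)⟩

theorem mollify_sub (φ : Mollifier N d) (θ θ' : testFunctions c M Ω) (f : Ultradistribution c M Ω) :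
    mollify φ (θ - θ') f = mollify φ θ f - mollify φ θ' f := by
  ext ε x
  simp only [mollify, Pi.sub_apply]
  rw [← map_sub]
  congr 1
  ext y
  simp [kernelTest, sub_mul]

/-- An exhaustion by relatively compact open sets. -/
theorem exists_exhaustion (Ω : TopologicalSpace.Opens (Euc d)) :
    ∃ (W : ℕ → TopologicalSpace.Opens (Euc d)) (L : ℕ → Set (Euc d)), Monotone W ∧
      (∀ n, IsCompact (L n) ∧ L n ⊆ Ω ∧ (W n : Set (Euc d)) ⊆ L n) ∧
      ∀ K : Set (Euc d), IsCompact K → K ⊆ Ω → ∃ n, K ⊆ W n := by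
  have : LocallyCompactSpace Ω := Ω.isOpen.locallyCompactSpace
  let e : CompactExhaustion Ω := CompactExhaustion.choice Ω
  refine ⟨fun n => ⟨interior (Subtype.val '' e n), isOpen_interior⟩, fun n => Subtype.val '' e n,
    fun m n hmn => interior_mono (Set.image_mono (e.subset hmn)),
    fun n => ⟨(e.isCompact n).image continuous_subtype_val,
      by rintro _ ⟨x, _, rfl⟩; exact x.2, interior_subset⟩,
    fun K hK hKΩ => ?_⟩
  have hK' : IsCompact (Subtype.val ⁻¹' K : Set Ω) :=
    Ω.isOpen.isOpenEmbedding_subtypeVal.isInducing.isCompact_preimage' hK (by simpa using hKΩ)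
  obtain ⟨n, hn⟩ := e.exists_superset_of_isCompact hK'
  refine ⟨n + 1, fun x hx => ?_⟩
  refine interior_maximal (s := Subtype.val '' e (n + 1)) (t := Subtype.val '' interior (e (n + 1)))
    (Set.image_mono interior_subset)
    (Ω.isOpen.isOpenEmbedding_subtypeVal.isOpenMap _ isOpen_interior) ?_
  exact ⟨⟨x, hKΩ hx⟩, e.subset_interior_succ n (hn hx), rfl⟩

end

/-! ### Existence and uniqueness of the image -/

section

variable {c : UltraClass} {M N : WeightSequence} {Ω : TopologicalSpace.Opens (Euc d)}

/-- The net Σ χ_n ((η_n f) * φ_ε) is formed with a partition of unity χ_n and cut-offs η_n equal to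
1 near supp χ_n. -/
theorem exists_isImage (hM : M.ModerateGrowth)
    (hMN : ∀ l : ℝ, 0 < l → ∃ C : ℝ, 0 < C ∧ ∀ t : ℝ, 0 ≤ t → 2 * M.assoc t ≤ N.assoc (l * t) + C)
    (φ : Mollifier N d) (f : Ultradistribution c M Ω) : ∃ g : GenFun c M Ω, IsImage φ f g := by
  obtain ⟨W, L, hWm, hL, hWe⟩ := exists_exhaustion Ω
  choose θ V hLV hVΩ hθ using fun n => exists_cutoff hMN φ c (hL n).1 (hL n).2.1
  have hθW : ∀ m n, m ≤ n → ∀ x ∈ W m, (θ n : Euc d → ℂ) x = 1 := fun m n hmn x hx =>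
    hθ n x (hLV n ((hL n).2.2 (hWm hmn hx)))
  -- Differences of successive cut-offs: the sums telescope to θ_m, and χ_n vanishes on W_m for n >
  -- m.
  let χ : ℕ → testFunctions c M Ω := fun n => Nat.casesOn n (θ 0) fun k => θ (k + 1) - θ k
  have hsum : ∀ m, ∑ n ∈ Finset.range (m + 1), χ n = θ m := by
    intro m
    induction m with
    | zero => simp [χ]
    | succ m ih => rw [Finset.sum_range_succ, ih]; simp [χ]
  have hsum' : ∀ m : ℕ, ∀ x ∈ W m, ∑ n ∈ Finset.range (m + 1), (χ n).1 x = 1 := by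
    intro m x hx
    rw [← hθW m m le_rfl x hx, ← hsum m]
    simp
  have hχ0 : ∀ m n : ℕ, m < n → ∀ x ∈ W m, (χ n).1 x = 0 := by
    rintro m (_ | k) hmn x hx
    · omega
    · simp [χ, hθW m (k + 1) (by omega) x hx, hθW m k (by omega) x hx]
  choose η Y hχY hYΩ hη using fun n => exists_cutoff hMN φ c (χ n).2.2.1 (χ n).2.2.2.1
  let r : Net d := fun ε x => ∑' n, (χ n).1 x * mollify φ (η n) f ε x
  have hr : ∀ m ε, ∀ x ∈ W m, r ε x =
      ∑ n ∈ Finset.range (m + 1), (χ n).1 x * mollify φ (η n) f ε x := by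
    intro m ε x hx
    refine tsum_eq_sum fun n hn => ?_
    rw [hχ0 m n (by simpa using hn) x hx, zero_mul]
  have hrm : r ∈ moderateNets c M Ω := by
    refine mem_moderateNets_of_local fun K hK hKΩ => ?_
    obtain ⟨m, hm⟩ := hWe K hK hKΩ
    refine ⟨W m, hm, ∑ n ∈ Finset.range (m + 1),
      fun ε x => (χ n).1 x * mollify φ (η n) f ε x, sum_mem fun n _ =>
        mul_mem_moderateNets (χ n) (mollify_mem_moderateNets hM φ (η n) f _), fun ε x hx => ?_⟩
    rw [hr m ε x hx]
    simp [Finset.sum_apply]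
  refine ⟨GenFun.mk ⟨r, hrm⟩, ⟨r, hrm⟩, rfl, fun U θ' hU hθ' => ?_⟩
  refine mem_negligibleNets_of_local fun K hK hKU => ?_
  obtain ⟨m, hm⟩ := hWe K hK (hKU.trans hU)
  -- On W_m ∩ U the finitely many χ_n sum to 1, so the difference is Σ χ_n (((η_n - θ')f) * φ_ε).
  -- The cut-off η_n - θ' vanishes on Y_n ∩ U, which contains the relevant part of supp χ_n.
  refine ⟨W m ⊓ U, fun x hx => ⟨hm hx, hKU hx⟩, ∑ n ∈ Finset.range (m + 1),
      fun ε x => (χ n).1 x * mollify φ (η n - θ') f ε x, sum_mem fun n _ =>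
        mul_mem_negligibleNets (χ n)
          (fun ε => (mollify_mem_moderateNets hM φ (η n - θ') f _).1 ε) ?_, fun ε x hx => ?_⟩
  · intro K' hK' hK'U h hh k hk
    refine normBigO_mollify_decay hM hMN φ (η n - θ') f (U := (Y n : Set (Euc d)) ∩ U)
      ((Y n).isOpen.inter U.isOpen) (fun x hx => ?_)
      (hK'.inter_right (isClosed_tsupport _)) (fun x hx => ⟨hχY n hx.2, (hK'U hx.1).2⟩) hh hk
    simp [hη n x hx.1, hθ' x hx.2]
  · have h1 := hsum' m x hx.1
    simp only [Pi.sub_apply, Finset.sum_apply, mollify_sub, mul_sub, Finset.sum_sub_distrib]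
    rw [hr m ε x hx.1, ← Finset.sum_mul, h1, one_mul]

theorem GenFun.mk_eq_mk_iff {r r' : moderateNets c M Ω} :
    GenFun.mk r = GenFun.mk r' ↔ (r : Net d) - r' ∈ negligibleNets c M Ω := by
  exact Submodule.Quotient.eq _

/-- Near each compact set a cut-off equal to 1 exists, and both representatives differ there from
the same mollified net by negligible nets. -/
theorem IsImage.unique
    (hMN : ∀ l : ℝ, 0 < l → ∃ C : ℝ, 0 < C ∧ ∀ t : ℝ, 0 ≤ t → 2 * M.assoc t ≤ N.assoc (l * t) + C)
    {φ : Mollifier N d} {f : Ultradistribution c M Ω} {g g' : GenFun c M Ω}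
    (h : IsImage φ f g) (h' : IsImage φ f g') : g = g' := by
  obtain ⟨r, rfl, hr⟩ := h
  obtain ⟨r', rfl, hr'⟩ := h'
  rw [GenFun.mk_eq_mk_iff]
  refine mem_negligibleNets_of_local fun K hK hKΩ => ?_
  obtain ⟨θ, V, hKV, hVΩ, hθ⟩ := exists_cutoff hMN φ c hK hKΩ
  refine ⟨V, hKV, (r : Net d) - r', ?_, fun _ _ _ => rfl⟩
  have := sub_mem (hr V θ hVΩ hθ) (hr' V θ hVΩ hθ)
  rwa [sub_sub_sub_cancel_right] at this

theorem isImage_iff (hM : M.ModerateGrowth)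
    (hMN : ∀ l : ℝ, 0 < l → ∃ C : ℝ, 0 < C ∧ ∀ t : ℝ, 0 ≤ t → 2 * M.assoc t ≤ N.assoc (l * t) + C)
    (φ : Mollifier N d) (f : Ultradistribution c M Ω) (g : GenFun c M Ω) :
    IsImage φ f g ↔ g = embedding φ f := by
  have h : IsImage φ f (embedding φ f) := Classical.epsilon_spec (exists_isImage hM hMN φ f)
  exact ⟨fun hg => hg.unique hMN h, fun hg => hg ▸ h⟩

end

/-! ### Rapidly decaying symbols and the image of ultradifferentiable functions -/

section

variable {c : UltraClass} {M N : WeightSequence} {Ω : TopologicalSpace.Opens (Euc d)}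

/-- The decay which characterizes the Fourier transforms of the functions of `D^*`. -/
def HasDecay (c : UltraClass) (M : WeightSequence) (a : Euc d → ℂ) : Prop :=
  match c with
  | .beurling => ∀ κ : ℝ, 0 < κ → ∃ C : ℝ, 0 ≤ C ∧
      ∀ ζ, ‖a ζ‖ ≤ C * Real.exp (-M.assoc (κ * (2 * Real.pi * ‖ζ‖)))
  | .roumieu => ∃ κ : ℝ, 0 < κ ∧ ∃ C : ℝ, 0 ≤ C ∧
      ∀ ζ, ‖a ζ‖ ≤ C * Real.exp (-M.assoc (κ * (2 * Real.pi * ‖ζ‖)))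

theorem HasDecay.exists_le {a : Euc d → ℂ} (H : HasDecay c M a) : ∃ κ : ℝ, 0 < κ ∧ ∃ C : ℝ, 0 ≤ C ∧
    ∀ ζ, ‖a ζ‖ ≤ C * Real.exp (-M.assoc (κ * (2 * Real.pi * ‖ζ‖))) := by
  cases c with
  | beurling => exact ⟨1, one_pos, H 1 one_pos⟩
  | roumieu => exact H

theorem HasDecay.integrable {a : Euc d → ℂ} (H : HasDecay c M a) (ha : AEStronglyMeasurable a) :
    Integrable a := by
  obtain ⟨κ, hκ, C, hC, H⟩ := H.exists_le
  exact integrable_of_decay ha hκ hC H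

theorem HasDecay.mul_bounded {a b : Euc d → ℂ} (H : HasDecay c M a) {D : ℝ} (hD : 0 ≤ D)
    (hb : ∀ ζ, ‖b ζ‖ ≤ D) : HasDecay c M fun ζ => b ζ * a ζ := by
  have key : ∀ (κ C : ℝ) (ζ : Euc d), ‖a ζ‖ ≤ C * Real.exp (-M.assoc (κ * (2 * Real.pi * ‖ζ‖))) →
      ‖b ζ * a ζ‖ ≤ D * C * Real.exp (-M.assoc (κ * (2 * Real.pi * ‖ζ‖))) := fun κ C ζ h => by
    rw [norm_mul, mul_assoc]
    exact mul_le_mul (hb ζ) h (norm_nonneg _) hD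
  cases c with
  | beurling =>
    intro κ hκ
    obtain ⟨C, hC, H⟩ := H κ hκ
    exact ⟨D * C, by positivity, fun ζ => key κ C ζ (H ζ)⟩
  | roumieu =>
    obtain ⟨κ, hκ, C, hC, H⟩ := H
    exact ⟨κ, hκ, D * C, by positivity, fun ζ => key κ C ζ (H ζ)⟩

theorem hasDecay_fourier (v : testFunctions c M Ω) : HasDecay c M (𝓕 (v : Euc d → ℂ)) := by
  have key : ∀ h C : ℝ, 0 < h → 0 ≤ C → DerivBound M h C Set.univ (v : Euc d → ℂ) →
      ∃ C' : ℝ, 0 ≤ C' ∧ ∀ ζ, ‖𝓕 (v : Euc d → ℂ) ζ‖ ≤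
        C' * Real.exp (-M.assoc (h⁻¹ * (2 * Real.pi * ‖ζ‖))) := fun h C hh hC H =>
    ⟨C * volume.real (tsupport (v : Euc d → ℂ)), by positivity, fun ζ => by
      rw [inv_mul_eq_div]
      exact norm_fourier_le v.2.1 v.2.2.1 v.2.2.1 le_rfl hh hC (H.subset (Set.subset_univ _)) ζ⟩
  have hv := v.2.2.2.2.derivBound
  cases c with
  | beurling =>
    intro κ hκ
    obtain ⟨C, hC, H⟩ := hv κ⁻¹ (inv_pos.2 hκ)
    simpa using key _ C (inv_pos.2 hκ) hC H
  | roumieu =>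
    obtain ⟨h, hh, C, hC, H⟩ := hv
    exact ⟨h⁻¹, inv_pos.2 hh, key h C hh hC H⟩

theorem hasDecay_fourierInv (v : testFunctions c M Ω) : HasDecay c M (𝓕⁻ (v : Euc d → ℂ)) := by
  have h := hasDecay_fourier v
  have e : ∀ ζ, 𝓕⁻ (v : Euc d → ℂ) ζ = 𝓕 (v : Euc d → ℂ) (-ζ) :=
    fun ζ => Real.fourierInv_eq_fourier_neg _ _
  cases c with
  | beurling =>
    intro κ hκ
    obtain ⟨C, hC, H⟩ := h κ hκ
    exact ⟨C, hC, fun ζ => by rw [e]; simpa using H (-ζ)⟩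
  | roumieu =>
    obtain ⟨κ, hκ, C, hC, H⟩ := h
    exact ⟨κ, hκ, C, hC, fun ζ => by rw [e]; simpa using H (-ζ)⟩

theorem integrable_test (v : testFunctions c M Ω) : Integrable (v : Euc d → ℂ) :=
  v.2.1.continuous.integrable_of_hasCompactSupport v.2.2.1

theorem continuous_fourier_test (v : testFunctions c M Ω) : Continuous (𝓕 (v : Euc d → ℂ)) :=
  VectorFourier.fourierIntegral_continuous Real.continuous_fourierChar continuous_inner
    (integrable_test v)

theorem continuous_fourierInv_test (v : testFunctions c M Ω) :
    Continuous (𝓕⁻ (v : Euc d → ℂ)) := by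
  have : 𝓕⁻ (v : Euc d → ℂ) = fun ζ => 𝓕 (v : Euc d → ℂ) (-ζ) :=
    funext fun ζ => Real.fourierInv_eq_fourier_neg _ _
  rw [this]
  exact (continuous_fourier_test v).comp continuous_neg

theorem fourier_fourierInv_test (v : testFunctions c M Ω) :
    𝓕 (𝓕⁻ (v : Euc d → ℂ)) = v :=
  v.2.1.continuous.fourier_fourierInv_eq (integrable_test v)
    ((hasDecay_fourier v).integrable (continuous_fourier_test v).aestronglyMeasurable)

theorem fourierInv_fourier_test (v : testFunctions c M Ω) :
    𝓕⁻ (𝓕 (v : Euc d → ℂ)) = v :=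
  v.2.1.continuous.fourierInv_fourier_eq (integrable_test v)
    ((hasDecay_fourier v).integrable (continuous_fourier_test v).aestronglyMeasurable)

theorem HasDecay.contDiff_fourier (hM : M.ModerateGrowth) {a : Euc d → ℂ} (H : HasDecay c M a)
    (ha : AEStronglyMeasurable a) : ContDiff ℝ ∞ (𝓕 a) := by
  obtain ⟨A, L, hA, hL, -, hAL⟩ := hM.exp_neg_le
  obtain ⟨κ, hκ, C, hC, H⟩ := H.exists_le
  obtain ⟨D, hD, key⟩ := derivBound_fourier_of_decay (d := d) (by positivity) (by positivity) hAL hκ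
  -- With r = 0 the vanishing condition on the ball is void.
  exact (key a C 0 ha hC le_rfl H fun ζ hζ => absurd hζ (not_lt.2 (by positivity))).1

theorem HasDecay.hasUltraBound_fourier (hM : M.ModerateGrowth) {a : Euc d → ℂ}
    (H : HasDecay c M a) (ha : AEStronglyMeasurable a) (K : Set (Euc d)) :
    HasUltraBound c M K (𝓕 a) := by
  obtain ⟨A, L, hA, hL, -, hAL⟩ := hM.exp_neg_le
  have key : ∀ κ C : ℝ, 0 < κ → 0 ≤ C →
      (∀ ζ, ‖a ζ‖ ≤ C * Real.exp (-M.assoc (κ * (2 * Real.pi * ‖ζ‖)))) →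
      ∃ D : ℝ, 0 ≤ D ∧ DerivBound M (L / κ) D K (𝓕 a) := fun κ C hκ hC H => by
    obtain ⟨D, hD, key⟩ := derivBound_fourier_of_decay (d := d) (by positivity) (by positivity)
      hAL hκ
    exact ⟨_, by positivity, (key a C 0 ha hC le_rfl H
      fun ζ hζ => absurd hζ (not_lt.2 (by positivity))).2.subset (Set.subset_univ _)⟩
  refine HasUltraBound.of_derivBound ?_
  cases c with
  | beurling =>
    intro h hh
    obtain ⟨C, hC, H⟩ := H (L / h) (by positivity)
    have := key _ C (by positivity) hC H
    rwa [div_div_cancel₀ (by positivity)] at this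
  | roumieu =>
    obtain ⟨κ, hκ, C, hC, H⟩ := H
    exact ⟨L / κ, by positivity, key κ C hκ hC H⟩

/-- Removing the low frequencies from a rapidly decaying symbol gives a negligible net. -/
theorem HasDecay.negligibleOn (hM : M.ModerateGrowth) (φ : Mollifier N d) {a : Euc d → ℂ}
    (H : HasDecay c M a) (ha : AEStronglyMeasurable a) (K : Set (Euc d)) :
    NegligibleOn c M K fun ε => 𝓕 fun ζ => (1 - φ.symbol ε ζ) * a ζ := by
  obtain ⟨A, L, hA, hL, -, hAL⟩ := hM.exp_neg_le
  obtain ⟨B, hB, hφ⟩ := φ.exists_norm_symbol_le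
  have key : ∀ κ C : ℝ, 0 < κ → 0 ≤ C →
      (∀ ζ, ‖a ζ‖ ≤ C * Real.exp (-M.assoc (κ * (2 * Real.pi * ‖ζ‖)))) →
      NormBigO M (L / κ) K (fun ε => 𝓕 fun ζ => (1 - φ.symbol ε ζ) * a ζ) (decay M (κ / L)) :=
    fun κ C hκ hC H => by
    obtain ⟨D, hD, key⟩ := derivBound_fourier_of_decay (d := d) (by positivity) (by positivity)
      hAL hκ
    refine NormBigO.of_derivBound (C := (1 + B) * C * D) (by positivity)
      (fun _ => (Real.exp_pos _).le) (by positivity) one_pos fun ε _ => ?_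
    have hε := ε.2.1
    -- The factor 1 minus the symbol vanishes for 2π|ζ| ≤ 1/ε, so the estimate applies with r = 1/ε.
    have e : decay M (κ / L) ε = Real.exp (-M.assoc (κ * (1 / ε) / L)) := by
      rw [decay]; congr 3; field_simp
    rw [e]
    refine (key _ _ (1 / ε) ?_ (by positivity) (by positivity) (fun ζ => ?_) fun ζ hζ => ?_).2.subset
      (Set.subset_univ _)
    · exact ((continuous_const.sub φ.continuous_symbol).aestronglyMeasurable).mul ha
    · rw [norm_mul, mul_assoc]
      refine mul_le_mul ((norm_sub_le _ _).trans ?_) (H ζ) (norm_nonneg _) (by positivity)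
      rw [norm_one]
      gcongr
      exact hφ ε ζ
    · rw [φ.symbol_eq_one hε hζ.le, sub_self, zero_mul]
  cases c with
  | beurling =>
    intro h hh k hk
    -- A rate κ at least L/h and kL makes L/κ ≤ h and k ≤ κ/L.
    have hm : 0 < max (L / h) (k * L) := lt_max_of_lt_left (by positivity)
    obtain ⟨C, hC, H⟩ := H (max (L / h) (k * L)) hm
    refine (key _ C hm hC H).weaken (by positivity) ?_ (decay_anti M hk ?_)
    · rw [div_le_iff₀ hm, ← div_le_iff₀' hh]
      exact le_max_left _ _
    · rw [le_div_iff₀ (by positivity)]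
      exact le_max_right _ _
  | roumieu =>
    obtain ⟨κ, hκ, C, hC, H⟩ := H
    exact ⟨κ / L, by positivity, L / κ, by positivity, key κ C hκ hC H⟩

theorem fourier_sub_apply {a b : Euc d → ℂ} (ha : Integrable a) (hb : Integrable b) (x : Euc d) :
    𝓕 (fun ζ => a ζ - b ζ) x = 𝓕 a x - 𝓕 b x := by
  simp only [Real.fourier_eq, smul_sub]
  exact integral_sub ((Real.fourierIntegral_convergent_iff x).2 ha)
    ((Real.fourierIntegral_convergent_iff x).2 hb)

/-- The product of a cut-off and an ultradifferentiable function, as a test function. -/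
noncomputable def cutoffMul (θ : testFunctions c M Ω) (u : ultraSmooth c M Ω) :
    testFunctions c M Ω :=
  ⟨fun y => (θ : Euc d → ℂ) y * (u : Euc d → ℂ) y,
    mul_mem_testFunctions' θ θ.2.2.2.1 (contDiffAt_of_mem u.2.1 θ.2.2.2.1)
      (u.2.2 _ θ.2.2.1 θ.2.2.2.1)⟩

theorem ofUltraSmooth_apply (u : ultraSmooth c M Ω) (ψ : testFunctions c M Ω) :
    (ofUltraSmooth u).1 ψ = ∫ x, (u : Euc d → ℂ) x * (ψ : Euc d → ℂ) x := by
  refine setIntegral_eq_integral_of_forall_compl_eq_zero fun x hx => ?_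
  rw [image_eq_zero_of_notMem_tsupport fun h => hx (ψ.2.2.2.1 h), mul_zero]

/-- The characters carry the sign e^{+2πi}, whence the inverse transform. Applying `𝓕` to the local
Fourier transform then returns θu. -/
theorem localFourier_ofUltraSmooth (u : ultraSmooth c M Ω) (θ : testFunctions c M Ω) :
    localFourier (ofUltraSmooth u) θ = 𝓕⁻ (cutoffMul θ u : Euc d → ℂ) := by
  ext ζ
  rw [localFourier, ofUltraSmooth_apply, fourierInv_eq_expFun]
  refine integral_congr_ae (Filter.Eventually.of_forall fun x => ?_)
  simp only [expTest, cutoffMul, expFun_comm ζ x]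
  ring

theorem const_mem_regularNets (u : ultraSmooth c M Ω) :
    (fun _ => (u : Euc d → ℂ)) ∈ regularNets c M Ω := by
  refine ⟨fun _ => u.2, fun K hK hKΩ => ?_⟩
  have h := u.2.2 K hK hKΩ
  have key : ∀ h k : ℝ, ultraNorm M h K (u : Euc d → ℂ) < ⊤ → 0 < k →
      NormBigO M h K (fun _ => (u : Euc d → ℂ)) (growth M k) := fun h k H hk =>
    ⟨(ultraNorm M h K (u : Euc d → ℂ)).toNNReal, 1, one_pos, fun ε _ => by
      rw [ENNReal.coe_toNNReal H.ne]
      have hε := ε.2.1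
      refine le_mul_of_one_le_right zero_le ?_
      rw [← ENNReal.ofReal_one]
      exact ENNReal.ofReal_le_ofReal (M.one_le_exp_assoc (by positivity))⟩
  cases c with
  | beurling => exact ⟨1, one_pos, fun h' hh' => key h' 1 (h h' hh') one_pos⟩
  | roumieu =>
    obtain ⟨h, hh, H⟩ := h
    exact ⟨h, hh, fun k hk => key h k H hk⟩

/-- On U one has u = θu, and θu - (θu) * φ_ε is the Fourier transform of a rapidly decaying symbol
from which the frequencies below 1/ε have been removed. -/
theorem isImage_ofUltraSmooth (hM : M.ModerateGrowth) (φ : Mollifier N d)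
    (u : ultraSmooth c M Ω) : IsImage φ (ofUltraSmooth u)
      (GenFun.mk ⟨fun _ => (u : Euc d → ℂ), regularNets_le c M Ω (const_mem_regularNets u)⟩) := by
  refine ⟨_, rfl, fun U θ hU hθ => ⟨fun ε => ?_, fun K hK hKU => ?_⟩⟩
  · refine sub_mem (?_ : (u : Euc d → ℂ) ∈ ultraSmooth c M U)
      ((mollify_mem_moderateNets hM φ θ _ U).1 ε)
    exact ⟨u.2.1.mono hU, fun K hK hKU => u.2.2 K hK (hKU.trans hU)⟩
  · have hdec := hasDecay_fourierInv (cutoffMul θ u)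
    have hm := (continuous_fourierInv_test (cutoffMul θ u)).aestronglyMeasurable (μ := volume)
    refine NegligibleOn.congr U.isOpen hKU (fun ε x hx => ?_) (hdec.negligibleOn hM φ hm K)
    obtain ⟨B, hB, hφ⟩ := φ.exists_norm_symbol_le
    have hI := (hdec.mul_bounded (by positivity) (hφ ε)).integrable
      (φ.continuous_symbol.aestronglyMeasurable.mul hm)
    simp only [sub_mul, one_mul]
    rw [fourier_sub_apply (hdec.integrable hm) hI, fourier_fourierInv_test, Pi.sub_apply,
      mollify_eq_fourier, localFourier_ofUltraSmooth, Pi.sub_apply]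
    simp [cutoffMul, hθ x hx]

theorem embedding_ofUltraSmooth_mem (hM : M.ModerateGrowth)
    (hMN : ∀ l : ℝ, 0 < l → ∃ C : ℝ, 0 < C ∧ ∀ t : ℝ, 0 ≤ t → 2 * M.assoc t ≤ N.assoc (l * t) + C)
    (φ : Mollifier N d) (u : ultraSmooth c M Ω) :
    embedding φ (ofUltraSmooth u) ∈ regularGenFun c M Ω := by
  rw [← (isImage_iff hM hMN φ _ _).1 (isImage_ofUltraSmooth hM φ u)]
  exact Submodule.mem_map_of_mem (const_mem_regularNets u)

end

/-! ### Decay of the local Fourier transforms of regular ultradistributions -/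

section

variable {c : UltraClass} {M N : WeightSequence} {Ω : TopologicalSpace.Opens (Euc d)}

theorem integral_fourier_mul {a b : Euc d → ℂ} (ha : Integrable a) (hb : Integrable b) :
    ∫ ξ, 𝓕 a ξ * b ξ = ∫ x, a x * 𝓕 b x := by
  have := VectorFourier.integral_fourierIntegral_smul_eq_flip (L := innerₗ (Euc d))
    Real.continuous_fourierChar continuous_inner ha hb
  rw [flip_innerₗ] at this
  exact this

/-- The weight `e^{-M}` absorbs one factor `e^{M}`. -/
theorem exp_neg_mul_exp_le {A H : ℝ} (hA : 0 ≤ A)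
    (hAH : ∀ t : ℝ, 0 ≤ t → Real.exp (-M.assoc (H * t)) ≤ A * Real.exp (-M.assoc t) ^ 4)
    {t : ℝ} (ht : 0 ≤ t) :
    Real.exp (-M.assoc (H * t)) * Real.exp (M.assoc t) ≤ A * Real.exp (-M.assoc t) ^ 2 := by
  have h1 : Real.exp (-M.assoc t) * Real.exp (M.assoc t) = 1 := by
    rw [← Real.exp_add, neg_add_cancel, Real.exp_zero]
  have h2 := M.exp_neg_assoc_le_one ht
  have h3 := Real.exp_pos (-M.assoc t)
  calc Real.exp (-M.assoc (H * t)) * Real.exp (M.assoc t)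
      ≤ A * Real.exp (-M.assoc t) ^ 4 * Real.exp (M.assoc t) := by gcongr; exact hAH t ht
    _ = A * Real.exp (-M.assoc t) ^ 3 * (Real.exp (-M.assoc t) * Real.exp (M.assoc t)) := by ring
    _ = A * Real.exp (-M.assoc t) ^ 3 := by rw [h1, mul_one]
    _ ≤ A * Real.exp (-M.assoc t) ^ 2 :=
      mul_le_mul_of_nonneg_left (pow_le_pow_of_le_one h3.le h2 (by norm_num)) hA

/-- Rapidly decaying symbols can be paired with the local Fourier transforms. -/
theorem HasDecay.exists_testBound (hM : M.ModerateGrowth) {a : Euc d → ℂ} (h : HasDecay c M a)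
    (f : Ultradistribution c M Ω) (θ : testFunctions c M Ω) : ∃ s : ℝ, 0 < s ∧ ∃ B : ℝ, 0 ≤ B ∧
      TestBound f θ s B ∧ ∃ w : Euc d → ℝ, Integrable w ∧
        ∀ ζ, ‖a ζ‖ * Real.exp (M.assoc (2 * Real.pi * ‖ζ‖ / s)) ≤ w ζ := by
  obtain ⟨A, L, hA, hL, -, hAL⟩ := hM.exp_neg_le
  have hL0 : 0 < L := by linarith
  have key : ∀ s C : ℝ, 0 < s → 0 ≤ C →
      (∀ ζ, ‖a ζ‖ ≤ C * Real.exp (-M.assoc (L / s * (2 * Real.pi * ‖ζ‖)))) →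
      ∃ w : Euc d → ℝ, Integrable w ∧
        ∀ ζ, ‖a ζ‖ * Real.exp (M.assoc (2 * Real.pi * ‖ζ‖ / s)) ≤ w ζ := by
    intro s C hs hC ha
    obtain ⟨D, hD, hw⟩ := exp_neg_assoc_le_polyWeight (d := d) M (q := 2 * Real.pi / s)
      (by positivity)
    refine ⟨fun ζ => C * A * D * polyWeight ζ, integrable_polyWeight.const_mul _, fun ζ => ?_⟩
    have ht : 0 ≤ 2 * Real.pi * ‖ζ‖ / s := by positivity
    have e : L / s * (2 * Real.pi * ‖ζ‖) = L * (2 * Real.pi * ‖ζ‖ / s) := by ring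
    have h1 := ha ζ
    have h2 := hw ζ
    rw [e] at h1
    rw [div_mul_eq_mul_div] at h2
    calc ‖a ζ‖ * Real.exp (M.assoc (2 * Real.pi * ‖ζ‖ / s))
        ≤ C * Real.exp (-M.assoc (L * (2 * Real.pi * ‖ζ‖ / s))) *
            Real.exp (M.assoc (2 * Real.pi * ‖ζ‖ / s)) := by gcongr
      _ ≤ C * (A * Real.exp (-M.assoc (2 * Real.pi * ‖ζ‖ / s)) ^ 2) := by
          rw [mul_assoc]
          exact mul_le_mul_of_nonneg_left (exp_neg_mul_exp_le (by linarith) hAL ht) hC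
      _ ≤ C * (A * (D * polyWeight ζ)) := by
          gcongr
          exact (pow_le_of_le_one (Real.exp_pos _).le (M.exp_neg_assoc_le_one ht)
            two_ne_zero).trans h2
      _ = C * A * D * polyWeight ζ := by ring
  -- In the Beurling case f fixes s and the decay rate of a is free; in the Roumieu case the rate κ
  -- is fixed and s = L/κ may be chosen.
  have hf := UltraAlg.exists_testBound f θ
  cases c with
  | beurling =>
    obtain ⟨s, hs, B, hB, hf⟩ := hf
    obtain ⟨C, hC, ha⟩ := h (L / s) (by positivity)
    exact ⟨s, hs, B, hB, hf, key s C hs hC ha⟩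
  | roumieu =>
    obtain ⟨κ, hκ, C, hC, ha⟩ := h
    have hs : 0 < L / κ := by positivity
    obtain ⟨B, hB, hf⟩ := hf _ hs
    refine ⟨L / κ, hs, B, hB, hf, key _ C hs hC ?_⟩
    rwa [div_div_cancel₀ hL0.ne']

theorem HasDecay.integrable_mul_localFourier (hM : M.ModerateGrowth) {a : Euc d → ℂ}
    (h : HasDecay c M a) (ha : AEStronglyMeasurable a) (f : Ultradistribution c M Ω)
    (θ : testFunctions c M Ω) : Integrable fun ζ => a ζ * localFourier f θ ζ := by
  obtain ⟨s, hs, B, hB, hf, w, hw, haw⟩ := h.exists_testBound hM f θ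
  refine (hw.const_mul B).mono'
    (ha.mul (continuous_localFourier f θ).aestronglyMeasurable) (Filter.Eventually.of_forall
      fun ζ => ?_)
  rw [norm_mul]
  calc ‖a ζ‖ * ‖localFourier f θ ζ‖
      ≤ ‖a ζ‖ * (B * Real.exp (M.assoc (2 * Real.pi * ‖ζ‖ / s))) := by
        gcongr; exact hf.norm_localFourier_le hs ζ
    _ = B * (‖a ζ‖ * Real.exp (M.assoc (2 * Real.pi * ‖ζ‖ / s))) := by ring
    _ ≤ B * w ζ := by gcongr; exact haw ζ

/-- A Parseval formula: since θ = 1 on supp ψ, ψ equals θ times the inverse transform of its own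
transform. -/
theorem apply_eq_integral (hM : M.ModerateGrowth) (f : Ultradistribution c M Ω)
    (θ ψ : testFunctions c M Ω)
    (hθ : ∀ x ∈ tsupport (ψ : Euc d → ℂ), (θ : Euc d → ℂ) x = 1) :
    f.1 ψ = ∫ ζ, 𝓕 (ψ : Euc d → ℂ) ζ * localFourier f θ ζ := by
  obtain ⟨s, hs, B, hB, hf, w, hw, haw⟩ := (hasDecay_fourier ψ).exists_testBound hM f θ
  refine hf.apply_fourierInv hs (continuous_fourier_test ψ).aestronglyMeasurable hw haw ψ fun y => ?_
  rw [fourierInv_fourier_test]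
  by_cases hy : y ∈ tsupport (ψ : Euc d → ℂ)
  · rw [hθ y hy, one_mul]
  · rw [image_eq_zero_of_notMem_tsupport hy, mul_zero]

theorem fourier_expTest (χ : testFunctions c M Ω) (ξ η : Euc d) :
    𝓕 (expTest χ ξ : Euc d → ℂ) η = 𝓕 (χ : Euc d → ℂ) (η - ξ) := by
  simp only [fourier_eq_expFun, expTest]
  refine integral_congr_ae (Filter.Eventually.of_forall fun y => ?_)
  simp only
  rw [neg_sub, sub_eq_add_neg, expFun_add_right, expFun_comm ξ y, mul_assoc]

theorem integrable_symbol_mul (φ : Mollifier N d) (ε : Set.Ioc (0 : ℝ) 1)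
    (f : Ultradistribution c M Ω) (θ : testFunctions c M Ω) :
    Integrable fun ζ => φ.symbol ε ζ * localFourier f θ ζ :=
  (φ.continuous_symbol.mul (continuous_localFourier f θ)).integrable_of_hasCompactSupport
    (φ.hasCompactSupport_symbol ε.2.1).mul_right

/-- The low-frequency part of the local Fourier transform comes from the mollified net. -/
theorem integral_symbol_mul (φ : Mollifier N d) (ε : Set.Ioc (0 : ℝ) 1)
    (f : Ultradistribution c M Ω) (θ χ : testFunctions c M Ω) (ξ : Euc d) :
    ∫ ζ, 𝓕 (expTest χ ξ : Euc d → ℂ) ζ * (φ.symbol ε ζ * localFourier f θ ζ) =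
      𝓕 (fun x => (χ : Euc d → ℂ) x * mollify φ θ f ε x) (-ξ) := by
  rw [integral_fourier_mul (integrable_test _) (integrable_symbol_mul φ ε f θ),
    ← mollify_eq_fourier, fourier_eq_expFun]
  refine integral_congr_ae (Filter.Eventually.of_forall fun y => ?_)
  simp only [expTest]
  rw [neg_neg, expFun_comm ξ y]
  ring

/-- The mollification parameter is tied to the frequency. The mollified net supplies the low
frequencies; the high ones are far from ξ, where the transform of χ beats the growth of the
transform of θf. -/
theorem localFourier_decay_aux (hM : M.ModerateGrowth) {A H : ℝ} (hA : 0 ≤ A) (hH : 0 < H)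
    (hAH : ∀ t : ℝ, 0 ≤ t → Real.exp (-M.assoc (H * t)) ≤ A * Real.exp (-M.assoc t) ^ 4)
    (φ : Mollifier N d) (f : Ultradistribution c M Ω) (θ χ : testFunctions c M Ω)
    (hθ : ∀ x ∈ tsupport (χ : Euc d → ℂ), (θ : Euc d → ℂ) x = 1)
    {κ k h C₁ C₂ B ε₀ : ℝ} (hκ : 0 < κ) (hk : 0 < k) (hh : 0 < h) (hkκ : 2 * k ≤ κ)
    (hhκ : H * κ * h ≤ 1) (hC₁ : 0 ≤ C₁) (hC₂ : 0 ≤ C₂) (hB : 0 ≤ B) (hε₀ : 0 < ε₀)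
    (H₁ : ∀ ε : Set.Ioc (0 : ℝ) 1, (ε : ℝ) < ε₀ → DerivBound M h (C₁ * growth M k ε)
      (tsupport (χ : Euc d → ℂ)) fun x => (χ : Euc d → ℂ) x * mollify φ θ f ε x)
    (H₂ : ∀ ζ, ‖𝓕 (χ : Euc d → ℂ) ζ‖ ≤
      C₂ * Real.exp (-M.assoc (2 * H * κ * (2 * Real.pi * ‖ζ‖))))
    (H₃ : ∀ ζ, ‖localFourier f θ ζ‖ ≤ B * Real.exp (M.assoc (κ * (2 * Real.pi * ‖ζ‖)))) :
    ∃ C R : ℝ, 0 ≤ C ∧ 0 ≤ R ∧ ∀ ξ, R ≤ ‖ξ‖ →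
      ‖localFourier f χ ξ‖ ≤ C * Real.exp (-M.assoc (κ * (2 * Real.pi * ‖ξ‖))) := by
  obtain ⟨D, hD, hw⟩ := exp_neg_assoc_le_polyWeight (d := d) M (q := κ * (2 * Real.pi))
    (by positivity)
  obtain ⟨B', hB', hφ⟩ := φ.exists_norm_symbol_le
  have hI : 0 ≤ ∫ ζ : Euc d, polyWeight ζ := integral_nonneg fun ζ => (polyWeight_pos ζ).le
  set E : Euc d → ℝ := fun ζ => Real.exp (-M.assoc (κ * (2 * Real.pi * ‖ζ‖))) with hE
  have hτ : ∀ ζ : Euc d, 0 ≤ κ * (2 * Real.pi * ‖ζ‖) := fun ζ => by positivity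
  have hE0 : ∀ ζ, 0 < E ζ := fun ζ => Real.exp_pos _
  have hE1 : ∀ ζ, E ζ ≤ 1 := fun ζ => M.exp_neg_assoc_le_one (hτ ζ)
  have hkey : ∀ ζ, Real.exp (-M.assoc (H * (κ * (2 * Real.pi * ‖ζ‖)))) *
      Real.exp (M.assoc (κ * (2 * Real.pi * ‖ζ‖))) ≤ A * E ζ ^ 2 := fun ζ =>
    exp_neg_mul_exp_le hA hAH (hτ ζ)
  set V := volume.real (tsupport (χ : Euc d → ℂ)) with hV
  -- The radius 1 + 1/ε₀ ensures that the parameter ε chosen below is at most 1 and less than ε₀.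
  refine ⟨C₁ * V * A + (1 + B') * C₂ * B * A * D * ∫ ζ : Euc d, polyWeight ζ, 1 + 1 / ε₀,
    by positivity, by positivity, fun ξ hξ => ?_⟩
  have hpi : 3 < Real.pi := Real.pi_gt_three
  have hξ1 : 1 ≤ ‖ξ‖ := le_trans (by simp [hε₀.le]) hξ
  have hξ0 : 0 < ‖ξ‖ := by linarith
  have hε1 : 1 / (4 * Real.pi * ‖ξ‖) ≤ 1 := by
    rw [div_le_one (by positivity)]; nlinarith
  -- Now 1/ε is twice 2π|ξ|, so the symbol equals 1 on |ζ| ≤ 2|ξ|, and k/ε = 2k·2π|ξ|.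
  let ε : Set.Ioc (0 : ℝ) 1 := ⟨1 / (4 * Real.pi * ‖ξ‖), by positivity, hε1⟩
  have hε : (ε : ℝ) < ε₀ := by
    change 1 / (4 * Real.pi * ‖ξ‖) < ε₀
    rw [div_lt_iff₀ (by positivity)]
    have h1 : 1 / ε₀ < ‖ξ‖ := by linarith
    rw [div_lt_iff₀ hε₀] at h1
    have : 0 < ε₀ * ‖ξ‖ := by positivity
    nlinarith
  have hεinv : ∀ t : ℝ, t / (ε : ℝ) = 2 * t * (2 * Real.pi * ‖ξ‖) := fun t => by
    change t / (1 / (4 * Real.pi * ‖ξ‖)) = _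
    rw [div_div_eq_mul_div]; ring
  have hX := hasDecay_fourier (expTest χ ξ)
  have hXc := continuous_fourier_test (expTest χ ξ)
  have hi1 : Integrable fun ζ => 𝓕 (expTest χ ξ : Euc d → ℂ) ζ *
      (φ.symbol ε ζ * localFourier f θ ζ) := by
    refine ((hX.mul_bounded (by positivity) (hφ ε)).integrable_mul_localFourier hM
      (φ.continuous_symbol.mul hXc).aestronglyMeasurable f θ).congr
      (Filter.Eventually.of_forall fun ζ => ?_)
    simp only; ring
  have hi0 := hX.integrable_mul_localFourier hM hXc.aestronglyMeasurable f θ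
  have hsplit : localFourier f χ ξ =
      𝓕 (fun x => (χ : Euc d → ℂ) x * mollify φ θ f ε x) (-ξ) +
        ∫ ζ, 𝓕 (expTest χ ξ : Euc d → ℂ) ζ * ((1 - φ.symbol ε ζ) * localFourier f θ ζ) := by
    rw [localFourier, apply_eq_integral hM f θ (expTest χ ξ) fun x hx =>
      hθ x (tsupport_mul_subset_left hx), ← integral_symbol_mul, ← sub_eq_iff_eq_add',
      ← integral_sub hi0 hi1]
    refine integral_congr_ae (Filter.Eventually.of_forall fun ζ => ?_)
    simp only; ring
  -- Regularity costs e^{M(2k·2π|ξ|)} ≤ e^{M(κ·2π|ξ|)}. Smoothness gains e^{-M(2π|ξ|/h)} ≤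
  -- e^{-M(Hκ·2π|ξ|)}, which absorbs it and leaves a factor E(ξ).
  have hlow : ‖𝓕 (fun x => (χ : Euc d → ℂ) x * mollify φ θ f ε x) (-ξ)‖ ≤ C₁ * V * A * E ξ := by
    refine (norm_fourier_le (χ.2.1.mul (contDiff_mollify hM φ θ f ε)) χ.2.2.1.mul_right χ.2.2.1
      tsupport_mul_subset_left hh
      (mul_nonneg hC₁ (b := growth M k ε) (Real.exp_pos _).le) (H₁ ε hε) (-ξ)).trans ?_
    rw [norm_neg, growth, hεinv]
    have h1 : M.assoc (2 * k * (2 * Real.pi * ‖ξ‖)) ≤ M.assoc (κ * (2 * Real.pi * ‖ξ‖)) :=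
      M.assoc_mono' (by positivity) (by gcongr)
    have h2 : M.assoc (H * (κ * (2 * Real.pi * ‖ξ‖))) ≤ M.assoc (2 * Real.pi * ‖ξ‖ / h) := by
      refine M.assoc_mono' (by positivity) ?_
      rw [le_div_iff₀ hh]
      calc H * (κ * (2 * Real.pi * ‖ξ‖)) * h = (H * κ * h) * (2 * Real.pi * ‖ξ‖) := by ring
        _ ≤ 1 * (2 * Real.pi * ‖ξ‖) := by gcongr
        _ = _ := one_mul _
    calc C₁ * Real.exp (M.assoc (2 * k * (2 * Real.pi * ‖ξ‖))) * V *
          Real.exp (-M.assoc (2 * Real.pi * ‖ξ‖ / h))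
        ≤ C₁ * Real.exp (M.assoc (κ * (2 * Real.pi * ‖ξ‖))) * V *
          Real.exp (-M.assoc (H * (κ * (2 * Real.pi * ‖ξ‖)))) := by gcongr
      _ = C₁ * V * (Real.exp (-M.assoc (H * (κ * (2 * Real.pi * ‖ξ‖)))) *
          Real.exp (M.assoc (κ * (2 * Real.pi * ‖ξ‖)))) := by ring
      _ ≤ C₁ * V * (A * E ξ) := by
          refine mul_le_mul_of_nonneg_left ?_ (mul_nonneg hC₁ measureReal_nonneg)
          exact (hkey ξ).trans (mul_le_mul_of_nonneg_left
            (pow_le_of_le_one (hE0 ξ).le (hE1 ξ) two_ne_zero) hA)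
      _ = C₁ * V * A * E ξ := by ring
  have hhigh : ‖∫ ζ, 𝓕 (expTest χ ξ : Euc d → ℂ) ζ *
      ((1 - φ.symbol ε ζ) * localFourier f θ ζ)‖ ≤
      ∫ ζ : Euc d, (1 + B') * C₂ * B * A * D * E ξ * polyWeight ζ := by
    refine norm_integral_le_of_norm_le (integrable_polyWeight.const_mul _)
      (Filter.Eventually.of_forall fun ζ => ?_)
    have hpw := polyWeight_pos ζ
    by_cases hζ : 2 * Real.pi * ‖ζ‖ ≤ 1 / ε
    · rw [φ.symbol_eq_one ε.2.1 hζ, sub_self, zero_mul, mul_zero, norm_zero]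
      have := hE0 ξ
      positivity
    · rw [hεinv, not_le] at hζ
      have hζ' : 2 * ‖ξ‖ ≤ ‖ζ‖ := by
        have h2pi : 0 < 2 * Real.pi := by positivity
        refine le_of_mul_le_mul_left ?_ h2pi
        linarith
      -- From |ξ| ≤ |ζ|/2. The factor 2 lost here is the one in the decay rate 2Hκ of the transform
      -- of χ.
      have hdiff : ‖ζ‖ ≤ 2 * ‖ζ - ξ‖ := by
        have := norm_sub_norm_le ζ ξ
        linarith
      have h1 : ‖𝓕 (expTest χ ξ : Euc d → ℂ) ζ‖ ≤
          C₂ * Real.exp (-M.assoc (H * (κ * (2 * Real.pi * ‖ζ‖)))) := by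
        rw [fourier_expTest]
        refine (H₂ _).trans ?_
        gcongr
        refine M.assoc_mono' (by positivity) ?_
        calc H * (κ * (2 * Real.pi * ‖ζ‖)) = H * κ * (2 * Real.pi) * ‖ζ‖ := by ring
          _ ≤ H * κ * (2 * Real.pi) * (2 * ‖ζ - ξ‖) := by gcongr
          _ = _ := by ring
      have h2 : ‖1 - φ.symbol ε ζ‖ ≤ 1 + B' := by
        refine (norm_sub_le _ _).trans ?_
        rw [norm_one]
        gcongr
        exact hφ ε ζ
      have h3 : E ζ ≤ E ξ := by
        refine Real.exp_le_exp.2 (neg_le_neg (M.assoc_mono' (hτ ξ) ?_))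
        gcongr
        linarith
      have h4 : E ζ ≤ D * polyWeight ζ := by
        have := hw ζ
        rwa [mul_assoc κ] at this
      rw [norm_mul, norm_mul]
      calc ‖𝓕 (expTest χ ξ : Euc d → ℂ) ζ‖ * (‖1 - φ.symbol ε ζ‖ * ‖localFourier f θ ζ‖)
          ≤ C₂ * Real.exp (-M.assoc (H * (κ * (2 * Real.pi * ‖ζ‖)))) *
            ((1 + B') * (B * Real.exp (M.assoc (κ * (2 * Real.pi * ‖ζ‖))))) := by
            gcongr
            exact H₃ ζ
        _ = (1 + B') * C₂ * B * (Real.exp (-M.assoc (H * (κ * (2 * Real.pi * ‖ζ‖)))) *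
            Real.exp (M.assoc (κ * (2 * Real.pi * ‖ζ‖)))) := by ring
        _ ≤ (1 + B') * C₂ * B * (A * E ζ ^ 2) :=
            mul_le_mul_of_nonneg_left (hkey ζ) (by positivity)
        _ = (1 + B') * C₂ * B * (A * (E ζ * E ζ)) := by ring
        -- One factor E(ζ) gives the decay in ξ, the other makes the integral over ζ converge.
        _ ≤ (1 + B') * C₂ * B * (A * (E ξ * (D * polyWeight ζ))) := by
            have := hE0 ζ
            have := hE0 ξ
            gcongr
        _ = _ := by ring
  rw [hsplit]
  refine (norm_add_le_of_le hlow hhigh).trans (le_of_eq ?_)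
  rw [integral_const_mul]
  ring

/-- On a ball the transform is bounded and e^{-M} is bounded below, so enlarging the constant
suffices. -/
theorem localFourier_bound_of_far (f : Ultradistribution c M Ω) (χ : testFunctions c M Ω)
    {κ : ℝ} (hκ : 0 < κ) (H : ∃ C R : ℝ, 0 ≤ C ∧ 0 ≤ R ∧ ∀ ξ, R ≤ ‖ξ‖ →
      ‖localFourier f χ ξ‖ ≤ C * Real.exp (-M.assoc (κ * (2 * Real.pi * ‖ξ‖)))) :
    ∃ C : ℝ, 0 ≤ C ∧ ∀ ξ,
      ‖localFourier f χ ξ‖ ≤ C * Real.exp (-M.assoc (κ * (2 * Real.pi * ‖ξ‖))) := by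
  obtain ⟨C, R, hC, hR, H⟩ := H
  obtain ⟨s, hs, B, hB, hf⟩ := exists_testBound' f χ
  set C' := B * Real.exp (M.assoc (2 * Real.pi * R / s)) *
    Real.exp (M.assoc (κ * (2 * Real.pi * R))) with hC'
  have hC'0 : 0 ≤ C' := by positivity
  refine ⟨C + C', by positivity, fun ξ => ?_⟩
  rcases le_total R ‖ξ‖ with h | h
  · refine (H ξ h).trans ?_
    gcongr
    linarith
  · calc ‖localFourier f χ ξ‖ ≤ B * Real.exp (M.assoc (2 * Real.pi * ‖ξ‖ / s)) :=
          hf.norm_localFourier_le hs ξ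
      _ ≤ B * Real.exp (M.assoc (2 * Real.pi * R / s)) := by
          gcongr
          exact M.assoc_mono' (by positivity) (by gcongr)
      _ = C' * Real.exp (-M.assoc (κ * (2 * Real.pi * R))) := by
          rw [hC', mul_assoc (B * _), ← Real.exp_add, add_neg_cancel, Real.exp_zero, mul_one]
      _ ≤ (C + C') * Real.exp (-M.assoc (κ * (2 * Real.pi * ‖ξ‖))) := by
          gcongr
          · linarith
          · exact M.assoc_mono' (by positivity) (by gcongr)

/-- If the mollified net is regular near the support of `χ`, then `χ f` has a rapidly decaying
Fourier transform. -/
theorem hasDecay_localFourier (hM : M.ModerateGrowth) (φ : Mollifier N d)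
    (f : Ultradistribution c M Ω) (θ χ : testFunctions c M Ω)
    {U : TopologicalSpace.Opens (Euc d)} (hθ : ∀ x ∈ U, (θ : Euc d → ℂ) x = 1)
    (hχU : tsupport (χ : Euc d → ℂ) ⊆ U) (hreg : mollify φ θ f ∈ regularNets c M U) :
    HasDecay c M (localFourier f χ) := by
  obtain ⟨A, H, hA, hH, -, hAH⟩ := hM.exp_neg_le
  have hA0 : 0 ≤ A := by linarith
  have hH0 : 0 < H := by linarith
  have hq : ∀ ε, ∀ x ∈ tsupport (χ : Euc d → ℂ), ContDiffAt ℝ ∞ (mollify φ θ f ε) x :=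
    fun ε x _ => (contDiff_mollify hM φ θ f ε).contDiffAt
  have hg : ∀ k ε, 0 ≤ growth M k ε := fun _ _ => (Real.exp_pos _).le
  have key : ∀ κ k h h₂ A₂ C₂ B s : ℝ, 0 < κ → 0 < k → 0 < h → 0 < h₂ → 0 ≤ A₂ → 0 ≤ C₂ → 0 ≤ B →
      0 < s → 2 * k ≤ κ → H * κ * ((d + 1) * (h₂ + (d + 1) * h)) ≤ 1 → 1 / s ≤ κ →
      NormBigO M h (tsupport (χ : Euc d → ℂ)) (mollify φ θ f) (growth M k) →
      DerivBound M h₂ A₂ Set.univ (χ : Euc d → ℂ) →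
      (∀ ζ, ‖𝓕 (χ : Euc d → ℂ) ζ‖ ≤
        C₂ * Real.exp (-M.assoc (2 * H * κ * (2 * Real.pi * ‖ζ‖)))) →
      TestBound f θ s B → ∃ C : ℝ, 0 ≤ C ∧ ∀ ξ,
        ‖localFourier f χ ξ‖ ≤ C * Real.exp (-M.assoc (κ * (2 * Real.pi * ‖ξ‖))) := by
    intro κ k h h₂ A₂ C₂ B s hκ hk hh hh₂ hA₂ hC₂ hB hs hkκ hhκ hsκ H₁ Hχ H₂ H₃
    obtain ⟨C₁, ε₀, hC₁, hε₀, H₁⟩ := (NormBigO.testMul χ.2.1 hq hh hh₂ hA₂ Hχ (hg k)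
      (H₁.subset Set.inter_subset_left)).derivBound (by positivity) (hg k)
    refine localFourier_bound_of_far f χ hκ (localFourier_decay_aux hM hA0 hH0 hAH φ f θ χ
      (fun x hx => hθ x (hχU hx)) hκ hk (by positivity) hkκ hhκ hC₁ hC₂ hB hε₀ H₁ H₂ fun ζ =>
        (H₃.norm_localFourier_le hs ζ).trans ?_)
    gcongr
    refine M.assoc_mono' (by positivity) ?_
    rw [div_eq_mul_one_div, mul_comm]
    gcongr
  have hreg := hreg.2 _ χ.2.2.1 hχU
  have hf := exists_testBound f θ
  have hχd := χ.2.2.2.2.derivBound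
  have hχF := hasDecay_fourier χ
  have hd : (0 : ℝ) < d + 1 := by positivity
  cases c with
  | beurling =>
    intro κ₀ hκ₀
    obtain ⟨k, hk, hreg⟩ := hreg
    obtain ⟨s, hs, B, hB, hf⟩ := hf
    -- The numbers k and s are given, so κ is enlarged to meet 2k ≤ κ and 1/s ≤ κ. Then h₂ and (d +
    -- 1)h are each set to half of 1/(Hκ(d + 1)), which gives equality in the remaining constraint.
    set κ := max κ₀ (max (2 * k) (1 / s)) with hκdef
    have hκ : 0 < κ := lt_max_of_lt_left hκ₀
    have hh₂ : 0 < 1 / (H * κ) / (d + 1) / 2 := by positivity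
    have hh : 0 < 1 / (H * κ) / (d + 1) / 2 / (d + 1) := by positivity
    obtain ⟨A₂, hA₂, hχd⟩ := hχd _ hh₂
    obtain ⟨C₂, hC₂, hχF⟩ := hχF (2 * H * κ) (by positivity)
    obtain ⟨C, hC, hb⟩ := key κ k _ _ A₂ C₂ B s hκ hk hh hh₂ hA₂ hC₂ hB hs
      ((le_max_left _ _).trans (le_max_right _ _)) (le_of_eq (by field_simp; norm_num))
      ((le_max_right _ _).trans (le_max_right _ _)) (hreg _ hh) hχd hχF hf
    refine ⟨C, hC, fun ζ => (hb ζ).trans ?_⟩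
    gcongr
    exact M.assoc_mono' (by positivity) (by gcongr; exact le_max_left _ _)
  | roumieu =>
    obtain ⟨h, hh, hreg⟩ := hreg
    obtain ⟨h₂, hh₂, A₂, hA₂, hχd⟩ := hχd
    obtain ⟨κ', hκ', C₂, hC₂, hχF⟩ := hχF
    set h' : ℝ := (d + 1) * (h₂ + (d + 1) * h) with hh'
    have hh'0 : 0 < h' := by positivity
    -- Here h, h₂ and the decay rate κ' of the transform of χ are given, so κ is made small.
    -- Afterwards k = κ/2 and s = 1/κ are free choices.
    set κ := min (1 / (H * h')) (κ' / (2 * H)) with hκdef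
    have hκ : 0 < κ := lt_min (by positivity) (by positivity)
    obtain ⟨B, hB, hf⟩ := hf (1 / κ) (by positivity)
    refine ⟨κ, hκ, key κ (κ / 2) h h₂ A₂ C₂ B (1 / κ) hκ (by positivity) hh hh₂ hA₂ hC₂ hB
      (by positivity) (by linarith) ?_ (by simp) (hreg _ (by positivity)) hχd
      (fun ζ => (hχF ζ).trans ?_) hf⟩
    · have := min_le_left (1 / (H * h')) (κ' / (2 * H))
      rw [← hκdef, le_div_iff₀ (by positivity)] at this
      linarith
    · have := min_le_right (1 / (H * h')) (κ' / (2 * H))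
      rw [← hκdef, le_div_iff₀ (by positivity)] at this
      gcongr
      exact M.assoc_mono' (by positivity) (by gcongr; linarith)

end

/-! ### Regular ultradistributions are ultradifferentiable -/

section

variable {c : UltraClass} {M N : WeightSequence} {Ω : TopologicalSpace.Opens (Euc d)}

/-- The decay scale is at most 1 and the growth scale at least 1. Regularity is therefore
independent of the representative. -/
theorem negligibleNets_le (c : UltraClass) (M : WeightSequence)
    (Ω : TopologicalSpace.Opens (Euc d)) : negligibleNets c M Ω ≤ regularNets c M Ω := by
  refine fun q hq => ⟨hq.1, fun K hK hKΩ => ?_⟩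
  have h := hq.2 K hK hKΩ
  have hle : ∀ k k' : ℝ, 0 < k → 0 < k' → ∀ ε : Set.Ioc (0 : ℝ) 1,
      decay M k ε ≤ growth M k' ε := fun k k' hk hk' ε => by
    have hε := ε.2.1
    exact (M.exp_neg_assoc_le_one (by positivity)).trans (M.one_le_exp_assoc (by positivity))
  cases c with
  | beurling =>
    exact ⟨1, one_pos, fun h' hh => (h h' hh 1 one_pos).weaken hh le_rfl (hle _ _ one_pos one_pos)⟩
  | roumieu =>
    obtain ⟨k, hk, h, hh, b⟩ := h
    exact ⟨h, hh, fun k' hk' => b.weaken hh le_rfl (hle _ _ hk hk')⟩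

theorem regularNets_mono {U : TopologicalSpace.Opens (Euc d)} (hU : U ≤ Ω) :
    regularNets c M Ω ≤ regularNets c M U := fun _ hq =>
  ⟨fun ε => ⟨(hq.1 ε).1.mono hU, fun K hK hKU => (hq.1 ε).2 K hK (hKU.trans hU)⟩,
    fun K hK hKU => hq.2 K hK (hKU.trans hU)⟩

/-- The value |g(x)| does not depend on ε, yet it is at most a constant times a scale that is O(ε).
This makes the local representatives of f agree pointwise. -/
theorem eq_zero_of_const_mem_negligibleNets {g : Euc d → ℂ}
    (H : (fun _ => g) ∈ negligibleNets c M Ω) {x : Euc d} (hx : x ∈ Ω) : g x = 0 := by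
  have h : ∃ h k : ℝ, 0 < h ∧ 0 < k ∧ NormBigO M h {x} (fun _ => g) (decay M k) := by
    have := H.2 {x} isCompact_singleton (by simpa using hx)
    cases c with
    | beurling => exact ⟨1, 1, one_pos, one_pos, this 1 one_pos 1 one_pos⟩
    | roumieu => obtain ⟨k, hk, h, hh, b⟩ := this; exact ⟨h, k, hh, hk, b⟩
  obtain ⟨h, k, hh, hk, b⟩ := h
  obtain ⟨C, ε₀, hC, hε₀, b⟩ := b.derivBound hh fun _ => (Real.exp_pos _).le
  obtain ⟨D, hD, hdec⟩ := M.exp_neg_assoc_tendsto hk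
  by_contra h0
  have hpos : 0 < ‖g x‖ := norm_pos_iff.2 h0
  -- The last entry makes CDε smaller than |g(x)|, contradicting |g(x)| ≤ CDε.
  set ε := min (min 1 (ε₀ / 2)) (‖g x‖ / (2 * (C * D + 1))) with hε
  have hCD : 0 ≤ C * D := mul_nonneg hC hD
  have hε0 : 0 < ε := lt_min (lt_min one_pos (by positivity)) (by positivity)
  have h1 : ε ≤ 1 := (min_le_left _ _).trans (min_le_left _ _)
  have h2 : ε < ε₀ := ((min_le_left _ _).trans (min_le_right _ _)).trans_lt (by linarith)
  have h3 : ε ≤ ‖g x‖ / (2 * (C * D + 1)) := min_le_right _ _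
  have h4 : ‖g x‖ ≤ C * decay M k ε := by
    simpa [M.zero, decay] using b ⟨ε, hε0, h1⟩ h2 x rfl 0
  have h5 : C * decay M k ε ≤ C * (D * ε) := mul_le_mul_of_nonneg_left (hdec ε hε0) hC
  rw [le_div_iff₀ (by positivity)] at h3
  nlinarith

/-- Near a point where `χ = 1`, the function representing `χ f` is the limit of the net. -/
theorem fourier_localFourier_sub_mem (hM : M.ModerateGrowth) (φ : Mollifier N d)
    (f : Ultradistribution c M Ω) (χ : testFunctions c M Ω) (H : HasDecay c M (localFourier f χ))
    (U : TopologicalSpace.Opens (Euc d)) :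
    (fun _ => 𝓕 (localFourier f χ)) - mollify φ χ f ∈ negligibleNets c M U := by
  have hm := (continuous_localFourier f χ).aestronglyMeasurable (μ := volume)
  obtain ⟨B, hB, hφ⟩ := φ.exists_norm_symbol_le
  refine ⟨fun ε => sub_mem ⟨(H.contDiff_fourier hM hm).contDiffOn,
    fun K _ _ => H.hasUltraBound_fourier hM hm K⟩ ((mollify_mem_moderateNets hM φ χ f U).1 ε),
    fun K _ hKU => NegligibleOn.congr U.isOpen hKU (fun ε x _ => ?_) (H.negligibleOn hM φ hm K)⟩
  have hI := (H.mul_bounded (by positivity) (hφ ε)).integrable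
    (φ.continuous_symbol.aestronglyMeasurable.mul hm)
  simp only [sub_mul, one_mul]
  rw [fourier_sub_apply (H.integrable hm) hI, Pi.sub_apply, mollify_eq_fourier, Pi.sub_apply]

/-- A cut-off equal to `1` near `K` together with a cut-off equal to `1` near its support. -/
theorem exists_cutoff_hasDecay (hM : M.ModerateGrowth)
    (hMN : ∀ l : ℝ, 0 < l → ∃ C : ℝ, 0 < C ∧ ∀ t : ℝ, 0 ≤ t → 2 * M.assoc t ≤ N.assoc (l * t) + C)
    (φ : Mollifier N d) (f : Ultradistribution c M Ω) {r : Net d} (hr : r ∈ regularNets c M Ω)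
    (hrf : ∀ (U : TopologicalSpace.Opens (Euc d)) (θ : testFunctions c M Ω), U ≤ Ω →
      (∀ x ∈ U, (θ : Euc d → ℂ) x = 1) → r - mollify φ θ f ∈ negligibleNets c M U)
    {K : Set (Euc d)} (hK : IsCompact K) (hKΩ : K ⊆ Ω) :
    ∃ (χ : testFunctions c M Ω) (V : TopologicalSpace.Opens (Euc d)), K ⊆ V ∧ V ≤ Ω ∧
      (∀ x ∈ V, (χ : Euc d → ℂ) x = 1) ∧ HasDecay c M (localFourier f χ) ∧
      (fun _ => 𝓕 (localFourier f χ)) - r ∈ negligibleNets c M V := by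
  obtain ⟨χ, V, hKV, hVΩ, hχ⟩ := exists_cutoff hMN φ c hK hKΩ
  obtain ⟨θ, U, hχU, hUΩ, hθ⟩ := exists_cutoff hMN φ c χ.2.2.1 χ.2.2.2.1
  have hreg : mollify φ θ f ∈ regularNets c M U := by
    have := sub_mem (regularNets_mono hUΩ hr) (negligibleNets_le c M U (hrf U θ hUΩ hθ))
    rwa [sub_sub_cancel] at this
  have hdec := hasDecay_localFourier hM φ f θ χ hθ hχU hreg
  refine ⟨χ, V, hKV, hVΩ, hχ, hdec, ?_⟩
  have := sub_mem (fourier_localFourier_sub_mem hM φ f χ hdec V) (hrf V χ hVΩ hχ)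
  rwa [sub_sub_sub_cancel_right] at this

theorem exists_eq_ofUltraSmooth (hM : M.ModerateGrowth)
    (hMN : ∀ l : ℝ, 0 < l → ∃ C : ℝ, 0 < C ∧ ∀ t : ℝ, 0 ≤ t → 2 * M.assoc t ≤ N.assoc (l * t) + C)
    (φ : Mollifier N d) (f : Ultradistribution c M Ω) {r : Net d} (hr : r ∈ regularNets c M Ω)
    (hrf : ∀ (U : TopologicalSpace.Opens (Euc d)) (θ : testFunctions c M Ω), U ≤ Ω →
      (∀ x ∈ U, (θ : Euc d → ℂ) x = 1) → r - mollify φ θ f ∈ negligibleNets c M U) :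
    ∃ u : ultraSmooth c M Ω, f = ofUltraSmooth u := by
  have hcut : ∀ K : Set (Euc d), IsCompact K ∧ K ⊆ Ω → _ := fun K hK =>
    exists_cutoff_hasDecay hM hMN φ f hr hrf hK.1 hK.2
  choose! χ V hKV hVΩ hχ hdec hneg using hcut
  have hpt : ∀ x ∈ Ω, IsCompact ({x} : Set (Euc d)) ∧ {x} ⊆ (Ω : Set (Euc d)) := fun x hx =>
    ⟨isCompact_singleton, by simpa using hx⟩
  -- The value at x is read off from the cut-off attached to {x}. Any other compact set whose
  -- neighbourhood contains x gives the same value, because both constant nets differ from `r` by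
  -- negligible nets near x.
  let u : Euc d → ℂ := fun x => 𝓕 (localFourier f (χ {x})) x
  have hu : ∀ K : Set (Euc d), IsCompact K ∧ K ⊆ Ω → ∀ x ∈ V K,
      u x = 𝓕 (localFourier f (χ K)) x := by
    intro K hK x hx
    have hx' := hpt x (hVΩ K hK hx)
    have h := sub_mem (negligibleNets_mono (inf_le_left : V {x} ⊓ V K ≤ _) (hneg {x} hx'))
      (negligibleNets_mono (inf_le_right : V {x} ⊓ V K ≤ _) (hneg K hK))
    rw [sub_sub_sub_cancel_right] at h
    exact sub_eq_zero.1 (eq_zero_of_const_mem_negligibleNets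
      (g := 𝓕 (localFourier f (χ {x})) - 𝓕 (localFourier f (χ K))) h ⟨hKV {x} hx' rfl, hx⟩)
  have hm : ∀ χ, AEStronglyMeasurable (localFourier f χ) := fun χ =>
    (continuous_localFourier f χ).aestronglyMeasurable
  have humem : u ∈ ultraSmooth c M Ω := mem_ultraSmooth_of_local fun K hK hKΩ =>
    ⟨V K, hKV K ⟨hK, hKΩ⟩, _, ⟨((hdec K ⟨hK, hKΩ⟩).contDiff_fourier hM (hm _)).contDiffOn,
      fun K' _ _ => (hdec K ⟨hK, hKΩ⟩).hasUltraBound_fourier hM (hm _) K'⟩, hu K ⟨hK, hKΩ⟩⟩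
  refine ⟨⟨u, humem⟩, Subtype.ext (LinearMap.ext fun ψ => ?_)⟩
  have hψ : IsCompact (tsupport (ψ : Euc d → ℂ)) ∧ tsupport (ψ : Euc d → ℂ) ⊆ Ω :=
    ⟨ψ.2.2.1, ψ.2.2.2.1⟩
  set K := tsupport (ψ : Euc d → ℂ) with hKdef
  -- Parseval writes f(ψ) as the pairing of the transform of ψ with that of χf. Moving the transform
  -- to the other factor gives the integral of ψ against the function representing χf, which is u on
  -- supp ψ.
  rw [ofUltraSmooth_apply, apply_eq_integral hM f (χ K) ψ fun x hx => hχ K hψ x (hKV K hψ hx),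
    integral_fourier_mul (integrable_test ψ) ((hdec K hψ).integrable (hm _))]
  refine integral_congr_ae (Filter.Eventually.of_forall fun x => ?_)
  by_cases hx : x ∈ K
  · simp only
    rw [hu K hψ x (hKV K hψ hx), mul_comm]
  · simp only
    rw [image_eq_zero_of_notMem_tsupport hx, zero_mul, mul_zero]

theorem embedding_mem_regularGenFun_iff (hM : M.ModerateGrowth)
    (hMN : ∀ l : ℝ, 0 < l → ∃ C : ℝ, 0 < C ∧ ∀ t : ℝ, 0 ≤ t → 2 * M.assoc t ≤ N.assoc (l * t) + C)
    (φ : Mollifier N d) (f : Ultradistribution c M Ω) :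
    embedding φ f ∈ regularGenFun c M Ω ↔ ∃ u : ultraSmooth c M Ω, f = ofUltraSmooth u := by
  refine ⟨fun h => ?_, fun ⟨u, hu⟩ => hu ▸ embedding_ofUltraSmooth_mem hM hMN φ u⟩
  obtain ⟨r', hr', hrf⟩ := (isImage_iff hM hMN φ f _).2 rfl
  obtain ⟨r, hr, hrr⟩ := h
  refine exists_eq_ofUltraSmooth hM hMN φ f (r := r) hr fun U θ hU hθ => ?_
  -- The regular representative and the one supplied by the embedding differ by a negligible net, so
  -- the regular one satisfies the same local comparison with the mollified nets.
  have h1 := GenFun.mk_eq_mk_iff.1 (hrr.trans hr'.symm)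
  have := add_mem (negligibleNets_mono hU h1) (hrf U θ hU hθ)
  rwa [sub_add_sub_cancel] at this

end

end UltraAlg

theorem mainTheorem3 (c : UltraClass) {d : ℕ} (hd : 0 < d) (M N : WeightSequence)
    (hM : M.ModerateGrowth)
    (hMN : ∀ l : ℝ, 0 < l → ∃ C : ℝ, 0 < C ∧ ∀ t : ℝ, 0 ≤ t → 2 * M.assoc t ≤ N.assoc (l * t) + C)
    (φ : Mollifier N d) (Ω : TopologicalSpace.Opens (Euc d)) :
    (∀ (f : Ultradistribution c M Ω) (g : GenFun c M Ω), IsImage φ f g ↔ g = embedding φ f) ∧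
    (regularGenFun c M Ω : Set (GenFun c M Ω)) ∩
        Set.range (embedding φ : Ultradistribution c M Ω → GenFun c M Ω) =
      embedding φ '' Set.range (ofUltraSmooth : ultraSmooth c M Ω → Ultradistribution c M Ω) ∧
    ∀ f : Ultradistribution c M Ω, embedding φ f ∈ regularGenFun c M Ω ↔
      ∃ u : ultraSmooth c M Ω, f = ofUltraSmooth u := by
  refine ⟨isImage_iff hM hMN φ, ?_, embedding_mem_regularGenFun_iff hM hMN φ⟩
  ext g
  constructor
  · rintro ⟨hg, f, rfl⟩
    obtain ⟨u, rfl⟩ := (embedding_mem_regularGenFun_iff hM hMN φ f).1 hg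
    exact ⟨_, ⟨u, rfl⟩, rfl⟩
  · rintro ⟨_, ⟨u, rfl⟩, rfl⟩
    exact ⟨embedding_ofUltraSmooth_mem hM hMN φ u, _, rfl⟩
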